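/- **Theorem (Group III interactions: overtaking backward waves).** Let $\gamma>1$ and set $$a=\frac{\gamma-1}{\gamma+1},\quad \kappa=\sqrt{1-a},\quad \nu=\frac{\sqrt{1-a^2}}{a},\quad \zeta=\frac{a}{1+a}=\frac{\gamma-1}{2\gamma}.$$ Consider the 1-d Euler equations of an ideal polytropic gas in Lagrangian coordinates, with states $(\tau,u,p)$ (specific volume, velocity, pressure), $\tau,p>0$. The state to the right of a backward wave of strength (pressure ratio right/left) $b$, of a contact of strength (specific volume ratio right/left) $c$, and of a forward wave of strength (pressure ratio) $f$, with left state $(\bar\tau,\bar u,\bar p)$, is respectively $$\big(\phi_-(b)\bar\tau,\ \bar u-\psi_-(b)\sqrt{\bar\tau\bar p},\ b\bar p\big),\qquad (c\bar\tau,\bar u,\bar p),\qquad \big(\phi_+(f)\bar\tau,\ \bar u+\psi_+(f)\sqrt{\bar\tau\bar p},\ f\bar p\big),$$ where $\phi_-(q)=q^{-1/\gamma}$, $\psi_-(q)=\nu(q^\zeta-1)$ for $0<q\le 1$ (rarefaction) and $\phi_-(q)=\frac{1+aq}{q+a}$, $\psi_-(q)=\frac{\kappa(q-1)}{\sqrt{q+a}}$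 for $q>1$ (shock), while $\phi_+,\psi_+$ are given by the same two pairs of formulas, the first pair for $q\ge1$ (rarefaction) and the second for $0<q<1$ (shock). Two backward waves of strengths $x$ (left) and $y$ (right), with extreme left state $U$, determine an extreme right state $V$. The outgoing strengths $B,C,F>0$ (backward wave, contact, forward wave) are those whose successive composition connects $U$ to $V$. A vacuum is produced when $u_V-u_U\ge\frac{2}{\gamma-1}(\mathfrak c_U+\mathfrak c_V)$, $\mathfrak c=\sqrt{\gamma\tau p}$; the outgoing backward and forward waves are then rarefactions. The interactions are $SS$ ($x,y>1$), $SR$ ($0<y<1<x$) and $RS$ ($0<x<1<y$); two rarefactions do not meet. Loci are taken in $D=\{x,y>0:\ x\ge1\text{ or }y\ge1\}$ (a wave of strength $1$ is no wave). For $(x,y)\in D$ and every $U$, either a vacuum is produced and there are no outgoing strengths $(B,C,F)$, or no vacuum is produced and there is exactly one triple $(B,C,F)$. Let $\alpha=\psi_+-\psi_-$. There is $y_0=y_0(\gamma)>0$ such that the positive zeros of $\alpha$ are exactly $1$ and $y_0$, and $y_0=1$ if and only if $\gamma=\frac53$. There are functions $k,h$ depending only on $\gamma$ such that the following holds for all left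 states $U$. (i) On $D$, $\{B=1\}$ is the graph $y=k(x)$, where $k$ is a $C^2$, strictly decreasing function on $(0,\infty)$ with $k(1)=1$, $k(x)\to\infty$ as $x\downarrow0$, and $k(x)\to\hat y(\gamma):=\big[\frac12(1-\sqrt\zeta)\big]^{1/\zeta}\in(0,1)$ as $x\to\infty$. The outgoing backward wave is a shock ($B>1$) if and only if $y>k(x)$. (ii) On $D$, $\{F=1\}$ is the union of $\{x=1\}$, $\{y=1\}$ and a graph $y=h(x)$ of a continuous positive function $h$ defined on $(1,\infty)$ if $\gamma<\frac53$, on $[1,\infty)$ if $\gamma=\frac53$, and on $(0,\infty)$ if $\gamma>\frac53$. - If $\gamma\le\frac53$, then $h(x)<1$ for $x>1$. If $\frac53<\gamma<2$, then, with $\bar x=\frac{4a^2}{1-3a}>1$, $h<1$ exactly for $x>\bar x$ and $h=1$ exactly at $\bar x$. If $\gamma\ge2$, then $h>1$ everywhere. - The outgoing forward wave is a rarefaction ($F>1$ or vacuum), respectively a shock ($F<1$), if and only if: in $SS$, $y>h(x)$, respectively $y<h(x)$; in $SR$, $y<h(x)$, respectively $y>h(x)$; in $RS$ with $\gamma>\frac53$,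 $y<h(x)$, respectively $y>h(x)$. In $RS$ with $\gamma\le\frac53$ it is always a shock. - $h(x)\to y_*(\gamma)$ as $x\to\infty$, where $y_*>\hat y$, $y_*<1$ if $\gamma<2$, and $y_*=\frac{4a^2}{(1-a)^2}$ if $\gamma\ge2$. - The graphs of $h$ and $k$ intersect at $(\frac1{y_0},y_0)$ and only there; on the domain of $h$, $h(x)<k(x)$ exactly when $x<\frac1{y_0}$. (iii) The outgoing contact satisfies $C<1$ in $SS$ interactions and $C>1$ in $SR$ and $RS$ interactions. When a vacuum is produced in these, the latter is understood as an increase of the entropy $S=c_v\log(p\tau^\gamma/K)$ (for any positive constants $K,c_v$) from $U$ to $V$. (iv) A vacuum never appears in $SS$ and $RS$ interactions; in an $SR$ interaction it appears if and only if $$0<y\le\Big[\tfrac12\Big(1-\frac{v(x)}{\nu}\Big)\Big]^{1/\zeta},\qquad v(x)=\frac{\nu\sqrt{x+a}+\kappa(x-1)}{\sqrt{x+ax^2}}.$$ -/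

import Mathlib

open Filter Topology Set

noncomputable section

namespace Overtaking

/-- A state of the gas: specific volume, velocity, pressure. -/
structure GasState where
  τ : ℝ
  u : ℝ
  p : ℝ

/-- Physical (non-vacuum) states: positive specific volume and positive pressure. -/
def GasState.Physical (U : GasState) : Prop := 0 < U.τ ∧ 0 < U.p

/-- `a = (γ - 1) / (γ + 1)`. -/
def a (γ : ℝ) : ℝ := (γ - 1) / (γ + 1)

/-- `κ = √(1 - a)`. -/
def kappa (γ : ℝ) : ℝ := √(1 - a γ)

/-- `ν = √(1 - a²) / a`. -/
def nu (γ : ℝ) : ℝ := √(1 - a γ ^ 2) / a γ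

/-- `ζ = a / (1 + a) = (γ - 1) / (2 γ)`. -/
def zeta (γ : ℝ) : ℝ := a γ / (1 + a γ)

/-- Specific volume ratio across a backward wave of pressure ratio `b`
(rarefaction for `b < 1`, compressive shock for `b > 1`). -/
def phiB (γ b : ℝ) : ℝ := if b ≤ 1 then b ^ (-1 / γ) else (1 + a γ * b) / (b + a γ)

/-- Scaled velocity drop across a backward wave of pressure ratio `b`. -/
def psiB (γ b : ℝ) : ℝ :=
  if b ≤ 1 then nu γ * (b ^ zeta γ - 1) else kappa γ * (b - 1) / √(b + a γ)

/-- Specific volume ratio across a forward wave of pressure ratio `f`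
(rarefaction for `f > 1`, compressive shock for `f < 1`). -/
def phiF (γ f : ℝ) : ℝ := if 1 ≤ f then f ^ (-1 / γ) else (1 + a γ * f) / (f + a γ)

/-- Scaled velocity gain across a forward wave of pressure ratio `f`. -/
def psiF (γ f : ℝ) : ℝ :=
  if 1 ≤ f then nu γ * (f ^ zeta γ - 1) else kappa γ * (f - 1) / √(f + a γ)

/-- The state on the right of a backward wave of strength (pressure ratio right/left) `b`
with `U` on its left. -/
def backwardWave (γ b : ℝ) (U : GasState) : GasState where
  τ := phiB γ b * U.τ
  u := U.u - psiB γ b * √(U.τ * U.p)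
  p := b * U.p

/-- The state on the right of a contact of strength (specific volume ratio right/left) `c`
with `U` on its left. -/
def contactWave (c : ℝ) (U : GasState) : GasState where
  τ := c * U.τ
  u := U.u
  p := U.p

/-- The state on the right of a forward wave of strength (pressure ratio right/left) `f`
with `U` on its left. -/
def forwardWave (γ f : ℝ) (U : GasState) : GasState where
  τ := phiF γ f * U.τ
  u := U.u + psiF γ f * √(U.τ * U.p)
  p := f * U.p

/-- The Riemann problem with left state `U` and right state `V` is solved without vacuum by a
backward wave `B`, a contact `C` and a forward wave `F`. -/
def SolvesRiemann (γ : ℝ) (U V : GasState) (B C F : ℝ) : Prop :=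
  0 < B ∧ 0 < C ∧ 0 < F ∧ forwardWave γ F (contactWave C (backwardWave γ B U)) = V

/-- Local sound speed `√(γ τ p)`. -/
def soundSpeed (γ : ℝ) (U : GasState) : ℝ := √(γ * U.τ * U.p)

/-- A vacuum appears in the Riemann problem `(U, V)`: the complete backward rarefaction from `U`
down to zero pressure ends at a velocity `u_U + 2 c_U / (γ - 1)` which is at most the velocity
`u_V - 2 c_V / (γ - 1)` at which the complete forward rarefaction up to `V` begins. -/
def Vacuum (γ : ℝ) (U V : GasState) : Prop :=
  2 / (γ - 1) * (soundSpeed γ U + soundSpeed γ V) ≤ V.u - U.u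

/-- Specific entropy, from `p = K τ ^ (-γ) exp (S / c_v)`. -/
def specificEntropy (γ K cv : ℝ) (U : GasState) : ℝ := cv * Real.log (U.p * U.τ ^ γ / K)

/-- The extreme right state of two consecutive backward waves of strengths `x` (left) and
`y` (right), with extreme left state `U`. -/
def rightState (γ : ℝ) (U : GasState) (x y : ℝ) : GasState :=
  backwardWave γ y (backwardWave γ x U)

/-- `B`, `C`, `F` are the strengths of the outgoing waves when two backward waves of strengths
`x` (left) and `y` (right), with extreme left state `U`, interact without producing a vacuum. -/
def Outgoing (γ : ℝ) (U : GasState) (x y B C F : ℝ) : Prop :=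
  SolvesRiemann γ U (rightState γ U x y) B C F

/-- The interaction of the waves `x`, `y` produces a vacuum. -/
def ProducesVacuum (γ : ℝ) (U : GasState) (x y : ℝ) : Prop :=
  Vacuum γ U (rightState γ U x y)

/-- The outgoing backward wave is a shock. -/
def BackwardShock (γ : ℝ) (U : GasState) (x y : ℝ) : Prop :=
  ∃ B C F, Outgoing γ U x y B C F ∧ 1 < B

/-- The outgoing forward wave is a shock. -/
def ForwardShock (γ : ℝ) (U : GasState) (x y : ℝ) : Prop :=
  ∃ B C F, Outgoing γ U x y B C F ∧ F < 1

/-- The outgoing forward wave is a rarefaction; this includes the forward rarefaction adjacent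
to a vacuum. -/
def ForwardRarefaction (γ : ℝ) (U : GasState) (x y : ℝ) : Prop :=
  ProducesVacuum γ U x y ∨ ∃ B C F, Outgoing γ U x y B C F ∧ 1 < F

/-- Incoming pair shock - shock. -/
def IsSS (x y : ℝ) : Prop := 1 < x ∧ 1 < y

/-- Incoming pair shock (left) - rarefaction (right). -/
def IsSR (x y : ℝ) : Prop := 1 < x ∧ 0 < y ∧ y < 1

/-- Incoming pair rarefaction (left) - shock (right). -/
def IsRS (x y : ℝ) : Prop := 0 < x ∧ x < 1 ∧ 1 < y

/-- The quarter plane of incoming strengths with the rarefaction - rarefaction region (where the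
waves do not meet) removed. The lines `x = 1` and `y = 1`, on which one of the incoming waves is
absent, are included. -/
def IncomingRegion (x y : ℝ) : Prop := 0 < x ∧ 0 < y ∧ (1 ≤ x ∨ 1 ≤ y)

/-- `α(q)`: the forward minus the backward velocity function. -/
def alpha (γ q : ℝ) : ℝ := psiF γ q - psiB γ q

/-- `ŷ(γ) = [(1 - √ζ) / 2] ^ (1 / ζ)`. -/
def yHat (γ : ℝ) : ℝ := (1 / 2 * (1 - √(zeta γ))) ^ (1 / zeta γ)

/-- `x̄ = 4 a² / (1 - 3 a)`, only used for `5/3 < γ < 2`, that is `1/4 < a < 1/3`. -/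
def xBar (γ : ℝ) : ℝ := 4 * a γ ^ 2 / (1 - 3 * a γ)

/-- `v(x) = (ν √(x + a) + κ (x - 1)) / √(x + a x²)`. -/
def vFun (γ x : ℝ) : ℝ :=
  (nu γ * √(x + a γ) + kappa γ * (x - 1)) / √(x + a γ * x ^ 2)

/-- The domain of the third branch `y = h(x)` of the locus `F = 1`. -/
def hDomain (γ : ℝ) : Set ℝ :=
  {x | (γ < 5 / 3 ∧ 1 < x) ∨ (γ = 5 / 3 ∧ 1 ≤ x) ∨ (5 / 3 < γ ∧ 0 < x)}

end Overtaking

end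

/-!
After division by `ν √(τ p)` the velocity jump across a backward wave of strength `q` depends only
on `q` and `a`, and so does the factor by which `√(τ p)` changes; these are `vel a q` and
`imp a q`. A forward wave of strength `F` is a backward wave of strength `1 / F` read in the
opposite direction (`psiF_eq`). Matching pressures and specific volumes expresses `B` and `C`
through `G = 1 / F`, and the whole interaction problem becomes the scalar equation
`outVel a x y G = inVel a x y` (`outgoing_iff`). Its left side increases in `G` from
`-(1 + imp a x * imp a y)` to `∞`, and the vacuum condition says exactly that the right side does
not exceed that lower limit; hence the alternative between vacuum and a unique solution. Comparing
with the value at `G = 1 / (x y)`, where `B = 1`, and at `G = 1`, where `F = 1`, shows that the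
types of the outgoing waves are the signs of two explicit functions `bwd a x y` and `fwd a x y`.

*Backward wave.* `bwd` is strictly increasing in each variable; in `y` because `imp q / √q`
decreases and `vel q / √q` increases. Since `vel` and `imp` are of class `C²`, also at `q = 1` where
shock and rarefaction branches meet, the implicit function theorem gives the curve `k`
(`exists_backward_locus`).

*Forward wave.* `fwd` vanishes on `x = 1` and `y = 1`. For fixed `x` its `y`-derivative changes sign
only once, which is read off from the logarithm `ls` of the ratio of the slopes of the two branches
of `vel`: the derivative of `ls` has the explicit factor `(q - 1) ((1 - a) q - 2 a (1 + 2 a))`.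
Hence, for `x > 1`, `fwd a x` decreases and then increases, and besides `y = 1` it has one more zero
`h x`, which may coincide with `1`. For `x < 1` the same holds for `-fwd a x` on `y ≥ 1` if
`a > 1 / 4`, while for `a ≤ 1 / 4` there is no further zero (`exists_forward_branch`,
`fwd_neg_of_lt`). For `x > 1`, whether `h x` lies below or above `1` is the sign of the derivative at
`y = 1`, and this gives `x̄`. Dividing `fwd` by `x - 1` carries the
description across `x = 1` and makes `h` continuous there; only `a = 1 / 4`, where the branch starts
at `(1, 1)` as a degenerate zero, needs a separate argument (`fwd_pos_near_one`). The asymptote is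
the nontrivial zero of the limit of `fwd a x y / √x` (`exists_asymptote`).

*Intersection.* On the curve `k` the sign of `fwd` is decided by the hyperbola `x y = 1`, and on
the hyperbola `bwd` is, up to a positive factor, the function `-α`. Up to sign this is the
difference `gap` of the two branches of `vel`, which again decreases and then increases, and so has
a single zero `y₀` besides `1`, merging with it for `a = 1 / 4` (`exists_gap_root`,
`loci_crossing`).

*Contact.* `logExc` is proportional to the entropy jump of a wave; it vanishes on rarefactions and
increases along shocks, and `C < 1` compares its values on incoming and outgoing waves
(`contact_iff`). For `SR` and `RS` the outgoing backward wave is weaker than the incoming shock. For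
`SS` with an outgoing forward shock it suffices that one shock produces more entropy than several
shocks with the same total pressure ratio (`logExc_superadditive`). With an outgoing forward
rarefaction one has to see that the single shock with the entropy of the two incoming ones slows the
gas down too little. This follows by differentiating along the strength of the second shock
(`vel_add_imp_entShock_lt`, `entropy_SS`).
-/

noncomputable section

namespace Overtaking

/-! ### Gluing smooth branches at `q = 1` -/

lemma hasDerivAt_glue {f g f' g' : ℝ → ℝ} (hf : ∀ q, 0 < q → HasDerivAt f (f' q) q)
    (hg : ∀ q, 0 < q → HasDerivAt g (g' q) q) (h0 : f 1 = g 1) (h1 : f' 1 = g' 1)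
    {q : ℝ} (hq : 0 < q) :
    HasDerivAt (fun q => if q ≤ 1 then f q else g q) (if q ≤ 1 then f' q else g' q) q := by
  rcases lt_trichotomy q 1 with h | h | h
  · rw [if_pos h.le]
    refine (hf q hq).congr_of_eventuallyEq ?_
    filter_upwards [gt_mem_nhds h] with t ht
    rw [if_pos ht.le]
  · subst h
    rw [if_pos le_rfl, ← hasDerivWithinAt_univ, ← Iic_union_Ici (a := (1 : ℝ))]
    refine HasDerivWithinAt.union ?_ ?_
    · refine (hf 1 hq).hasDerivWithinAt.congr (fun t ht => ?_) ?_
      · exact if_pos ht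
      · rw [if_pos le_rfl]
    · rw [h1]
      refine (hg 1 hq).hasDerivWithinAt.congr (fun t ht => ?_) ?_
      · rcases eq_or_lt_of_le (show (1 : ℝ) ≤ t from ht) with h | h
        · rw [← h, if_pos le_rfl, h0]
        · rw [if_neg (not_le.2 h)]
      · rw [if_pos le_rfl, h0]
  · rw [if_neg (not_le.2 h)]
    refine (hg q hq).congr_of_eventuallyEq ?_
    filter_upwards [lt_mem_nhds h] with t ht
    rw [if_neg (not_le.2 ht)]

lemma continuousOn_glue {f g : ℝ → ℝ} (hf : ContinuousOn f (Ioi 0))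
    (hg : ContinuousOn g (Ioi 0)) (h0 : f 1 = g 1) :
    ContinuousOn (fun q => if q ≤ 1 then f q else g q) (Ioi 0) := by
  refine ContinuousOn.if ?_ (hf.mono inter_subset_left) (hg.mono inter_subset_left)
  rintro q ⟨_, hq⟩
  have : {q : ℝ | q ≤ 1} = Iic 1 := rfl
  rw [this, frontier_Iic] at hq
  rw [mem_singleton_iff.1 hq, h0]

lemma contDiffOn_two_of_hasDerivAt {f f' f'' : ℝ → ℝ} (h1 : ∀ q, 0 < q → HasDerivAt f (f' q) q)
    (h2 : ∀ q, 0 < q → HasDerivAt f' (f'' q) q) (h3 : ContinuousOn f'' (Ioi 0)) :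
    ContDiffOn ℝ 2 f (Ioi 0) := by
  have e2 : ContDiffOn ℝ 1 f' (Ioi 0) := by
    rw [show (1 : WithTop ℕ∞) = 0 + 1 from rfl, contDiffOn_succ_iff_deriv_of_isOpen isOpen_Ioi]
    refine ⟨fun q hq => (h2 q hq).differentiableAt.differentiableWithinAt, by simp, ?_⟩
    rw [contDiffOn_zero]
    exact h3.congr fun q hq => (h2 q hq).deriv
  rw [show (2 : WithTop ℕ∞) = 1 + 1 by norm_num, contDiffOn_succ_iff_deriv_of_isOpen isOpen_Ioi]
  refine ⟨fun q hq => (h1 q hq).differentiableAt.differentiableWithinAt, by simp, ?_⟩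
  exact e2.congr fun q hq => (h1 q hq).deriv

/-! ### The normalised wave curves -/

/-- The exponent `ζ` as a function of `a`. -/
def zet (a : ℝ) : ℝ := a / (1 + a)

/-- The shock branch of `ψ₋ / ν`, extended to all `q > 0`. -/
def sv (a q : ℝ) : ℝ := a * (q - 1) / √((1 + a) * (q + a))

/-- The derivative of `sv`. -/
def svd (a q : ℝ) : ℝ := a * (q + (1 + 2 * a)) / (2 * (q + a) * √((1 + a) * (q + a)))

/-- The normalised velocity drop `ψ₋ / ν` across a backward wave. -/
def vel (a q : ℝ) : ℝ := if q ≤ 1 then q ^ zet a - 1 else sv a q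

/-- The derivative of `vel`. -/
def veld (a q : ℝ) : ℝ := if q ≤ 1 then zet a * q ^ (zet a - 1) else svd a q

/-- The ratio of `τ p` across a backward wave. -/
def impSq (a q : ℝ) : ℝ := if q ≤ 1 then q ^ (2 * zet a) else q * (1 + a * q) / (q + a)

/-- The derivative of `impSq`. -/
def impSqd (a q : ℝ) : ℝ :=
  if q ≤ 1 then 2 * zet a * q ^ (2 * zet a - 1) else a * (q ^ 2 + 2 * a * q + 1) / (q + a) ^ 2

/-- The ratio of `√(τ p)` across a backward wave; on rarefactions it equals `1 + vel`. -/
def imp (a q : ℝ) : ℝ := √(impSq a q)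

section Basic

variable {a : ℝ}

lemma zet_pos (h0 : 0 < a) : 0 < zet a := by unfold zet; positivity

lemma zet_lt_half (h0 : 0 < a) (h1 : a < 1) : zet a < 1 / 2 := by
  unfold zet; rw [div_lt_div_iff₀ (by linarith) (by norm_num)]; linarith

lemma hasDerivAt_sv (h0 : 0 < a) {q : ℝ} (hq : 0 < q) : HasDerivAt (sv a) (svd a q) q := by
  have hp : 0 < (1 + a) * (q + a) := by positivity
  have hR : 0 < √((1 + a) * (q + a)) := Real.sqrt_pos.2 hp
  have hR2 : √((1 + a) * (q + a)) ^ 2 = (1 + a) * (q + a) := Real.sq_sqrt hp.le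
  have hd : HasDerivAt (fun q => √((1 + a) * (q + a)))
      (((1 + a) * 1) / (2 * √((1 + a) * (q + a)))) q :=
    (((hasDerivAt_id q).add_const a).const_mul (1 + a)).sqrt hp.ne'
  have hn : HasDerivAt (fun q : ℝ => a * (q - 1)) (a * 1) q :=
    ((hasDerivAt_id q).sub_const 1).const_mul a
  refine (hn.div hd hR.ne').congr_deriv ?_
  unfold svd
  set R := √((1 + a) * (q + a))
  have hqa : 0 < q + a := by positivity
  rw [div_eq_div_iff (by positivity) (by positivity)]
  field_simp
  rw [hR2]; ring

/-- The second derivative of the shock branch. -/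
lemma hasDerivAt_svd (h0 : 0 < a) {q : ℝ} (hq : 0 < q) :
    HasDerivAt (svd a)
      (-(a * (q + 3 + 4 * a)) / (4 * (q + a) ^ 2 * √((1 + a) * (q + a)))) q := by
  have hp : 0 < (1 + a) * (q + a) := by positivity
  have hR : 0 < √((1 + a) * (q + a)) := Real.sqrt_pos.2 hp
  have hR2 : √((1 + a) * (q + a)) ^ 2 = (1 + a) * (q + a) := Real.sq_sqrt hp.le
  have hd : HasDerivAt (fun q => √((1 + a) * (q + a)))
      (((1 + a) * 1) / (2 * √((1 + a) * (q + a)))) q :=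
    (((hasDerivAt_id q).add_const a).const_mul (1 + a)).sqrt hp.ne'
  have hn : HasDerivAt (fun q : ℝ => a * (q + (1 + 2 * a))) (a * 1) q :=
    ((hasDerivAt_id q).add_const _).const_mul a
  have hqa : 0 < q + a := by positivity
  have hm : HasDerivAt (fun q : ℝ => 2 * (q + a)) (2 * 1) q :=
    ((hasDerivAt_id q).add_const _).const_mul 2
  refine (hn.div (hm.mul hd) (mul_pos (by positivity) hR).ne').congr_deriv ?_
  simp only [Pi.mul_apply]
  set R := √((1 + a) * (q + a))
  rw [div_eq_div_iff (by positivity) (by positivity)]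
  field_simp
  rw [show R ^ 2 = (1 + a) * (q + a) from hR2]; ring

lemma sqrt_one_add_sq (h0 : 0 < a) : √((1 + a) * (1 + a)) = 1 + a :=
  Real.sqrt_mul_self (by linarith)

lemma hasDerivAt_vel (h0 : 0 < a) {q : ℝ} (hq : 0 < q) : HasDerivAt (vel a) (veld a q) q := by
  refine hasDerivAt_glue (f := fun q => q ^ zet a - 1) (g := sv a)
    (f' := fun q => zet a * q ^ (zet a - 1)) (g' := svd a) (fun q hq => ?_)
    (fun q hq => hasDerivAt_sv h0 hq) ?_ ?_ hq
  · exact (Real.hasDerivAt_rpow_const (Or.inl hq.ne')).sub_const 1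
  · simp [sv]
  · simp only [svd, Real.one_rpow, sqrt_one_add_sq h0, zet]
    field_simp; ring

lemma contDiffOn_vel (h0 : 0 < a) : ContDiffOn ℝ 2 (vel a) (Ioi 0) := by
  refine contDiffOn_two_of_hasDerivAt (f' := veld a) (fun q hq => hasDerivAt_vel h0 hq)
    (fun q hq => hasDerivAt_glue (f := fun q => zet a * q ^ (zet a - 1)) (g := svd a)
      (f' := fun q => zet a * ((zet a - 1) * q ^ (zet a - 1 - 1)))
      (g' := fun q => -(a * (q + 3 + 4 * a)) / (4 * (q + a) ^ 2 * √((1 + a) * (q + a))))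
      (fun q hq => ?_) (fun q hq => hasDerivAt_svd h0 hq) ?_ ?_ hq)
    (continuousOn_glue ?_ ?_ ?_)
  · exact (Real.hasDerivAt_rpow_const (Or.inl hq.ne')).const_mul _
  · simp only [svd, Real.one_rpow, sqrt_one_add_sq h0, zet]
    field_simp; ring
  · simp only [Real.one_rpow, sqrt_one_add_sq h0, zet]
    field_simp; ring
  · intro q hq
    exact ((Real.continuousAt_rpow_const q _ (Or.inl (ne_of_gt hq))).const_mul _).const_mul _
      |>.continuousWithinAt
  · intro q (hq : 0 < q)
    have hp : 0 < (1 + a) * (q + a) := by positivity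
    refine ContinuousAt.continuousWithinAt (ContinuousAt.div (by fun_prop) (by fun_prop) ?_)
    have := Real.sqrt_pos.2 hp
    positivity
  · simp only [Real.one_rpow, sqrt_one_add_sq h0, zet]
    field_simp; ring

lemma hasDerivAt_impSq (h0 : 0 < a) {q : ℝ} (hq : 0 < q) :
    HasDerivAt (impSq a) (impSqd a q) q := by
  refine hasDerivAt_glue (f := fun q => q ^ (2 * zet a)) (g := fun q => q * (1 + a * q) / (q + a))
    (f' := fun q => 2 * zet a * q ^ (2 * zet a - 1))
    (g' := fun q => a * (q ^ 2 + 2 * a * q + 1) / (q + a) ^ 2) (fun q hq => ?_)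
    (fun q hq => ?_) ?_ ?_ hq
  · exact Real.hasDerivAt_rpow_const (Or.inl hq.ne')
  · have hd : HasDerivAt (fun q : ℝ => q * (1 + a * q)) (1 * (1 + a * q) + q * (a * 1)) q :=
      (hasDerivAt_id q).mul (((hasDerivAt_id q).const_mul a).const_add 1)
    refine (hd.div ((hasDerivAt_id q).add_const a) (by simp; positivity)).congr_deriv ?_
    simp only [id]
    ring
  · simp; field_simp
  · simp [zet]; field_simp; ring

lemma contDiffOn_impSq (h0 : 0 < a) : ContDiffOn ℝ 2 (impSq a) (Ioi 0) := by
  refine contDiffOn_two_of_hasDerivAt (f' := impSqd a) (fun q hq => hasDerivAt_impSq h0 hq)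
    (fun q hq => hasDerivAt_glue (f := fun q => 2 * zet a * q ^ (2 * zet a - 1))
      (g := fun q => a * (q ^ 2 + 2 * a * q + 1) / (q + a) ^ 2)
      (f' := fun q => 2 * zet a * ((2 * zet a - 1) * q ^ (2 * zet a - 1 - 1)))
      (g' := fun q => 2 * a * (a ^ 2 - 1) / (q + a) ^ 3)
      (fun q hq => ?_) (fun q hq => ?_) ?_ ?_ hq)
    (continuousOn_glue ?_ ?_ ?_)
  · exact (Real.hasDerivAt_rpow_const (Or.inl hq.ne')).const_mul _
  · have hd : HasDerivAt (fun q : ℝ => a * (q ^ 2 + 2 * a * q + 1))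
        (a * (2 * q + 2 * a)) q := by
      have := (((hasDerivAt_pow 2 q).add ((hasDerivAt_id q).const_mul (2 * a))).add_const
        (1 : ℝ)).const_mul a
      simpa using this
    have hd2 : HasDerivAt (fun q : ℝ => (q + a) ^ 2) (2 * (q + a)) q := by
      refine (((hasDerivAt_id q).add_const a).pow 2).congr_deriv ?_
      simp
    have hqa : 0 < q + a := by positivity
    refine (hd.div hd2 (by positivity)).congr_deriv ?_
    field_simp; ring
  · simp [zet]; field_simp; ring
  · simp [zet]; field_simp; ring
  · intro q hq
    exact ((Real.continuousAt_rpow_const q _ (Or.inl (ne_of_gt hq))).const_mul _).const_mul _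
      |>.continuousWithinAt
  · intro q (hq : 0 < q)
    refine ContinuousAt.continuousWithinAt (ContinuousAt.div (by fun_prop) (by fun_prop) ?_)
    positivity
  · simp [zet]; field_simp; ring

lemma impSq_pos (h0 : 0 < a) {q : ℝ} (hq : 0 < q) : 0 < impSq a q := by
  unfold impSq; split_ifs <;> positivity

lemma impSqd_pos (h0 : 0 < a) {q : ℝ} (hq : 0 < q) : 0 < impSqd a q := by
  have := zet_pos h0
  unfold impSqd; split_ifs <;> positivity

lemma veld_pos (h0 : 0 < a) {q : ℝ} (hq : 0 < q) : 0 < veld a q := by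
  have := zet_pos h0
  have hp : 0 < √((1 + a) * (q + a)) := Real.sqrt_pos.2 (by positivity)
  unfold veld svd; split_ifs <;> positivity

lemma imp_pos (h0 : 0 < a) {q : ℝ} (hq : 0 < q) : 0 < imp a q :=
  Real.sqrt_pos.2 (impSq_pos h0 hq)

lemma imp_sq (h0 : 0 < a) {q : ℝ} (hq : 0 < q) : imp a q ^ 2 = impSq a q :=
  Real.sq_sqrt (impSq_pos h0 hq).le

lemma hasDerivAt_imp (h0 : 0 < a) {q : ℝ} (hq : 0 < q) :
    HasDerivAt (imp a) (impSqd a q / (2 * imp a q)) q :=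
  (hasDerivAt_impSq h0 hq).sqrt (impSq_pos h0 hq).ne'

lemma contDiffOn_imp (h0 : 0 < a) : ContDiffOn ℝ 2 (imp a) (Ioi 0) :=
  (contDiffOn_impSq h0).sqrt fun _ hq => (impSq_pos h0 hq).ne'

lemma continuousOn_vel (h0 : 0 < a) : ContinuousOn (vel a) (Ioi 0) :=
  fun _ hq => (hasDerivAt_vel h0 hq).continuousAt.continuousWithinAt

lemma continuousOn_imp (h0 : 0 < a) : ContinuousOn (imp a) (Ioi 0) :=
  fun _ hq => (hasDerivAt_imp h0 hq).continuousAt.continuousWithinAt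

lemma strictMonoOn_vel (h0 : 0 < a) : StrictMonoOn (vel a) (Ioi 0) := by
  refine strictMonoOn_of_deriv_pos (convex_Ioi 0) (continuousOn_vel h0) fun q hq => ?_
  rw [interior_Ioi] at hq
  rw [(hasDerivAt_vel h0 hq).deriv]
  exact veld_pos h0 hq

lemma strictMonoOn_imp (h0 : 0 < a) : StrictMonoOn (imp a) (Ioi 0) := by
  refine strictMonoOn_of_deriv_pos (convex_Ioi 0) (continuousOn_imp h0) fun q hq => ?_
  rw [interior_Ioi] at hq
  rw [(hasDerivAt_imp h0 hq).deriv]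
  exact div_pos (impSqd_pos h0 hq) (mul_pos two_pos (imp_pos h0 hq))

lemma vel_of_le {q : ℝ} (hq : q ≤ 1) : vel a q = q ^ zet a - 1 := if_pos hq

lemma vel_of_gt {q : ℝ} (hq : 1 < q) : vel a q = sv a q := if_neg (not_le.2 hq)

lemma vel_of_ge {q : ℝ} (hq : 1 ≤ q) : vel a q = sv a q := by
  rcases hq.eq_or_lt with h | h
  · subst h; simp [vel, sv]
  · exact vel_of_gt h

lemma imp_of_le {q : ℝ} (hq0 : 0 < q) (hq : q ≤ 1) : imp a q = q ^ zet a := by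
  unfold imp impSq
  rw [if_pos hq, mul_comm, Real.rpow_mul hq0.le, Real.rpow_two, Real.sqrt_sq (by positivity)]

lemma imp_of_ge (h0 : 0 < a) {q : ℝ} (hq : 1 ≤ q) :
    imp a q = √(q * (1 + a * q) / (q + a)) := by
  unfold imp impSq
  rcases hq.eq_or_lt with h | h
  · subst h; simp [add_comm, div_self (show a + 1 ≠ 0 by linarith)]
  · rw [if_neg (not_le.2 h)]

@[simp] lemma vel_one : vel a 1 = 0 := by simp [vel]

@[simp] lemma imp_one : imp a 1 = 1 := by simp [imp, impSq]

lemma vel_pos (h0 : 0 < a) {q : ℝ} (hq : 1 < q) : 0 < vel a q := by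
  have := strictMonoOn_vel h0 (mem_Ioi.2 one_pos) (mem_Ioi.2 (one_pos.trans hq)) hq
  simpa using this

lemma vel_neg (h0 : 0 < a) {q : ℝ} (hq0 : 0 < q) (hq : q < 1) : vel a q < 0 := by
  have := strictMonoOn_vel h0 hq0 (mem_Ioi.2 one_pos) hq
  simpa using this

lemma neg_one_lt_vel (h0 : 0 < a) {q : ℝ} (hq : 0 < q) : -1 < vel a q := by
  rcases le_or_gt q 1 with h | h
  · rw [vel_of_le h]
    have := Real.rpow_pos_of_pos hq (zet a)
    linarith
  · linarith [vel_pos h0 h]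

lemma imp_lt_one (h0 : 0 < a) {q : ℝ} (hq0 : 0 < q) (hq : q < 1) : imp a q < 1 := by
  have := strictMonoOn_imp h0 hq0 (mem_Ioi.2 one_pos) hq
  simpa using this

end Basic

/-! ### Comparison with `√q` and limits -/

section Growth

variable {a : ℝ}

lemma sv_sq (h0 : 0 < a) {q : ℝ} (hq : 0 < q) :
    sv a q ^ 2 = a ^ 2 * (q - 1) ^ 2 / ((1 + a) * (q + a)) := by
  unfold sv; rw [div_pow, Real.sq_sqrt (by positivity), mul_pow]

lemma impSq_of_le {q : ℝ} (hq : q ≤ 1) : impSq a q = q ^ (2 * zet a) := if_pos hq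

lemma impSq_of_ge (h0 : 0 < a) {q : ℝ} (hq : 1 ≤ q) :
    impSq a q = q * (1 + a * q) / (q + a) := by
  rw [← imp_sq h0 (by linarith), imp_of_ge h0 hq, Real.sq_sqrt (by positivity)]

lemma impSq_div_anti (h0 : 0 < a) (h1 : a < 1) {p q : ℝ} (hp : 0 < p) (hpq : p ≤ q) :
    impSq a q / q ≤ impSq a p / p := by
  have hz := zet_lt_half h0 h1
  have key1 : ∀ p q : ℝ, 0 < p → p ≤ q → q ≤ 1 → impSq a q / q ≤ impSq a p / p := by
    intro p q hp hpq hq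
    have e : ∀ r : ℝ, 0 < r → r ≤ 1 → impSq a r / r = r ^ (2 * zet a - 1) := by
      intro r hr hr1
      rw [impSq_of_le hr1, Real.rpow_sub_one hr.ne']
    rw [e p hp (hpq.trans hq), e q (hp.trans_le hpq) hq]
    exact Real.rpow_le_rpow_of_nonpos hp hpq (by linarith)
  have key2 : ∀ p q : ℝ, 1 ≤ p → p ≤ q → impSq a q / q ≤ impSq a p / p := by
    intro p q hp hpq
    have e : ∀ r : ℝ, 1 ≤ r → impSq a r / r = (1 + a * r) / (r + a) := by
      intro r hr
      have : 0 < r := by linarith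
      rw [impSq_of_ge h0 hr]; field_simp
    rw [e p hp, e q (hp.trans hpq), div_le_div_iff₀ (by linarith) (by linarith)]
    nlinarith [mul_nonneg (sub_nonneg.2 hpq) (show 0 ≤ 1 - a ^ 2 by nlinarith)]
  rcases le_total q 1 with h | h
  · exact key1 p q hp hpq h
  · rcases le_total p 1 with h' | h'
    · exact (key2 1 q le_rfl h).trans (key1 p 1 hp h' le_rfl)
    · exact key2 p q h' hpq

lemma imp_div_sqrt {q : ℝ} (hq : 0 < q) : imp a q / √q = √(impSq a q / q) := by
  rw [imp, Real.sqrt_div' _ hq.le]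

lemma imp_div_sqrt_anti (h0 : 0 < a) (h1 : a < 1) {p q : ℝ} (hp : 0 < p) (hpq : p ≤ q) :
    imp a q / √q ≤ imp a p / √p := by
  rw [imp_div_sqrt hp, imp_div_sqrt (hp.trans_le hpq)]
  exact Real.sqrt_le_sqrt (impSq_div_anti h0 h1 hp hpq)

lemma vel_div_sqrt_mono (h0 : 0 < a) {p q : ℝ} (hp : 1 ≤ p) (hpq : p ≤ q) :
    vel a p / √p ≤ vel a q / √q := by
  have hq : 1 ≤ q := hp.trans hpq
  have hp0 : 0 < p := by linarith
  have hq0 : 0 < q := by linarith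
  have hv : 0 ≤ vel a q := by
    rcases hq.eq_or_lt with h | h
    · rw [← h, vel_one]
    · exact (vel_pos h0 h).le
  refine le_of_sq_le_sq ?_ (div_nonneg hv (Real.sqrt_nonneg _))
  rw [div_pow, div_pow, Real.sq_sqrt hp0.le, Real.sq_sqrt hq0.le, vel_of_ge hp, vel_of_ge hq,
    sv_sq h0 hp0, sv_sq h0 hq0, div_div, div_div, div_le_div_iff₀ (by positivity) (by positivity)]
  have e1 : (p - 1) * q ≤ (q - 1) * p := by linarith
  have e2 : (p - 1) * (q + a) ≤ (q - 1) * (p + a) := by nlinarith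
  have e3 := mul_le_mul e1 e2 (mul_nonneg (by linarith) (by linarith))
    (mul_nonneg (by linarith) (by linarith))
  have := mul_le_mul_of_nonneg_left e3 (show 0 ≤ a ^ 2 * (1 + a) by positivity)
  linarith

lemma imp_lt_sqrt (h0 : 0 < a) (h1 : a < 1) {q : ℝ} (hq : 1 < q) : imp a q < √q := by
  rw [imp_of_ge h0 hq.le]
  refine Real.sqrt_lt_sqrt (by positivity) ?_
  rw [div_lt_iff₀ (by linarith)]
  nlinarith [mul_pos (sub_pos.2 hq) (sub_pos.2 h1),
    mul_pos (mul_pos (sub_pos.2 hq) (sub_pos.2 h1)) (one_pos.trans hq)]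

lemma vel_div_imp_strictMono (h0 : 0 < a) {p q : ℝ} (hp : 0 < p) (hpq : p < q) :
    vel a p / imp a p < vel a q / imp a q := by
  have key1 : ∀ p q : ℝ, 0 < p → p < q → q ≤ 1 → vel a p / imp a p < vel a q / imp a q := by
    intro p q hp hpq hq
    have e : ∀ r : ℝ, 0 < r → r ≤ 1 → vel a r / imp a r = 1 - 1 / imp a r := by
      intro r hr hr1
      have := imp_pos h0 hr
      have e : vel a r = imp a r - 1 := by rw [vel_of_le hr1, imp_of_le hr hr1]
      rw [e, sub_div, div_self this.ne']
    rw [e p hp (hpq.le.trans hq), e q (hp.trans hpq) hq]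
    have := one_div_lt_one_div_of_lt (imp_pos h0 hp) (strictMonoOn_imp h0 hp (hp.trans hpq) hpq)
    linarith
  have key2 : ∀ p q : ℝ, 1 ≤ p → p < q → vel a p / imp a p < vel a q / imp a q := by
    intro p q hp hpq
    have hq : 1 < q := hp.trans_lt hpq
    have hp0 : 0 < p := by linarith
    have hq0 : 0 < q := by linarith
    refine lt_of_pow_lt_pow_left₀ 2 (div_nonneg (vel_pos h0 hq).le (imp_pos h0 hq0).le) ?_
    have e : ∀ r : ℝ, 1 ≤ r → (vel a r / imp a r) ^ 2
        = a ^ 2 * (r - 1) ^ 2 / ((1 + a) * (r * (1 + a * r))) := by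
      intro r hr
      have hr0 : 0 < r := by linarith
      rw [div_pow, vel_of_ge hr, sv_sq h0 hr0, imp_sq h0 hr0, impSq_of_ge h0 hr]
      field_simp
    rw [e p hp, e q hq.le, div_lt_div_iff₀ (by positivity) (by positivity)]
    have e1 : (p - 1) * q ≤ (q - 1) * p := by linarith
    have e2 : (p - 1) * (1 + a * q) < (q - 1) * (1 + a * p) := by nlinarith
    have e3 := mul_lt_mul' e1 e2 (mul_nonneg (by linarith) (by positivity))
      (mul_pos (by linarith) hp0)
    have := mul_lt_mul_of_pos_left e3 (show 0 < a ^ 2 * (1 + a) by positivity)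
    linarith
  rcases le_or_gt q 1 with h | h
  · exact key1 p q hp hpq h
  · rcases lt_or_ge p 1 with h' | h'
    · exact (key1 p 1 hp h' le_rfl).trans (key2 1 q le_rfl h)
    · exact key2 p q h' hpq

lemma tendsto_vel_div_sqrt (h0 : 0 < a) :
    Tendsto (fun q => vel a q / √q) atTop (𝓝 (a / √(1 + a))) := by
  have hc : ContinuousAt (fun t : ℝ => a * (1 - t) / √((1 + a) * (1 + a * t))) 0 := by
    refine ContinuousAt.div (by fun_prop) (by fun_prop) ?_
    simpa using (Real.sqrt_pos.2 (show 0 < 1 + a by linarith)).ne'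
  have := hc.tendsto.comp tendsto_inv_atTop_zero
  simp only [mul_zero, add_zero, sub_zero, mul_one] at this
  refine this.congr' ?_
  filter_upwards [eventually_ge_atTop 1] with q hq
  have hq0 : 0 < q := by linarith
  have e : √((1 + a) * (q + a)) = √((1 + a) * (1 + a * q⁻¹)) * √q := by
    rw [← Real.sqrt_mul (by positivity)]
    congr 1
    field_simp
  have hs := Real.sqrt_pos.2 hq0
  have h2 : √q * √q = q := Real.mul_self_sqrt hq0.le
  rw [vel_of_ge hq, sv, e, Function.comp_apply, div_div, mul_assoc, h2]
  have : 0 < √((1 + a) * (1 + a * q⁻¹)) := Real.sqrt_pos.2 (by positivity)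
  field_simp

lemma tendsto_imp_div_sqrt (h0 : 0 < a) :
    Tendsto (fun q => imp a q / √q) atTop (𝓝 (√a)) := by
  have hc : ContinuousAt (fun t : ℝ => √((t + a) / (1 + a * t))) 0 := by
    refine ContinuousAt.sqrt (ContinuousAt.div (by fun_prop) (by fun_prop) ?_)
    simp
  have := hc.tendsto.comp tendsto_inv_atTop_zero
  simp only [mul_zero, add_zero, zero_add, div_one] at this
  refine this.congr' ?_
  filter_upwards [eventually_ge_atTop 1] with q hq
  have hq0 : 0 < q := by linarith
  rw [imp_div_sqrt hq0, impSq_of_ge h0 hq, Function.comp_apply]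
  congr 1
  field_simp

lemma sqrt_zet (h0 : 0 < a) : a / √(1 + a) / √a = √(zet a) := by
  rw [zet, Real.sqrt_div' _ (by linarith), div_right_comm, Real.div_sqrt]

lemma tendsto_vel_div_imp (h0 : 0 < a) :
    Tendsto (fun q => vel a q / imp a q) atTop (𝓝 (√(zet a))) := by
  rw [← sqrt_zet h0]
  refine ((tendsto_vel_div_sqrt h0).div (tendsto_imp_div_sqrt h0)
    (Real.sqrt_pos.2 h0).ne').congr' ?_
  filter_upwards [eventually_gt_atTop 0] with q hq
  exact div_div_div_cancel_right₀ (Real.sqrt_pos.2 hq).ne' _ _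

lemma vel_div_imp_lt (h0 : 0 < a) {q : ℝ} (hq : 0 < q) : vel a q / imp a q < √(zet a) := by
  have h1 : vel a q / imp a q < vel a (q + 1) / imp a (q + 1) :=
    vel_div_imp_strictMono h0 hq (by linarith)
  refine h1.trans_le (ge_of_tendsto (tendsto_vel_div_imp h0) ?_)
  filter_upwards [eventually_gt_atTop (q + 1)] with r hr
  exact (vel_div_imp_strictMono h0 (by linarith) hr).le

lemma tendsto_vel_atTop (h0 : 0 < a) : Tendsto (vel a) atTop atTop := by
  have hc : 0 < a / √(1 + a) := div_pos h0 (Real.sqrt_pos.2 (by linarith))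
  refine ((tendsto_vel_div_sqrt h0).pos_mul_atTop hc Real.tendsto_sqrt_atTop).congr' ?_
  filter_upwards [eventually_gt_atTop 0] with q hq
  exact div_mul_cancel₀ _ (Real.sqrt_pos.2 hq).ne'

lemma tendsto_rpow_zet_zero (h0 : 0 < a) :
    Tendsto (fun q : ℝ => q ^ zet a) (𝓝[>] 0) (𝓝 0) := by
  have h := (Real.continuousAt_rpow_const 0 (zet a) (Or.inr (zet_pos h0).le)).tendsto
  rw [Real.zero_rpow (zet_pos h0).ne'] at h
  exact h.mono_left nhdsWithin_le_nhds

lemma tendsto_vel_zero (h0 : 0 < a) : Tendsto (vel a) (𝓝[>] 0) (𝓝 (-1)) := by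
  have h := (tendsto_rpow_zet_zero h0).sub_const 1
  rw [zero_sub] at h
  refine h.congr' ?_
  filter_upwards [Ioo_mem_nhdsGT one_pos] with q hq
  rw [vel_of_le hq.2.le]

end Growth

/-! ### The locus of vanishing outgoing backward wave -/

section Backward

variable {a : ℝ}

/-- The function whose sign decides the type of the outgoing backward wave: up to the factor
`imp a x`, the excess of the incoming velocity drop over the drop caused by a sole forward wave
(see `inVel_sub_outVel_inv`). -/
def bwd (a x y : ℝ) : ℝ := vel a x / imp a x + vel a y - imp a y * vel a (1 / (x * y))

lemma neg_imp_mul_vel_mono (h0 : 0 < a) (h1 : a < 1) {x : ℝ} (hx : 0 < x) :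
    MonotoneOn (fun y => -(imp a y * vel a (1 / (x * y)))) (Ioi 0) := by
  intro p (hp : 0 < p) q (hq : 0 < q) hpq
  have hxp : 0 < x * p := by positivity
  have hxq : 0 < x * q := by positivity
  have hz : 1 / (x * q) ≤ 1 / (x * p) := one_div_le_one_div_of_le hxp (by gcongr)
  have hzp : 0 < 1 / (x * p) := by positivity
  have hzq : 0 < 1 / (x * q) := by positivity
  have hw := (strictMonoOn_imp h0).monotoneOn hp hq hpq
  have hwp := imp_pos h0 hp
  have hwq := imp_pos h0 hq
  have hv := (strictMonoOn_vel h0).monotoneOn hzq hzp hz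
  simp only [neg_le_neg_iff]
  rcases le_total (1 / (x * p)) 1 with h | h
  · have : vel a (1 / (x * p)) ≤ 0 := by
      rw [← vel_one (a := a)]; exact (strictMonoOn_vel h0).monotoneOn hzp (mem_Ioi.2 one_pos) h
    nlinarith
  · have hvp : 0 ≤ vel a (1 / (x * p)) := by
      rw [← vel_one (a := a)]; exact (strictMonoOn_vel h0).monotoneOn (mem_Ioi.2 one_pos) hzp h
    rcases le_total (1 / (x * q)) 1 with h' | h'
    · have : vel a (1 / (x * q)) ≤ 0 := by
        rw [← vel_one (a := a)]
        exact (strictMonoOn_vel h0).monotoneOn hzq (mem_Ioi.2 one_pos) h'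
      nlinarith [mul_nonneg hwp.le hvp]
    · -- both factors of `(imp y / √y) * (vel z / √z)` are antitone in `y` when `z = 1 / (x y) ≥ 1`
      have e : ∀ y : ℝ, 0 < y → imp a y * vel a (1 / (x * y))
          = (imp a y / √y) * (vel a (1 / (x * y)) / √(1 / (x * y))) * √(1 / x) := by
        intro y hy
        have : √(1 / x) = √y * √(1 / (x * y)) := by
          rw [← Real.sqrt_mul hy.le]; congr 1; field_simp
        have h1 := Real.sqrt_pos.2 hy
        have h2 := Real.sqrt_pos.2 (show 0 < 1 / (x * y) by positivity)
        rw [this]; field_simp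
      rw [e p hp, e q hq]
      have hvq : 0 ≤ vel a (1 / (x * q)) := by
        rw [← vel_one (a := a)]
        exact (strictMonoOn_vel h0).monotoneOn (mem_Ioi.2 one_pos) hzq h'
      refine mul_le_mul_of_nonneg_right (mul_le_mul (imp_div_sqrt_anti h0 h1 hp hpq)
        (vel_div_sqrt_mono h0 h' hz) (by positivity) (by positivity)) (Real.sqrt_nonneg _)

lemma bwd_strictMono_right (h0 : 0 < a) (h1 : a < 1) {x : ℝ} (hx : 0 < x) :
    StrictMonoOn (bwd a x) (Ioi 0) := by
  intro p hp q hq hpq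
  have e1 := neg_imp_mul_vel_mono h0 h1 hx hp hq hpq.le
  have e2 := strictMonoOn_vel h0 hp hq hpq
  simp only at e1
  unfold bwd
  linarith

lemma bwd_strictMono_left (h0 : 0 < a) {y : ℝ} (hy : 0 < y) {p q : ℝ} (hp : 0 < p)
    (hpq : p < q) : bwd a p y < bwd a q y := by
  have hq := hp.trans hpq
  have hz : 1 / (q * y) < 1 / (p * y) := one_div_lt_one_div_of_lt (by positivity) (by gcongr)
  have e1 := strictMonoOn_vel h0 (mem_Ioi.2 (by positivity)) (mem_Ioi.2 (by positivity)) hz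
  have e2 := vel_div_imp_strictMono h0 hp hpq
  have e3 := mul_lt_mul_of_pos_left e1 (imp_pos h0 hy)
  unfold bwd
  linarith

lemma contDiffAt_bwd (h0 : 0 < a) {x y : ℝ} (hx : 0 < x) (hy : 0 < y) :
    ContDiffAt ℝ 2 (fun p : ℝ × ℝ => bwd a p.1 p.2) (x, y) := by
  have hv : ∀ q : ℝ, 0 < q → ContDiffAt ℝ 2 (vel a) q := fun q hq =>
    (contDiffOn_vel h0).contDiffAt (Ioi_mem_nhds hq)
  have hi : ∀ q : ℝ, 0 < q → ContDiffAt ℝ 2 (imp a) q := fun q hq =>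
    (contDiffOn_imp h0).contDiffAt (Ioi_mem_nhds hq)
  have hf : ContDiffAt ℝ 2 (fun p : ℝ × ℝ => p.1) (x, y) := contDiffAt_fst
  have hs : ContDiffAt ℝ 2 (fun p : ℝ × ℝ => p.2) (x, y) := contDiffAt_snd
  have hz : ContDiffAt ℝ 2 (fun p : ℝ × ℝ => 1 / (p.1 * p.2)) (x, y) :=
    contDiffAt_const.div (hf.mul hs) (by simp; exact ⟨hx.ne', hy.ne'⟩)
  refine ContDiffAt.sub (ContDiffAt.add (ContDiffAt.div ?_ ?_ (imp_pos h0 hx).ne') ?_)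
    (ContDiffAt.mul ?_ ?_)
  · exact (hv x hx).comp (x, y) hf
  · exact ContDiffAt.comp (g := imp a) (x, y) (hi x hx) hf
  · exact (hv y hy).comp (x, y) hs
  · exact ContDiffAt.comp (g := imp a) (x, y) (hi y hy) hs
  · exact ContDiffAt.comp (g := vel a) (x, y) (hv (1 / (x * y)) (by positivity)) hz

lemma deriv_bwd_pos (h0 : 0 < a) (h1 : a < 1) {x y d : ℝ} (hx : 0 < x) (hy : 0 < y)
    (hd : HasDerivAt (bwd a x) d y) : 0 < d := by
  have h2 : HasDerivAt (fun y => vel a x / imp a x + -(imp a y * vel a (1 / (x * y))))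
      (d - veld a y) y := by
    refine (hd.sub (hasDerivAt_vel h0 hy)).congr_of_eventuallyEq (.of_forall fun t => ?_)
    simp only [bwd, Pi.sub_apply]; ring
  have hm : MonotoneOn (fun y => vel a x / imp a x + -(imp a y * vel a (1 / (x * y)))) (Ioi 0) :=
    fun p hp q hq hpq => by
      have := neg_imp_mul_vel_mono h0 h1 hx hp hq hpq
      simp only at this ⊢; linarith
  have := hm.derivWithin_nonneg (x := y)
  rw [derivWithin_of_mem_nhds (Ioi_mem_nhds hy), h2.deriv] at this
  linarith [veld_pos h0 hy]

lemma continuousOn_bwd (h0 : 0 < a) {x : ℝ} (hx : 0 < x) : ContinuousOn (bwd a x) (Ioi 0) := by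
  intro y hy
  have := (contDiffAt_bwd h0 hx hy).continuousAt
  exact (ContinuousAt.comp (f := fun y : ℝ => (x, y)) (g := fun p : ℝ × ℝ => bwd a p.1 p.2) this
    (by fun_prop)).continuousWithinAt

lemma exists_bwd_neg (h0 : 0 < a) (h1 : a < 1) {x : ℝ} (hx : 0 < x) :
    ∃ y, 0 < y ∧ bwd a x y < 0 := by
  have hz := zet_lt_half h0 h1
  have t1 : Tendsto (fun y : ℝ => imp a y / √y) (𝓝[>] 0) atTop := by
    refine (tendsto_rpow_neg_nhdsGT_zero (show zet a - 1 / 2 < 0 by linarith)).congr' ?_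
    filter_upwards [Ioo_mem_nhdsGT one_pos] with y hy
    rw [imp_of_le hy.1 hy.2.le, Real.sqrt_eq_rpow, Real.rpow_sub hy.1]
  have t2 : Tendsto (fun y : ℝ => 1 / (x * y)) (𝓝[>] 0) atTop := by
    refine (tendsto_inv_nhdsGT_zero.const_mul_atTop (inv_pos.2 hx)).congr fun y => ?_
    rw [one_div, mul_inv]
  have hc : 0 < a / √(1 + a) := div_pos h0 (Real.sqrt_pos.2 (by linarith))
  have t3 := (t1.atTop_mul_pos hc ((tendsto_vel_div_sqrt h0).comp t2)).atTop_mul_const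
    (Real.sqrt_pos.2 (show 0 < 1 / x by positivity))
  obtain ⟨y, hy1, hy2, hy3⟩ := ((t3.eventually_gt_atTop (vel a x / imp a x)).and
    (Ioo_mem_nhdsGT one_pos)).exists
  refine ⟨y, hy2, ?_⟩
  have e : imp a y * vel a (1 / (x * y))
      = (imp a y / √y) * (vel a (1 / (x * y)) / √(1 / (x * y))) * √(1 / x) := by
    have : √(1 / x) = √y * √(1 / (x * y)) := by
      rw [← Real.sqrt_mul hy2.le]; congr 1; field_simp
    have h1 := Real.sqrt_pos.2 hy2
    have h2 := Real.sqrt_pos.2 (show 0 < 1 / (x * y) by positivity)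
    rw [this]; field_simp
  simp only [Function.comp_apply] at hy1
  rw [← e] at hy1
  have := vel_neg h0 hy2 hy3
  unfold bwd
  linarith

lemma exists_bwd_pos (h0 : 0 < a) {x : ℝ} (hx : 0 < x) :
    ∃ y, 0 < y ∧ 0 < bwd a x y := by
  obtain ⟨y, hy1, hy2, hy3⟩ := (((tendsto_vel_atTop h0).eventually_gt_atTop
    (-(vel a x / imp a x))).and ((eventually_ge_atTop (1 / x)).and (eventually_gt_atTop 0))).exists
  refine ⟨y, hy3, ?_⟩
  have hxy : 1 ≤ x * y := by
    rw [div_le_iff₀ hx] at hy2; linarith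
  have hv : vel a (1 / (x * y)) ≤ 0 := by
    rw [← vel_one (a := a)]
    refine (strictMonoOn_vel h0).monotoneOn (mem_Ioi.2 (by positivity)) (mem_Ioi.2 one_pos) ?_
    rwa [div_le_one (by positivity)]
  have := imp_pos h0 hy3
  unfold bwd
  nlinarith

lemma contDiffAt_of_bwd_eq_zero (h0 : 0 < a) (h1 : a < 1) {k : ℝ → ℝ}
    (hk : ∀ x, 0 < x → 0 < k x ∧ bwd a x (k x) = 0) {x : ℝ} (hx : 0 < x) :
    ContDiffAt ℝ 2 k x := by
  obtain ⟨hy, hxy⟩ := hk x hx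
  set y := k x
  have cdf := contDiffAt_bwd h0 hx hy
  set f := fun p : ℝ × ℝ => bwd a p.1 p.2
  have hfd : HasFDerivAt f (fderiv ℝ f (x, y)) (x, y) :=
    (cdf.differentiableAt (by norm_num)).hasFDerivAt
  have hline : HasDerivAt (fun y : ℝ => (x, y)) ((0 : ℝ), (1 : ℝ)) y :=
    (hasDerivAt_const y x).prodMk (hasDerivAt_id y)
  have hd : HasDerivAt (bwd a x) (fderiv ℝ f (x, y) (0, 1)) y :=
    HasFDerivAt.comp_hasDerivAt (x := y) (f := fun y : ℝ => (x, y)) (l := f) hfd hline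
  have hpos := deriv_bwd_pos h0 h1 hx hy hd
  have inv : (fderiv ℝ f (x, y) ∘L .inr ℝ ℝ ℝ).IsInvertible := by
    refine ⟨ContinuousLinearEquiv.unitsEquivAut ℝ (Units.mk0 _ hpos.ne'), ?_⟩
    ext
    simp
  have e1 := cdf.eventually_apply_implicitFunction (by norm_num) inv
  have e2 := cdf.contDiffAt_implicitFunction (by norm_num) inv
  have e3 := cdf.implicitFunction_apply_self (by norm_num) inv
  refine e2.congr_of_eventuallyEq ?_
  have e4 : ∀ᶠ t in 𝓝 x, 0 < cdf.implicitFunction (by norm_num) inv t :=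
    e2.continuousAt.eventually (lt_mem_nhds (by simp only at e3 ⊢; rw [e3]; exact hy))
  filter_upwards [e1, e4, lt_mem_nhds hx] with t h2 h3 h4
  obtain ⟨h5, h6⟩ := hk t h4
  refine (bwd_strictMono_right h0 h1 h4).injOn h5 h3 ?_
  rw [h6]
  exact (h2.trans hxy).symm

/-- The locus of vanishing outgoing backward wave is the graph of a `C²` decreasing function. -/
theorem exists_backward_locus (h0 : 0 < a) (h1 : a < 1) :
    ∃ k : ℝ → ℝ, ContDiffOn ℝ 2 k (Ioi 0) ∧ StrictAntiOn k (Ioi 0) ∧ k 1 = 1 ∧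
      Tendsto k (𝓝[>] 0) atTop ∧
      Tendsto k atTop (𝓝 ((1 / 2 * (1 - √(zet a))) ^ (1 / zet a))) ∧
      ∀ x, 0 < x → 0 < k x ∧ ∀ y, 0 < y →
        (bwd a x y = 0 ↔ y = k x) ∧ (0 < bwd a x y ↔ k x < y) := by
  have ex : ∀ x : ℝ, ∃ y, 0 < x → 0 < y ∧ bwd a x y = 0 := by
    intro x
    by_cases hx : 0 < x
    · obtain ⟨p, hp, hp'⟩ := exists_bwd_neg h0 h1 hx
      obtain ⟨q, hq, hq'⟩ := exists_bwd_pos h0 hx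
      have hpq : p ≤ q := by
        by_contra h
        have := bwd_strictMono_right h0 h1 hx hq hp (not_le.1 h)
        linarith
      obtain ⟨y, hy, hy'⟩ := intermediate_value_Icc hpq
        ((continuousOn_bwd h0 hx).mono fun t ht => hp.trans_le ht.1) ⟨hp'.le, hq'.le⟩
      exact ⟨y, fun _ => ⟨hp.trans_le hy.1, hy'⟩⟩
    · exact ⟨0, fun h => absurd h hx⟩
  choose k hk using ex
  have hsign : ∀ x, 0 < x → ∀ y, 0 < y →
      (bwd a x y = 0 ↔ y = k x) ∧ (0 < bwd a x y ↔ k x < y) := by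
    intro x hx y hy
    obtain ⟨h2, h3⟩ := hk x hx
    have hm := bwd_strictMono_right h0 h1 hx
    rw [← h3]
    exact ⟨hm.eq_iff_eq hy h2, hm.lt_iff_lt h2 hy⟩
  refine ⟨k, fun x hx => (contDiffAt_of_bwd_eq_zero h0 h1 hk hx).contDiffWithinAt, ?_, ?_, ?_, ?_,
    fun x hx => ⟨(hk x hx).1, hsign x hx⟩⟩
  · intro p (hp : 0 < p) q (hq : 0 < q) hpq
    have e := bwd_strictMono_left h0 (hk p hp).1 hp hpq
    rw [(hk p hp).2] at e
    exact ((hsign q hq _ (hk p hp).1).2).1 e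
  · refine (((hsign 1 one_pos 1 one_pos).1).1 ?_).symm
    simp [bwd]
  · rw [tendsto_atTop]
    intro M
    have t : Tendsto (fun x : ℝ => x ^ (-zet a)) (𝓝[>] 0) atTop :=
      tendsto_rpow_neg_nhdsGT_zero (neg_lt_zero.2 (zet_pos h0))
    set N := max M 1
    have hN : 0 < N := lt_max_of_lt_right one_pos
    filter_upwards [t.eventually_gt_atTop (1 + vel a N), Ioo_mem_nhdsGT one_pos,
      Ioo_mem_nhdsGT (inv_pos.2 hN)] with x h2 h3 h4
    have hx := h3.1
    refine (le_max_left M 1).trans (not_lt.1 fun h => ?_)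
    have := ((hsign x hx N hN).2).2 h
    have hxN : x * N ≤ 1 := by
      have := h4.2.le
      rwa [← one_div, le_div_iff₀ hN] at this
    have hv : 0 ≤ vel a (1 / (x * N)) := by
      rw [← vel_one (a := a)]
      refine (strictMonoOn_vel h0).monotoneOn (mem_Ioi.2 one_pos) (mem_Ioi.2 (by positivity)) ?_
      rwa [le_div_iff₀ (by positivity), one_mul]
    have hm := mul_nonneg (imp_pos h0 hN).le hv
    have e : vel a x / imp a x = 1 - x ^ (-zet a) := by
      have hp := Real.rpow_pos_of_pos hx (zet a)
      rw [vel_of_le h3.2.le, imp_of_le hx h3.2.le, sub_div, div_self hp.ne', Real.rpow_neg hx.le,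
        one_div]
    unfold bwd at this
    linarith
  · set s := 1 / 2 * (1 - √(zet a)) with hs
    have hz := zet_pos h0
    have hz2 := zet_lt_half h0 h1
    have hr1 : √(zet a) < 1 := by
      rw [Real.sqrt_lt' one_pos]; linarith
    have hs0 : 0 < s := by linarith
    have hs1 : s < 1 := by linarith [Real.sqrt_nonneg (zet a)]
    set Y := s ^ (1 / zet a) with hY
    have hY0 : 0 < Y := Real.rpow_pos_of_pos hs0 _
    have hY1 : Y < 1 := Real.rpow_lt_one hs0.le hs1 (by positivity)
    have hYs : Y ^ zet a = s := by
      rw [hY, ← Real.rpow_mul hs0.le, one_div, inv_mul_cancel₀ hz.ne', Real.rpow_one]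
    rw [tendsto_order]
    constructor
    · intro b hb
      filter_upwards [eventually_gt_atTop 0] with x hx
      refine hb.trans_le (not_lt.1 fun h => ?_)
      have h2 := ((hsign x hx Y hY0).2).2 h
      have h3 := vel_div_imp_lt h0 hx
      have h4 := neg_one_lt_vel h0 (show 0 < 1 / (x * Y) by positivity)
      unfold bwd at h2
      rw [vel_of_le hY1.le, imp_of_le hY0 hY1.le, hYs] at h2
      nlinarith
    · intro b hb
      set y := min b 1 with hy
      have hyY : Y < y := lt_min hb hY1
      have hy0 := hY0.trans hyY
      have hy1 : y ≤ 1 := min_le_right _ _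
      have hsy : s < y ^ zet a := by
        rw [← hYs]; exact Real.rpow_lt_rpow hY0.le hyY hz
      have t1 : Tendsto (fun x : ℝ => 1 / (x * y)) atTop (𝓝[>] 0) := by
        have : Tendsto (fun x : ℝ => x * y) atTop atTop := tendsto_id.atTop_mul_const hy0
        refine (tendsto_inv_atTop_nhdsGT_zero.comp this).congr fun x => ?_
        simp
      have t2 := ((tendsto_vel_div_imp h0).add_const (vel a y)).sub
        (((tendsto_vel_zero h0).comp t1).const_mul (imp a y))
      have hlim : 0 < √(zet a) + vel a y - imp a y * -1 := by
        rw [vel_of_le hy1, imp_of_le hy0 hy1]; linarith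
      filter_upwards [t2.eventually (lt_mem_nhds hlim), eventually_gt_atTop 0] with x h2 h3
      exact (((hsign x h3 y hy0).2).1 h2).trans_le (min_le_left _ _)

end Backward

/-! ### Functions that first decrease and then increase -/

section Valley

lemma lt_of_hasDerivAt_pos {f f' : ℝ → ℝ} {u v : ℝ} (huv : u < v)
    (hc : ContinuousOn f (Icc u v)) (hd : ∀ y ∈ Ioo u v, HasDerivAt f (f' y) y)
    (hpos : ∀ y ∈ Ioo u v, 0 < f' y) : f u < f v := by
  refine strictMonoOn_of_deriv_pos (convex_Icc u v) hc (fun y hy => ?_)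
    (left_mem_Icc.2 huv.le) (right_mem_Icc.2 huv.le) huv
  rw [interior_Icc] at hy
  rw [(hd y hy).deriv]
  exact hpos y hy

lemma lt_of_hasDerivAt_pos_off {f f' : ℝ → ℝ} {u v : ℝ} (c : ℝ) (huv : u < v)
    (hd : ∀ y ∈ Icc u v, HasDerivAt f (f' y) y)
    (hpos : ∀ y ∈ Ioo u v, y ≠ c → 0 < f' y) : f u < f v := by
  have hc : ContinuousOn f (Icc u v) := fun y hy => (hd y hy).continuousAt.continuousWithinAt
  by_cases h : c ∈ Ioo u v
  · refine (lt_of_hasDerivAt_pos h.1 (hc.mono (Icc_subset_Icc_right h.2.le))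
      (fun y hy => hd y ⟨hy.1.le, hy.2.le.trans h.2.le⟩)
      (fun y hy => hpos y ⟨hy.1, hy.2.trans h.2⟩ hy.2.ne)).trans
      (lt_of_hasDerivAt_pos h.2 (hc.mono (Icc_subset_Icc_left h.1.le))
      (fun y hy => hd y ⟨h.1.le.trans hy.1.le, hy.2.le⟩)
      (fun y hy => hpos y ⟨h.1.trans hy.1, hy.2⟩ hy.1.ne'))
  · exact lt_of_hasDerivAt_pos huv hc (fun y hy => hd y (Ioo_subset_Icc_self hy))
      fun y hy => hpos y hy fun e => h (e ▸ hy)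

lemma lt_of_hasDerivAt_neg_off {f f' : ℝ → ℝ} {u v : ℝ} (c : ℝ) (huv : u < v)
    (hd : ∀ y ∈ Icc u v, HasDerivAt f (f' y) y)
    (hneg : ∀ y ∈ Ioo u v, y ≠ c → f' y < 0) : f v < f u := by
  have := lt_of_hasDerivAt_pos_off (f := fun y => -f y) (f' := fun y => -f' y) c huv
    (fun y hy => (hd y hy).neg) (fun y hy h => neg_pos.2 (hneg y hy h))
  simpa using this

/-- If the derivative, once nonnegative, is positive from then on, the function is strictly
quasiconvex. The point `c` is exempt from the sign condition. -/
lemma valley_of_deriv {f f' : ℝ → ℝ} (b c : ℝ) (hd : ∀ y, 0 < y → HasDerivAt f (f' y) y)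
    (up : ∀ p q, b < p → p < q → p ≠ c → q ≠ c → 0 ≤ f' p → 0 < f' q)
    {p q r : ℝ} (hp : 0 < p) (hb : b ≤ p) (hpq : p < q) (hqr : q < r) (h : f p ≤ f q) :
    f q < f r := by
  obtain ⟨t, ht, htc, ht'⟩ : ∃ t ∈ Ioo p q, t ≠ c ∧ 0 ≤ f' t := by
    by_contra! hcon
    exact absurd (lt_of_hasDerivAt_neg_off c hpq (fun y hy => hd y (hp.trans_le hy.1)) hcon)
      (not_lt.2 h)
  exact lt_of_hasDerivAt_pos_off c hqr (fun y hy => hd y ((hp.trans hpq).trans_le hy.1))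
    fun y hy hyc => up t y (hb.trans_lt ht.1) (ht.2.trans hy.1) htc hyc ht'

/-- A trichotomy argument: three implications suffice for both equivalences. -/
lemma sign_iff_of_imp {g y η : ℝ} (h1 : η < y → 0 < g) (h2 : y < η → g < 0)
    (h3 : y = η → g = 0) : (0 < g ↔ η < y) ∧ (g < 0 ↔ y < η) := by
  rcases lt_trichotomy y η with h | h | h
  · have := h2 h
    exact ⟨⟨fun h' => absurd this h'.not_gt, h1⟩, ⟨fun _ => h, h2⟩⟩
  · have := h3 h
    exact ⟨⟨fun h' => absurd this h'.ne', h1⟩, ⟨fun h' => absurd this h'.ne, h2⟩⟩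
  · have := h1 h
    exact ⟨⟨fun _ => h, h1⟩, ⟨fun h' => absurd this h'.not_gt, h2⟩⟩

/-- A strictly quasiconvex function on `(0, ∞)`, positive near both ends and vanishing at `1`, has
one further zero `η`, with `η = 1` when the zero at `1` is the minimum. -/
lemma exists_zero_of_valley {f : ℝ → ℝ} (hc : ContinuousOn f (Ioi 0))
    (U : ∀ p q r, 0 < p → p < q → q < r → f p ≤ f q → f q < f r) (h1 : f 1 = 0)
    (hl : ∃ e, 0 < e ∧ e < 1 ∧ 0 < f e) (hr : ∃ M, 1 < M ∧ 0 < f M) :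
    ∃ η, 0 < η ∧ ∀ y, 0 < y → y ≠ 1 →
      (0 < f y * (y - 1) ↔ η < y) ∧ (f y * (y - 1) < 0 ↔ y < η) := by
  obtain ⟨e, he0, he1, hfe⟩ := hl
  obtain ⟨M, hM1, hfM⟩ := hr
  by_cases hA : ∃ m, 0 < m ∧ m < 1 ∧ f m < 0
  · obtain ⟨m, hm0, hm1, hfm⟩ := hA
    have hem : e ≤ m := by
      by_contra! hme
      have := U m e 1 hm0 hme he1 (by linarith)
      linarith
    obtain ⟨η, hη, hfη⟩ := intermediate_value_Icc' hem
      (hc.mono fun t ht => he0.trans_le ht.1) ⟨hfm.le, hfe.le⟩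
    have hη0 : 0 < η := he0.trans_le hη.1
    have hη1 : η < 1 := hη.2.trans_lt hm1
    refine ⟨η, hη0, fun y hy hy1 => sign_iff_of_imp (fun h => ?_) (fun h => ?_) (fun h => ?_)⟩
    · rcases lt_or_gt_of_ne hy1 with h' | h'
      · have : f y < 0 := by
          by_contra! hcon
          have := U η y 1 hη0 h h' (by linarith)
          linarith
        exact mul_pos_of_neg_of_neg this (by linarith)
      · have := U η 1 y hη0 hη1 h' (by linarith)
        exact mul_pos (by linarith) (by linarith)
    · have : 0 < f y := by
        by_contra! hcon
        have := U y η 1 hy h hη1 (by linarith)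
        linarith
      exact mul_neg_of_pos_of_neg this (by linarith)
    · rw [h, hfη, zero_mul]
  by_cases hB : ∃ m, 1 < m ∧ f m < 0
  · obtain ⟨m, hm1, hfm⟩ := hB
    have hmM : m ≤ M := by
      by_contra! hMm
      have := U 1 M m one_pos hM1 hMm (by linarith)
      linarith
    obtain ⟨η, hη, hfη⟩ := intermediate_value_Icc hmM
      (hc.mono fun t ht => (one_pos.trans hm1).trans_le ht.1) ⟨hfm.le, hfM.le⟩
    have hη1 : 1 < η := hm1.trans_le hη.1
    refine ⟨η, by linarith, fun y hy hy1 =>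
      sign_iff_of_imp (fun h => ?_) (fun h => ?_) (fun h => ?_)⟩
    · have := U 1 η y one_pos hη1 h (by linarith)
      exact mul_pos (by linarith) (by linarith)
    · rcases lt_or_gt_of_ne hy1 with h' | h'
      · have : 0 < f y := by
          by_contra! hcon
          have := U y 1 η hy h' hη1 (by linarith)
          linarith
        exact mul_neg_of_pos_of_neg this (by linarith)
      · have : f y < 0 := by
          by_contra! hcon
          have := U 1 y η one_pos h' h (by linarith)
          linarith
        exact mul_neg_of_neg_of_pos this (by linarith)
    · rw [h, hfη, zero_mul]
  push Not at hA hB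
  refine ⟨1, one_pos, fun y hy hy1 => sign_iff_of_imp (fun h => ?_) (fun h => ?_)
    (fun h => absurd h hy1)⟩
  · have h2 := hB ((1 + y) / 2) (by linarith)
    have h3 := U 1 ((1 + y) / 2) y one_pos (by linarith) (by linarith) (by linarith)
    exact mul_pos (by linarith) (by linarith)
  · have h2 := hA ((1 + y) / 2) (by linarith) (by linarith)
    have h3 : 0 < f y := by
      by_contra! hcon
      have := U y ((1 + y) / 2) 1 hy (by linarith) (by linarith) (by linarith)
      linarith
    exact mul_neg_of_pos_of_neg h3 (by linarith)

/-- The one-sided version of `exists_zero_of_valley`, on `[1, ∞)`. -/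
lemma exists_zero_of_valley_right {f : ℝ → ℝ} (hc : ContinuousOn f (Ici 1))
    (U : ∀ p q r, 1 ≤ p → p < q → q < r → f p ≤ f q → f q < f r) (h1 : f 1 = 0)
    (hm : ∃ m, 1 < m ∧ f m < 0) (hM : ∃ M, 1 < M ∧ 0 < f M) :
    ∃ η, 1 < η ∧ ∀ y, 1 < y → (0 < f y ↔ η < y) ∧ (f y < 0 ↔ y < η) := by
  obtain ⟨m, hm1, hfm⟩ := hm
  obtain ⟨M, hM1, hfM⟩ := hM
  have hmM : m ≤ M := by
    by_contra! hMm
    have := U 1 M m le_rfl hM1 hMm (by linarith)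
    linarith
  obtain ⟨η, hη, hfη⟩ := intermediate_value_Icc hmM
    (hc.mono fun t ht => hm1.le.trans ht.1) ⟨hfm.le, hfM.le⟩
  have hη1 : 1 < η := hm1.trans_le hη.1
  refine ⟨η, hη1, fun y hy => sign_iff_of_imp (fun h => ?_) (fun h => ?_) (fun h => ?_)⟩
  · have := U 1 η y le_rfl hη1 h (by linarith)
    linarith
  · by_contra! hcon
    have := U 1 y η le_rfl hy h (by linarith)
    linarith
  · rw [h, hfη]

lemma exists_neg_left_of_deriv_pos {f : ℝ → ℝ} {m : ℝ} (hd : HasDerivAt f m 1) (f1 : f 1 = 0)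
    (h : 0 < m) : ∃ y, 0 < y ∧ y < 1 ∧ f y < 0 := by
  have h3 : Tendsto (slope f 1) (𝓝[<] 1) (𝓝 m) :=
    hd.tendsto_slope.mono_left (nhdsWithin_mono 1 (fun y (hy : y < 1) => hy.ne))
  obtain ⟨y, hy, hy'⟩ := ((h3.eventually (lt_mem_nhds h)).and (Ioo_mem_nhdsLT one_pos)).exists
  rw [slope_def_field, f1, sub_zero] at hy
  refine ⟨y, hy'.1, hy'.2, ?_⟩
  by_contra! hcon
  exact absurd hy (not_lt.2 (div_nonpos_of_nonneg_of_nonpos hcon (by linarith [hy'.2])))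

lemma exists_neg_right_of_deriv_neg {f : ℝ → ℝ} {m : ℝ} (hd : HasDerivAt f m 1) (f1 : f 1 = 0)
    (h : m < 0) : ∃ y, 1 < y ∧ f y < 0 := by
  have h3 : Tendsto (slope f 1) (𝓝[>] 1) (𝓝 m) :=
    hd.tendsto_slope.mono_left (nhdsWithin_mono 1 (fun y (hy : 1 < y) => hy.ne'))
  obtain ⟨y, hy, hy'⟩ := ((h3.eventually (gt_mem_nhds h)).and self_mem_nhdsWithin).exists
  rw [slope_def_field, f1, sub_zero] at hy
  refine ⟨y, hy', ?_⟩
  by_contra! hcon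
  exact absurd hy (not_lt.2 (div_nonneg hcon (by linarith [show (1 : ℝ) < y from hy'])))

end Valley

/-! ### The slope of the shock branch relative to the rarefaction branch -/

section Slope

variable {a : ℝ}

/-- The logarithm of the ratio of the slope of the (extended) shock branch to that of the
rarefaction branch `q ^ ζ - 1`. -/
def ls (a q : ℝ) : ℝ := Real.log (svd a q / (zet a * q ^ (zet a - 1)))

lemma svd_pos (h0 : 0 < a) {q : ℝ} (hq : 0 < q) : 0 < svd a q := by
  have hp : 0 < √((1 + a) * (q + a)) := Real.sqrt_pos.2 (by positivity)
  unfold svd; positivity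

lemma svd_eq (h0 : 0 < a) {q : ℝ} (hq : 0 < q) :
    svd a q = zet a * q ^ (zet a - 1) * Real.exp (ls a q) := by
  have := zet_pos h0
  have := svd_pos h0 hq
  rw [ls, Real.exp_log (by positivity)]
  field_simp

lemma ls_one (h0 : 0 < a) : ls a 1 = 0 := by
  have : svd a 1 = zet a := by
    simp only [svd, sqrt_one_add_sq h0, zet]
    field_simp; ring
  rw [ls, Real.one_rpow, this, mul_one, div_self (zet_pos h0).ne', Real.log_one]

lemma hasDerivAt_ls (h0 : 0 < a) {q : ℝ} (hq : 0 < q) :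
    HasDerivAt (ls a) ((q - 1) * ((1 - a) * q - 2 * a * (1 + 2 * a)) /
      (2 * (1 + a) * q * (q + (1 + 2 * a)) * (q + a))) q := by
  have hz := zet_pos h0
  have hs := svd_pos h0 hq
  have hd : HasDerivAt (fun q : ℝ => zet a * q ^ (zet a - 1))
      (zet a * ((zet a - 1) * q ^ (zet a - 1 - 1))) q :=
    (Real.hasDerivAt_rpow_const (Or.inl hq.ne')).const_mul _
  have h := ((hasDerivAt_svd h0 hq).div hd (by positivity)).log
    (by simp only [Pi.div_apply]; positivity)
  refine h.congr_deriv ?_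
  have hR : 0 < √((1 + a) * (q + a)) := Real.sqrt_pos.2 (by positivity)
  have hr : 0 < q ^ (zet a - 1) := by positivity
  simp only [Pi.div_apply]
  rw [Real.rpow_sub_one hq.ne' (zet a - 1), svd]
  set R := √((1 + a) * (q + a))
  set r := q ^ (zet a - 1)
  simp only [zet]
  have hqa : 0 < q + a := by positivity
  have hqA : 0 < q + (1 + 2 * a) := by positivity
  field_simp
  ring

lemma ls_lt (h0 : 0 < a) {p q : ℝ} (hp : 0 < p) (hpq : p < q)
    (h : ∀ t ∈ Ioo p q, t ≠ 1 → 0 < (t - 1) * ((1 - a) * t - 2 * a * (1 + 2 * a))) :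
    ls a p < ls a q := by
  refine lt_of_hasDerivAt_pos_off 1 hpq (fun y hy => hasDerivAt_ls h0 (hp.trans_le hy.1))
    fun y hy hy1 => div_pos (h y hy hy1) ?_
  have : 0 < y := hp.trans hy.1
  positivity

lemma ls_gt (h0 : 0 < a) {p q : ℝ} (hp : 0 < p) (hpq : p < q)
    (h : ∀ t ∈ Ioo p q, t ≠ 1 → (t - 1) * ((1 - a) * t - 2 * a * (1 + 2 * a)) < 0) :
    ls a q < ls a p := by
  refine lt_of_hasDerivAt_neg_off 1 hpq (fun y hy => hasDerivAt_ls h0 (hp.trans_le hy.1))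
    fun y hy hy1 => div_neg_of_neg_of_pos (h y hy hy1) ?_
  have : 0 < y := hp.trans hy.1
  positivity

/-- Past `1` the slope ratio can exceed `1` only on its increasing part. -/
lemma ls_increasing_of_nonneg (h0 : 0 < a) (h1 : a < 1) {p : ℝ} (hp : 1 < p) (h : 0 ≤ ls a p) :
    2 * a * (1 + 2 * a) < (1 - a) * p := by
  by_contra! hcon
  have := ls_gt h0 one_pos hp fun t ht _ =>
    mul_neg_of_pos_of_neg (by linarith [ht.1]) (by nlinarith [ht.2])
  rw [ls_one h0] at this
  linarith

lemma ls_strictMono_of (h0 : 0 < a) (h1 : a < 1) {p q : ℝ} (hp : 1 ≤ p) (hpq : p < q)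
    (h : 2 * a * (1 + 2 * a) ≤ (1 - a) * p) : ls a p < ls a q :=
  ls_lt h0 (by linarith) hpq fun t ht _ =>
    mul_pos (by linarith [ht.1]) (by nlinarith [ht.1])

lemma ls_upcrossing (h0 : 0 < a) (h1 : a < 1) {p q : ℝ} (hp : 0 < p) (hpq : p < q)
    (hp1 : p ≠ 1) (hq1 : q ≠ 1) (h : 0 ≤ ls a p) : 0 < ls a q := by
  have l1 := ls_one h0
  rcases lt_or_gt_of_ne hp1 with hp' | hp'
  · have hK : 2 * a * (1 + 2 * a) < 1 - a := by
      by_contra! hcon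
      have := ls_lt h0 hp hp' fun t ht _ =>
        mul_pos_of_neg_of_neg (by linarith [ht.2]) (by nlinarith [ht.2])
      linarith
    rcases lt_or_gt_of_ne hq1 with hq' | hq'
    · rcases le_or_gt (2 * a * (1 + 2 * a)) ((1 - a) * q) with h' | h'
      · have := ls_gt h0 (hp.trans hpq) hq' fun t ht _ =>
          mul_neg_of_neg_of_pos (by linarith [ht.2]) (by nlinarith [ht.1])
        linarith
      · have := ls_lt h0 hp hpq fun t ht _ =>
          mul_pos_of_neg_of_neg (by linarith [ht.2]) (by nlinarith [ht.2])
        linarith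
    · have := ls_strictMono_of h0 h1 le_rfl hq' (by linarith)
      linarith
  · have := ls_strictMono_of h0 h1 hp'.le hpq (ls_increasing_of_nonneg h0 h1 hp' h).le
    linarith

/-- The difference of the extended shock branch and the rarefaction branch. -/
def gap (a q : ℝ) : ℝ := sv a q - (q ^ zet a - 1)

lemma hasDerivAt_gap (h0 : 0 < a) {q : ℝ} (hq : 0 < q) :
    HasDerivAt (gap a) (zet a * q ^ (zet a - 1) * (Real.exp (ls a q) - 1)) q := by
  refine ((hasDerivAt_sv h0 hq).sub
    ((Real.hasDerivAt_rpow_const (Or.inl hq.ne')).sub_const 1)).congr_deriv ?_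
  rw [svd_eq h0 hq]; ring

lemma gap_one : gap a 1 = 0 := by simp [gap, sv]

lemma tendsto_rpow_zet_div_sqrt (h0 : 0 < a) (h1 : a < 1) :
    Tendsto (fun q : ℝ => q ^ zet a / √q) atTop (𝓝 0) := by
  have hz := zet_lt_half h0 h1
  refine (tendsto_rpow_neg_atTop (show 0 < 1 / 2 - zet a by linarith)).congr' ?_
  filter_upwards [eventually_gt_atTop 0] with q hq
  rw [Real.sqrt_eq_rpow, ← Real.rpow_sub hq]
  congr 1; ring

/-- The root `y₀` of `α`, in terms of the gap between the two branches. -/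
theorem exists_gap_root (h0 : 0 < a) (h1 : a < 1) :
    ∃ y₀, 0 < y₀ ∧ (a < 1 / 4 → y₀ < 1) ∧ (a = 1 / 4 → y₀ = 1) ∧ (1 / 4 < a → 1 < y₀) ∧
      ∀ q, 0 < q → q ≠ 1 →
        (0 < gap a q * (q - 1) ↔ y₀ < q) ∧ (gap a q * (q - 1) < 0 ↔ q < y₀) := by
  have hz := zet_pos h0
  have hz2 := zet_lt_half h0 h1
  have hpos : ∀ q : ℝ, 0 < q → 0 < zet a * q ^ (zet a - 1) := fun q hq => by positivity
  have U : ∀ p q r, 0 < p → p < q → q < r → gap a p ≤ gap a q → gap a q < gap a r := by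
    intro p q r hp hpq hqr h
    refine valley_of_deriv 0 1 (fun y hy => hasDerivAt_gap h0 hy) ?_ hp hp.le hpq hqr h
    intro p q hp hpq hp1 hq1 h
    have h2 : 0 ≤ ls a p := by
      have := nonneg_of_mul_nonneg_right h (hpos p hp)
      rw [← Real.one_le_exp_iff]; linarith
    have h3 := ls_upcrossing h0 h1 hp hpq hp1 hq1 h2
    exact mul_pos (hpos q (hp.trans hpq)) (by linarith [Real.add_one_lt_exp h3.ne'])
  have hl : ∃ e, 0 < e ∧ e < 1 ∧ 0 < gap a e := by
    have hs : ContinuousAt (sv a) 0 := by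
      unfold sv
      refine ContinuousAt.div (by fun_prop) (by fun_prop) ?_
      exact (Real.sqrt_pos.2 (by positivity)).ne'
    have t := (hs.tendsto.mono_left (nhdsWithin_le_nhds (s := Ioi 0))).sub
      ((tendsto_rpow_zet_zero h0).sub_const 1)
    have e0 : sv a 0 = -√(zet a) := by
      rw [← sqrt_zet h0, sv, zero_add, Real.sqrt_mul (by linarith)]
      ring
    have hlt : √(zet a) < 1 := by
      rw [Real.sqrt_lt' one_pos]; linarith
    have h2 : 0 < sv a 0 - (0 - 1) := by rw [e0]; linarith
    obtain ⟨e, he, he'⟩ := ((t.eventually (lt_mem_nhds h2)).and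
      (Ioo_mem_nhdsGT one_pos)).exists
    exact ⟨e, he'.1, he'.2, he⟩
  have hr : ∃ M, 1 < M ∧ 0 < gap a M := by
    have hc : 0 < a / √(1 + a) := div_pos h0 (Real.sqrt_pos.2 (by linarith))
    have t := (tendsto_vel_div_sqrt h0).sub (tendsto_rpow_zet_div_sqrt h0 h1)
    rw [sub_zero] at t
    obtain ⟨M, hM, hM'⟩ := ((t.eventually (lt_mem_nhds hc)).and (eventually_gt_atTop 1)).exists
    refine ⟨M, hM', ?_⟩
    have hs := Real.sqrt_pos.2 (one_pos.trans hM')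
    rw [← sub_div, vel_of_gt hM'] at hM
    have := (div_pos_iff_of_pos_right hs).1 hM
    unfold gap; linarith
  obtain ⟨y₀, hy0, hy⟩ := exists_zero_of_valley
    (fun q hq => (hasDerivAt_gap h0 hq).continuousAt.continuousWithinAt) U gap_one hl hr
  have l1 := ls_one h0
  have dpos : ∀ p q, 0 < p → p < q → (∀ t ∈ Ioo p q, 0 < ls a t) → gap a p < gap a q := by
    intro p q hp hpq h
    refine lt_of_hasDerivAt_pos_off 1 hpq (fun y hy => hasDerivAt_gap h0 (hp.trans_le hy.1))
      fun y hy _ => mul_pos (hpos y (hp.trans hy.1)) ?_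
    linarith [Real.add_one_lt_exp (h y hy).ne', h y hy]
  have dneg : ∀ p q, 0 < p → p < q → (∀ t ∈ Ioo p q, ls a t < 0) → gap a q < gap a p := by
    intro p q hp hpq h
    refine lt_of_hasDerivAt_neg_off 1 hpq (fun y hy => hasDerivAt_gap h0 (hp.trans_le hy.1))
      fun y hy _ => mul_neg_of_pos_of_neg (hpos y (hp.trans hy.1)) ?_
    linarith [Real.exp_lt_one_iff.2 (h y hy)]
  have g1 : gap a 1 = 0 := gap_one
  refine ⟨y₀, hy0, fun ha => ?_, fun ha => ?_, fun ha => ?_, hy⟩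
  · -- the slope ratio exceeds `1` between its maximum `q` and `1`
    set q := 2 * a * (1 + 2 * a) / (1 - a) with hq
    have hq0 : 0 < q := div_pos (by positivity) (by linarith)
    have hq1 : q < 1 := by
      rw [hq, div_lt_one (by linarith)]; nlinarith
    have hqK : (1 - a) * q = 2 * a * (1 + 2 * a) := mul_div_cancel₀ _ (by linarith)
    have : gap a q < gap a 1 := dpos q 1 hq0 hq1 fun t ht => by
      have := ls_gt h0 (hq0.trans ht.1) ht.2 fun s hs _ =>
        mul_neg_of_neg_of_pos (by linarith [hs.2]) (by nlinarith [hs.1, ht.1])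
      linarith
    refine lt_trans (((hy q hq0 hq1.ne).1).1 ?_) hq1
    exact mul_pos_of_neg_of_neg (by linarith) (by linarith)
  · refine le_antisymm (le_of_forall_gt fun q hq => ?_) (le_of_forall_lt fun q hq => ?_)
    · have : gap a 1 < gap a q := dpos 1 q one_pos hq fun t ht => by
        have := ls_strictMono_of h0 h1 le_rfl ht.1 (by rw [ha]; norm_num)
        linarith
      exact ((hy q (by linarith) hq.ne').1).1 (mul_pos (by linarith) (by linarith))
    · rcases le_or_gt q 0 with h | h
      · linarith
      · have : gap a 1 < gap a q := dneg q 1 h hq fun t ht => by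
          have := ls_lt h0 (h.trans ht.1) ht.2 fun s hs _ =>
            mul_pos_of_neg_of_neg (by linarith [hs.2]) (by rw [ha]; linarith [hs.2])
          linarith
        exact ((hy q h hq.ne).2).1 (mul_neg_of_pos_of_neg (by linarith) (by linarith))
  · set q := 2 * a * (1 + 2 * a) / (1 - a) with hq
    have hq1 : 1 < q := by
      rw [hq, one_lt_div (by linarith)]; nlinarith
    have hqK : (1 - a) * q = 2 * a * (1 + 2 * a) := mul_div_cancel₀ _ (by linarith)
    have : gap a q < gap a 1 := dneg 1 q one_pos hq1 fun t ht => by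
      have := ls_gt h0 one_pos ht.1 fun s hs _ =>
        mul_neg_of_pos_of_neg (by linarith [hs.1]) (by nlinarith [hs.2, ht.2])
      linarith
    refine lt_trans hq1 (((hy q (by linarith) hq1.ne').2).1 ?_)
    exact mul_neg_of_neg_of_pos (by linarith) (by linarith)

end Slope

/-! ### The locus of vanishing outgoing forward wave -/

section Forward

variable {a : ℝ}

/-- The function whose sign decides the type of the outgoing forward wave: the excess of the
velocity drop across a sole backward wave of strength `x y` over the incoming one. -/
def fwd (a x y : ℝ) : ℝ := vel a (x * y) - vel a x - imp a x * vel a y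

/-- The logarithm of `veld a q / (ζ q ^ (ζ - 1))`. -/
def lh (a q : ℝ) : ℝ := if q ≤ 1 then 0 else ls a q

lemma lh_of_le {q : ℝ} (hq : q ≤ 1) : lh a q = 0 := if_pos hq

lemma lh_of_ge (h0 : 0 < a) {q : ℝ} (hq : 1 ≤ q) : lh a q = ls a q := by
  rcases hq.eq_or_lt with h | h
  · rw [← h, ls_one h0, lh_of_le le_rfl]
  · exact if_neg (not_le.2 h)

lemma veld_eq (h0 : 0 < a) {q : ℝ} (hq : 0 < q) :
    veld a q = zet a * q ^ (zet a - 1) * Real.exp (lh a q) := by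
  unfold veld lh
  split_ifs
  · simp
  · exact svd_eq h0 hq

/-- The logarithm of the excess of `imp` over its rarefaction value `q ^ ζ`; up to the factor
`2 γ c_v` this is the entropy jump across the wave (see `wave_entropy`). -/
def logExc (a q : ℝ) : ℝ := Real.log (imp a q) - zet a * Real.log q

lemma logExc_of_le {q : ℝ} (hq0 : 0 < q) (hq : q ≤ 1) : logExc a q = 0 := by
  rw [logExc, imp_of_le hq0 hq, Real.log_rpow hq0, sub_self]

lemma imp_eq_exp (h0 : 0 < a) {q : ℝ} (hq : 0 < q) :
    imp a q = q ^ zet a * Real.exp (logExc a q) := by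
  rw [logExc, Real.exp_sub, Real.exp_log (imp_pos h0 hq), Real.rpow_def_of_pos hq, mul_comm (zet a)]
  have := Real.exp_pos (Real.log q * zet a)
  field_simp

lemma hasDerivAt_logExc (h0 : 0 < a) {q : ℝ} (hq : 1 < q) :
    HasDerivAt (logExc a)
      (a * (1 - a) * (q - 1) ^ 2 / (2 * (1 + a) * (q * (1 + a * q) * (q + a)))) q := by
  have hq0 : 0 < q := by linarith
  have hi := imp_pos h0 hq0
  refine (((hasDerivAt_imp h0 hq0).log hi.ne').sub
    ((Real.hasDerivAt_log hq0.ne').const_mul (zet a))).congr_deriv ?_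
  have e : imp a q ^ 2 = q * (1 + a * q) / (q + a) := by
    rw [imp_sq h0 hq0, impSq_of_ge h0 hq.le]
  rw [div_div, mul_assoc, ← pow_two, e, impSqd, if_neg (not_le.2 hq), zet]
  field_simp
  ring

lemma logExc_strictMono (h0 : 0 < a) (h1 : a < 1) {p q : ℝ} (hp : 1 ≤ p) (hpq : p < q) :
    logExc a p < logExc a q := by
  refine lt_of_hasDerivAt_pos hpq ?_ (fun y hy => hasDerivAt_logExc h0 (hp.trans_lt hy.1)) ?_
  · intro y hy
    have hy0 : 0 < y := by linarith [hy.1]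
    refine ContinuousAt.continuousWithinAt (ContinuousAt.sub (ContinuousAt.log ?_ ?_)
      ((Real.continuousAt_log hy0.ne').const_mul _))
    · exact (hasDerivAt_imp h0 hy0).continuousAt
    · exact (imp_pos h0 hy0).ne'
  · intro y hy
    have hy1 : 1 < y := hp.trans_lt hy.1
    have : 0 < y - 1 := by linarith
    have : 0 < 1 - a := by linarith
    have : 0 < y := by linarith
    positivity

lemma logExc_pos (h0 : 0 < a) (h1 : a < 1) {q : ℝ} (hq : 1 < q) : 0 < logExc a q := by
  have := logExc_strictMono h0 h1 le_rfl hq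
  rwa [logExc_of_le one_pos le_rfl] at this

lemma one_add_vel_lt_imp (h0 : 0 < a) {q : ℝ} (hq : 1 < q) : 1 + vel a q < imp a q := by
  have hq0 : 0 < q := by linarith
  have hp : 0 < (1 + a) * (q + a) := by positivity
  have hR : 0 < √((1 + a) * (q + a)) := Real.sqrt_pos.2 hp
  have hR2 : √((1 + a) * (q + a)) ^ 2 = (1 + a) * (q + a) := Real.sq_sqrt hp.le
  refine lt_of_pow_lt_pow_left₀ 2 (imp_pos h0 hq0).le ?_
  rw [imp_sq h0 hq0, impSq_of_ge h0 hq.le, vel_of_gt hq, sv]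
  set R := √((1 + a) * (q + a))
  have e : (1 + a * (q - 1) / R) ^ 2 = (R + a * (q - 1)) ^ 2 / R ^ 2 := by field_simp
  rw [e, hR2, div_lt_div_iff₀ hp (by positivity)]
  have h2 : 2 * R < q + 1 + 2 * a := by
    refine lt_of_pow_lt_pow_left₀ 2 (by positivity) ?_
    rw [mul_pow, hR2]
    nlinarith [mul_pos (sub_pos.2 hq) (sub_pos.2 hq)]
  have h3 : (R + a * (q - 1)) ^ 2 < q * (1 + a * q) * (1 + a) := by
    have := mul_lt_mul_of_pos_left h2 (show 0 < a * (q - 1) from mul_pos h0 (by linarith))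
    nlinarith
  have := mul_lt_mul_of_pos_right h3 (show 0 < q + a by positivity)
  linarith

lemma fwd_one_right (x : ℝ) : fwd a x 1 = 0 := by simp [fwd]

lemma fwd_one_left (y : ℝ) : fwd a 1 y = 0 := by simp [fwd]

lemma hasDerivAt_fwd (h0 : 0 < a) {x y : ℝ} (hx : 0 < x) (hy : 0 < y) :
    HasDerivAt (fwd a x) (x * veld a (x * y) - imp a x * veld a y) y := by
  have h1 : HasDerivAt (fun y => vel a (x * y)) (veld a (x * y) * (x * 1)) y :=
    HasDerivAt.comp (h₂ := vel a) y (hasDerivAt_vel h0 (by positivity))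
      ((hasDerivAt_id y).const_mul x)
  refine ((h1.sub_const _).sub ((hasDerivAt_vel h0 hy).const_mul _)).congr_deriv ?_
  ring

lemma fwd_deriv_eq (h0 : 0 < a) {x y : ℝ} (hx : 0 < x) (hy : 0 < y) :
    x * veld a (x * y) - imp a x * veld a y = zet a * y ^ (zet a - 1) * x ^ zet a *
      (Real.exp (lh a (x * y)) - Real.exp (logExc a x + lh a y)) := by
  rw [veld_eq h0 (by positivity), veld_eq h0 hy, imp_eq_exp h0 hx, Real.exp_add,
    Real.mul_rpow hx.le hy.le, Real.rpow_sub_one hx.ne']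
  field_simp

lemma fwd_deriv_nonneg_iff (h0 : 0 < a) {x y : ℝ} (hx : 0 < x) (hy : 0 < y) :
    0 ≤ x * veld a (x * y) - imp a x * veld a y ↔ logExc a x ≤ lh a (x * y) - lh a y := by
  have := zet_pos h0
  have h : 0 < zet a * y ^ (zet a - 1) * x ^ zet a := by positivity
  rw [fwd_deriv_eq h0 hx hy, mul_nonneg_iff_of_pos_left h, sub_nonneg, Real.exp_le_exp,
    le_sub_iff_add_le]

lemma fwd_deriv_pos_iff (h0 : 0 < a) {x y : ℝ} (hx : 0 < x) (hy : 0 < y) :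
    0 < x * veld a (x * y) - imp a x * veld a y ↔ logExc a x < lh a (x * y) - lh a y := by
  have := zet_pos h0
  have h : 0 < zet a * y ^ (zet a - 1) * x ^ zet a := by positivity
  rw [fwd_deriv_eq h0 hx hy, mul_pos_iff_of_pos_left h, sub_pos, Real.exp_lt_exp,
    lt_sub_iff_add_lt]

/-- The quadratic that decides the monotonicity of `y ↦ ls (x y) - ls y`. -/
def quad (a x y : ℝ) : ℝ :=
  (2 + a) * x * y ^ 2 - a * (1 + 2 * a) * (x + 1) * y - a * (1 + 2 * a) * (3 + 4 * a)

lemma quad_one (a x : ℝ) :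
    quad a x 1 = 2 * (1 + a) * ((1 - a) * x - 2 * a * (1 + 2 * a)) := by
  unfold quad; ring

lemma quad_pos_of (h0 : 0 < a) {x p q : ℝ} (hx : 0 < x) (hp : 0 < p) (hpq : p < q)
    (h : 0 ≤ quad a x p) : 0 < quad a x q := by
  -- `quad / y` is strictly increasing
  have e : p * quad a x q - q * quad a x p
      = (q - p) * ((2 + a) * x * p * q + a * (1 + 2 * a) * (3 + 4 * a)) := by
    unfold quad; ring
  have hq := hp.trans hpq
  have : 0 < p * quad a x q := by
    have h2 : 0 < (q - p) * ((2 + a) * x * p * q + a * (1 + 2 * a) * (3 + 4 * a)) :=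
      mul_pos (by linarith) (by positivity)
    have := mul_nonneg hq.le h
    linarith
  exact pos_of_mul_pos_right this hp.le

lemma hasDerivAt_ls_ratio (h0 : 0 < a) {x y : ℝ} (hx : 0 < x) (hy : 0 < y) :
    HasDerivAt (fun y => ls a (x * y) - ls a y) ((x - 1) * quad a x y /
      (2 * (x * y + (1 + 2 * a)) * (y + (1 + 2 * a)) * (x * y + a) * (y + a))) y := by
  have hxy : 0 < x * y := by positivity
  have h1 : HasDerivAt (fun y => ls a (x * y)) _ y :=
    HasDerivAt.comp (h₂ := ls a) y (hasDerivAt_ls h0 hxy) ((hasDerivAt_id y).const_mul x)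
  refine (h1.sub (hasDerivAt_ls h0 hy)).congr_deriv ?_
  unfold quad
  have : 0 < x * y + (1 + 2 * a) := by positivity
  have : 0 < y + (1 + 2 * a) := by positivity
  have : 0 < x * y + a := by positivity
  field_simp
  ring

lemma ls_ratio_lt (h0 : 0 < a) {x p q : ℝ} (hx : 1 < x) (hp : 0 < p) (hpq : p < q)
    (h : 0 ≤ quad a x p) : ls a (x * p) - ls a p < ls a (x * q) - ls a q := by
  have hx0 : 0 < x := by linarith
  have hd : ∀ y, 0 < y → HasDerivAt (fun y => ls a (x * y) - ls a y) _ y :=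
    fun y hy => hasDerivAt_ls_ratio h0 hx0 hy
  refine lt_of_hasDerivAt_pos_off (f := fun y => ls a (x * y) - ls a y) 0 hpq
    (fun y hy => hd y (hp.trans_le hy.1)) fun y hy _ => ?_
  have hy0 : 0 < y := hp.trans hy.1
  exact div_pos (mul_pos (by linarith) (quad_pos_of h0 hx0 hp hy.1 h)) (by positivity)

lemma ls_ratio_gt (h0 : 0 < a) {x p q : ℝ} (hx : 1 < x) (hp : 0 < p) (hpq : p < q)
    (h : quad a x q < 0) : ls a (x * q) - ls a q < ls a (x * p) - ls a p := by
  have hx0 : 0 < x := by linarith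
  have hd : ∀ y, 0 < y → HasDerivAt (fun y => ls a (x * y) - ls a y) _ y :=
    fun y hy => hasDerivAt_ls_ratio h0 hx0 hy
  refine lt_of_hasDerivAt_neg_off (f := fun y => ls a (x * y) - ls a y) 0 hpq
    (fun y hy => hd y (hp.trans_le hy.1)) fun y hy _ => ?_
  have hy0 : 0 < y := hp.trans hy.1
  refine div_neg_of_neg_of_pos (mul_neg_of_pos_of_neg (by linarith) ?_) (by positivity)
  by_contra! hcon
  linarith [quad_pos_of h0 hx0 hy0 hy.2 hcon]

/-- For an incoming left shock the `y`-derivative of `fwd` changes sign once, upwards. -/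
lemma fwd_upcrossing (h0 : 0 < a) (h1 : a < 1) {x p q l : ℝ} (hx : 1 < x) (hp : 0 < p)
    (hpq : p < q) (hl : 0 < l) (h : l ≤ lh a (x * p) - lh a p) :
    l < lh a (x * q) - lh a q := by
  have hx0 : 0 < x := by linarith
  have hq : 0 < q := hp.trans hpq
  have l1 := ls_one h0
  rcases le_or_gt p 1 with hp1 | hp1
  · rw [lh_of_le hp1, sub_zero] at h
    have hxp : 1 < x * p := by
      by_contra! hcon
      rw [lh_of_le hcon] at h
      linarith
    rw [lh_of_ge h0 hxp.le] at h
    have hK := ls_increasing_of_nonneg h0 h1 hxp (hl.le.trans h)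
    rcases le_or_gt q 1 with hq1 | hq1
    · have h2 : x * p < x * q := by gcongr
      rw [lh_of_le hq1, lh_of_ge h0 (hxp.trans h2).le]
      linarith [ls_strictMono_of h0 h1 hxp.le h2 hK.le]
    · have h2 : ls a (x * p) ≤ ls a x := by
        rcases hp1.eq_or_lt with e | e
        · rw [e, mul_one]
        · exact (ls_strictMono_of h0 h1 hxp.le (by nlinarith) hK.le).le
      have h3 : 0 ≤ quad a x 1 := by
        rw [quad_one]
        have : (1 - a) * (x * p) ≤ (1 - a) * x := by
          have : x * p ≤ x := by nlinarith
          nlinarith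
        exact mul_nonneg (by linarith) (by linarith)
      have h4 := ls_ratio_lt h0 hx one_pos hq1 h3
      rw [mul_one, l1] at h4
      rw [lh_of_ge h0 hq1.le, lh_of_ge h0 (by nlinarith)]
      linarith
  · rw [lh_of_ge h0 hp1.le, lh_of_ge h0 (by nlinarith)] at h
    rw [lh_of_ge h0 (hp1.trans hpq).le, lh_of_ge h0 (by nlinarith)]
    rcases le_or_gt 0 (quad a x p) with h2 | h2
    · exact h.trans_lt (ls_ratio_lt h0 hx hp hpq h2)
    · have h3 := ls_ratio_gt h0 hx one_pos hp1 h2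
      rw [mul_one, l1] at h3
      have hK := ls_increasing_of_nonneg h0 h1 hx (by linarith)
      have h4 : 0 ≤ quad a x 1 := by
        rw [quad_one]; exact mul_nonneg (by linarith) (by linarith)
      linarith [quad_pos_of h0 hx0 one_pos hp1 h4]

lemma tendsto_fwd_div_sqrt (h0 : 0 < a) {x : ℝ} (hx : 0 < x) :
    Tendsto (fun y => fwd a x y / √y) atTop (𝓝 (a / √(1 + a) * (√x - imp a x))) := by
  have t1 : Tendsto (fun y : ℝ => x * y) atTop atTop := tendsto_id.const_mul_atTop hx
  have t2 := ((tendsto_vel_div_sqrt h0).comp t1).mul_const (√x)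
  have t3 : Tendsto (fun y : ℝ => vel a x / √y) atTop (𝓝 0) :=
    tendsto_const_nhds.div_atTop Real.tendsto_sqrt_atTop
  have t4 := (t2.sub t3).sub ((tendsto_vel_div_sqrt h0).const_mul (imp a x))
  have e : a / √(1 + a) * √x - 0 - imp a x * (a / √(1 + a)) = a / √(1 + a) * (√x - imp a x) := by
    ring
  rw [e] at t4
  refine t4.congr' ?_
  filter_upwards [eventually_gt_atTop 0] with y hy
  have := Real.sqrt_pos.2 hx
  have := Real.sqrt_pos.2 hy
  simp only [Function.comp_apply, fwd, Real.sqrt_mul hx.le]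
  field_simp

lemma fwd_small_pos (h0 : 0 < a) {x : ℝ} (hx : 1 < x) :
    ∃ e, 0 < e ∧ e < 1 ∧ 0 < fwd a x e := by
  have hx0 : 0 < x := by linarith
  have t1 : Tendsto (fun y : ℝ => x * y) (𝓝[>] 0) (𝓝[>] 0) := by
    refine tendsto_nhdsWithin_iff.2 ⟨?_, ?_⟩
    · have : Tendsto (fun y : ℝ => x * y) (𝓝 0) (𝓝 (x * 0)) :=
        (continuous_const.mul continuous_id).tendsto 0
      rw [mul_zero] at this
      exact this.mono_left nhdsWithin_le_nhds
    · filter_upwards [self_mem_nhdsWithin] with y hy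
      exact mul_pos hx0 hy
  have t2 := (((tendsto_vel_zero h0).comp t1).sub_const (vel a x)).sub
    ((tendsto_vel_zero h0).const_mul (imp a x))
  have hlim : 0 < -1 - vel a x - imp a x * -1 := by linarith [one_add_vel_lt_imp h0 hx]
  obtain ⟨e, he, he'⟩ := ((t2.eventually (lt_mem_nhds hlim)).and
    (Ioo_mem_nhdsGT one_pos)).exists
  exact ⟨e, he'.1, he'.2, he⟩

/-- The sign of the `y`-derivative `x * veld a x - imp a x * ζ` of `fwd` on the line `y = 1`. -/
lemma slope_sq_sub (h0 : 0 < a) {x : ℝ} (hx : 1 < x) :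
    (x * veld a x) ^ 2 - (imp a x * zet a) ^ 2 = a ^ 2 * x * (x - 1) ^ 2 *
      ((1 - 3 * a) * x - 4 * a ^ 2) / (4 * (1 + a) ^ 2 * (x + a) ^ 3) := by
  have hx0 : 0 < x := by linarith
  have hp : 0 < (1 + a) * (x + a) := by positivity
  have hR : 0 < √((1 + a) * (x + a)) := Real.sqrt_pos.2 hp
  have hR2 : √((1 + a) * (x + a)) ^ 2 = (1 + a) * (x + a) := Real.sq_sqrt hp.le
  rw [mul_pow, mul_pow, imp_sq h0 hx0, impSq_of_ge h0 hx.le, veld, if_neg (not_le.2 hx), svd,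
    div_pow, mul_pow (2 * (x + a)), hR2, zet]
  field_simp
  ring

lemma veld_one : veld a 1 = zet a := by simp [veld]

/-- The third branch of the forward locus over an incoming left shock. -/
lemma exists_fwd_root_of_gt (h0 : 0 < a) (h1 : a < 1) {x : ℝ} (hx : 1 < x) :
    ∃ η, 0 < η ∧ (∀ y, 0 < y → y ≠ 1 →
      (0 < fwd a x y * (y - 1) ↔ η < y) ∧ (fwd a x y * (y - 1) < 0 ↔ y < η)) ∧
      (η < 1 ↔ 4 * a ^ 2 < (1 - 3 * a) * x) ∧ (η = 1 ↔ 4 * a ^ 2 = (1 - 3 * a) * x) := by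
  have hx0 : 0 < x := by linarith
  have hd : ∀ y, 0 < y → HasDerivAt (fwd a x) (x * veld a (x * y) - imp a x * veld a y) y :=
    fun y hy => hasDerivAt_fwd h0 hx0 hy
  have up : ∀ p q, 0 < p → p < q → 0 ≤ x * veld a (x * p) - imp a x * veld a p →
      0 < x * veld a (x * q) - imp a x * veld a q := by
    intro p q hp hpq h
    rw [fwd_deriv_nonneg_iff h0 hx0 hp] at h
    rw [fwd_deriv_pos_iff h0 hx0 (hp.trans hpq)]
    exact fwd_upcrossing h0 h1 hx hp hpq (logExc_pos h0 h1 hx) h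
  have U : ∀ p q r, 0 < p → p < q → q < r → fwd a x p ≤ fwd a x q → fwd a x q < fwd a x r :=
    fun p q r hp hpq hqr h =>
      valley_of_deriv 0 0 hd (fun p q hp hpq _ _ => up p q hp hpq) hp hp.le hpq hqr h
  have hr : ∃ M, 1 < M ∧ 0 < fwd a x M := by
    have hc : 0 < a / √(1 + a) := div_pos h0 (Real.sqrt_pos.2 (by linarith))
    have hlim : 0 < a / √(1 + a) * (√x - imp a x) :=
      mul_pos hc (by linarith [imp_lt_sqrt h0 h1 hx])
    obtain ⟨M, hM, hM'⟩ := (((tendsto_fwd_div_sqrt h0 hx0).eventually (lt_mem_nhds hlim)).and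
      (eventually_gt_atTop 1)).exists
    exact ⟨M, hM', (div_pos_iff_of_pos_right (Real.sqrt_pos.2 (by linarith))).1 hM⟩
  have f1 : fwd a x 1 = 0 := fwd_one_right x
  obtain ⟨η, hη, hs⟩ := exists_zero_of_valley
    (fun y hy => (hd y hy).continuousAt.continuousWithinAt) U f1 (fwd_small_pos h0 hx) hr
  refine ⟨η, hη, hs, ?_⟩
  -- `m` is the `y`-derivative at `y = 1`; its sign locates `η`
  have hd1 := hd 1 one_pos
  rw [mul_one, veld_one] at hd1
  have hsq := slope_sq_sub h0 hx
  set m := x * veld a x - imp a x * zet a with hm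
  have hsum : 0 < x * veld a x + imp a x * zet a :=
    add_pos (mul_pos hx0 (veld_pos h0 hx0)) (mul_pos (imp_pos h0 hx0) (zet_pos h0))
  have hfac : 0 < a ^ 2 * x * (x - 1) ^ 2 / (4 * (1 + a) ^ 2 * (x + a) ^ 3) := by
    have : 0 < x - 1 := by linarith
    positivity
  have hms : m * (x * veld a x + imp a x * zet a)
      = a ^ 2 * x * (x - 1) ^ 2 / (4 * (1 + a) ^ 2 * (x + a) ^ 3) *
        ((1 - 3 * a) * x - 4 * a ^ 2) := by
    rw [div_mul_eq_mul_div, ← hsq, hm]; ring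
  have c1 : 0 < m → η < 1 := by
    intro h
    obtain ⟨y, hy0, hy1, hy⟩ := exists_neg_left_of_deriv_pos hd1 f1 h
    exact lt_trans (((hs y hy0 hy1.ne).1).1 (mul_pos_of_neg_of_neg hy (by linarith))) hy1
  have c2 : m < 0 → 1 < η := by
    intro h
    obtain ⟨y, hy1, hy⟩ := exists_neg_right_of_deriv_neg hd1 f1 h
    exact lt_trans hy1 (((hs y (by linarith) hy1.ne').2).1
      (mul_neg_of_neg_of_pos hy (by linarith)))
  have c3 : m = 0 → η = 1 := by
    intro h
    have e1 : x * veld a (x * 1) - imp a x * veld a 1 = m := by rw [mul_one, veld_one]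
    refine le_antisymm (le_of_forall_gt fun y hy => ?_) (le_of_forall_lt fun y hy => ?_)
    · have hy0 : 0 < y := by linarith
      have : fwd a x 1 < fwd a x y := lt_of_hasDerivAt_pos_off 0 hy
        (fun t ht => hd t (by linarith [ht.1]))
        fun t ht _ => up 1 t one_pos ht.1 (by rw [e1, h])
      exact ((hs y hy0 hy.ne').1).1 (mul_pos (by linarith) (by linarith))
    · rcases le_or_gt y 0 with h' | hy0
      · linarith
      · have : fwd a x 1 < fwd a x y := lt_of_hasDerivAt_neg_off 0 hy
          (fun t ht => hd t (hy0.trans_le ht.1)) fun t ht _ => by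
            by_contra! hcon
            have := up t 1 (hy0.trans ht.1) ht.2 hcon
            linarith
        exact ((hs y hy0 hy.ne).2).1 (mul_neg_of_pos_of_neg (by linarith) (by linarith))
  have d1 : 4 * a ^ 2 < (1 - 3 * a) * x → 0 < m := by
    intro h
    have : 0 < m * (x * veld a x + imp a x * zet a) := by
      rw [hms]; exact mul_pos hfac (by linarith)
    exact (mul_pos_iff_of_pos_right hsum).1 this
  have d2 : (1 - 3 * a) * x < 4 * a ^ 2 → m < 0 := by
    intro h
    have : m * (x * veld a x + imp a x * zet a) < 0 := by
      rw [hms]; exact mul_neg_of_pos_of_neg hfac (by linarith)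
    exact (neg_iff_pos_of_mul_neg this).2 hsum
  have d3 : 4 * a ^ 2 = (1 - 3 * a) * x → m = 0 := by
    intro h
    have : m * (x * veld a x + imp a x * zet a) = 0 := by
      rw [hms, ← h, sub_self, mul_zero]
    exact (mul_eq_zero.1 this).resolve_right hsum.ne'
  rcases lt_trichotomy (4 * a ^ 2) ((1 - 3 * a) * x) with h | h | h
  · have := c1 (d1 h)
    exact ⟨⟨fun _ => h, fun _ => this⟩, ⟨fun e => absurd e this.ne, fun e => absurd e h.ne⟩⟩
  · have := c3 (d3 h)
    exact ⟨⟨fun e => absurd e (by simp [this]), fun e => absurd e (by simp [h])⟩,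
      ⟨fun _ => h, fun _ => this⟩⟩
  · have := c2 (d2 h)
    exact ⟨⟨fun e => absurd e this.not_gt, fun e => absurd e h.not_gt⟩,
      ⟨fun e => absurd e this.ne', fun e => absurd e h.ne'⟩⟩

/-- Over an incoming left rarefaction with `γ ≤ 5/3` the outgoing forward wave is a shock. -/
lemma fwd_neg_of_lt (h0 : 0 < a) (h1 : a < 1) (ha : a ≤ 1 / 4) {x y : ℝ} (hx0 : 0 < x)
    (hx : x < 1) (hy : 1 < y) : fwd a x y < 0 := by
  have : fwd a x y < fwd a x 1 := by
    refine lt_of_hasDerivAt_neg_off 0 hy (fun t ht => hasDerivAt_fwd h0 hx0 (by linarith [ht.1]))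
      fun t ht _ => ?_
    have ht0 : 0 < t := by linarith [ht.1]
    by_contra! hcon
    rw [fwd_deriv_nonneg_iff h0 hx0 ht0, logExc_of_le hx0 hx.le, lh_of_ge h0 ht.1.le] at hcon
    have hK : 2 * a * (1 + 2 * a) ≤ 1 - a := by nlinarith
    have hxt : x * t < t := by nlinarith [ht.1]
    rcases le_or_gt (x * t) 1 with h | h
    · rw [lh_of_le h] at hcon
      have := ls_strictMono_of h0 h1 le_rfl ht.1 (by linarith)
      rw [ls_one h0] at this
      linarith
    · rw [lh_of_ge h0 h.le] at hcon
      have := ls_strictMono_of h0 h1 h.le hxt (by nlinarith)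
      linarith
  rwa [fwd_one_right] at this

/-- The third branch of the forward locus over an incoming left rarefaction. -/
lemma exists_fwd_root_of_lt (h0 : 0 < a) (h1 : a < 1) (ha : 1 / 4 < a) {x : ℝ} (hx0 : 0 < x)
    (hx : x < 1) :
    ∃ η, 1 < η ∧ ∀ y, 1 < y → (fwd a x y < 0 ↔ η < y) ∧ (0 < fwd a x y ↔ y < η) := by
  have l1 := ls_one h0
  have hK1 : 1 - a < 2 * a * (1 + 2 * a) := by nlinarith
  have hd : ∀ y, 0 < y → HasDerivAt (fun y => -fwd a x y)
      (-(x * veld a (x * y) - imp a x * veld a y)) y :=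
    fun y hy => (hasDerivAt_fwd h0 hx0 hy).neg
  have hdec : ∀ y, 1 < y → (1 - a) * y ≤ 2 * a * (1 + 2 * a) → ls a y < lh a (x * y) := by
    intro y hy h
    have hlt : ∀ p, 1 ≤ p → p < y → ls a y < ls a p := fun p hp hpy =>
      ls_gt h0 (by linarith) hpy fun t ht _ =>
        mul_neg_of_pos_of_neg (by linarith [ht.1]) (by nlinarith [ht.2])
    rcases le_or_gt (x * y) 1 with h' | h'
    · rw [lh_of_le h', ← l1]; exact hlt 1 le_rfl hy
    · rw [lh_of_ge h0 h'.le]; exact hlt _ h'.le (by nlinarith)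
  have sgn : ∀ y, 1 < y → (0 ≤ -(x * veld a (x * y) - imp a x * veld a y) ↔
      lh a (x * y) ≤ ls a y) := by
    intro y hy
    rw [← not_iff_not, not_le, not_le, neg_lt_zero, fwd_deriv_pos_iff h0 hx0 (by linarith),
      logExc_of_le hx0 hx.le, sub_pos, lh_of_ge h0 hy.le]
  have sgn' : ∀ y, 1 < y → (0 < -(x * veld a (x * y) - imp a x * veld a y) ↔
      lh a (x * y) < ls a y) := by
    intro y hy
    rw [← not_iff_not, not_lt, not_lt, neg_nonpos, fwd_deriv_nonneg_iff h0 hx0 (by linarith),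
      logExc_of_le hx0 hx.le, sub_nonneg, lh_of_ge h0 hy.le]
  have up : ∀ p q, 1 < p → p < q → 0 ≤ -(x * veld a (x * p) - imp a x * veld a p) →
      0 < -(x * veld a (x * q) - imp a x * veld a q) := by
    intro p q hp hpq h
    rw [sgn p hp] at h
    rw [sgn' q (hp.trans hpq)]
    have hKp : 2 * a * (1 + 2 * a) < (1 - a) * p := by
      by_contra! hcon
      linarith [hdec p hp hcon]
    have hlt := ls_strictMono_of h0 h1 hp.le hpq hKp.le
    rcases le_or_gt (2 * a * (1 + 2 * a)) ((1 - a) * (x * q)) with h2 | h2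
    · have h3 : 1 < x * q := by nlinarith
      rw [lh_of_ge h0 h3.le]
      exact ls_strictMono_of h0 h1 h3.le (by nlinarith) h2
    · have hxpq : x * p < x * q := by gcongr
      have hle : ∀ r, 1 ≤ r → r < x * q → ls a (x * q) < ls a r := fun r hr hrq =>
        ls_gt h0 (by linarith) hrq fun t ht _ =>
          mul_neg_of_pos_of_neg (by linarith [ht.1]) (by nlinarith [ht.2])
      have : lh a (x * q) ≤ lh a (x * p) := by
        rcases le_or_gt (x * q) 1 with h3 | h3
        · rw [lh_of_le h3, lh_of_le (hxpq.le.trans h3)]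
        · rw [lh_of_ge h0 h3.le]
          rcases le_or_gt (x * p) 1 with h4 | h4
          · rw [lh_of_le h4, ← l1]; exact (hle 1 le_rfl h3).le
          · rw [lh_of_ge h0 h4.le]; exact (hle _ h4.le hxpq).le
      linarith
  have f1 : fwd a x 1 = 0 := fwd_one_right x
  have hm : ∃ m, 1 < m ∧ -fwd a x m < 0 := by
    set q := 2 * a * (1 + 2 * a) / (1 - a) with hq
    have hq1 : 1 < q := by
      rw [hq, one_lt_div (by linarith)]; nlinarith
    have hqK : (1 - a) * q = 2 * a * (1 + 2 * a) := mul_div_cancel₀ _ (by linarith)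
    refine ⟨q, hq1, ?_⟩
    have : -fwd a x q < -fwd a x 1 := lt_of_hasDerivAt_neg_off
      (f := fun y => -fwd a x y) 0 hq1
      (fun y hy => hd y (by linarith [hy.1])) fun y hy _ => by
        by_contra! hcon
        rw [sgn y hy.1] at hcon
        linarith [hdec y hy.1 (by nlinarith [hy.2])]
    rwa [f1, neg_zero] at this
  have hM : ∃ M, 1 < M ∧ 0 < -fwd a x M := by
    have hc : 0 < a / √(1 + a) := div_pos h0 (Real.sqrt_pos.2 (by linarith))
    have hlt : √x < imp a x := by
      rw [imp_of_le hx0 hx.le, Real.sqrt_eq_rpow]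
      exact Real.rpow_lt_rpow_of_exponent_gt hx0 hx (zet_lt_half h0 h1)
    have hlim : a / √(1 + a) * (√x - imp a x) < 0 := mul_neg_of_pos_of_neg hc (by linarith)
    obtain ⟨M, hM, hM'⟩ := (((tendsto_fwd_div_sqrt h0 hx0).eventually (gt_mem_nhds hlim)).and
      (eventually_gt_atTop 1)).exists
    have hs := Real.sqrt_pos.2 (show 0 < M by linarith)
    refine ⟨M, hM', neg_pos.2 ?_⟩
    by_contra! hcon
    exact absurd hM (not_lt.2 (div_nonneg hcon hs.le))
  obtain ⟨η, hη, h⟩ := exists_zero_of_valley_right (f := fun y => -fwd a x y)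
    (fun y hy => (hd y (one_pos.trans_le hy)).continuousAt.continuousWithinAt)
    (fun p q r hp hpq hqr h => valley_of_deriv 1 0 hd (fun p q hp hpq _ _ => up p q hp hpq)
      (by linarith) hp hpq hqr h) (by simp [f1]) hm hM
  refine ⟨η, hη, fun y hy => ?_⟩
  have := h y hy
  simpa using this

/-- The `x`-derivative of `fwd` on the line `x = 1`, for `y ≥ 1`. -/
def edge (a y : ℝ) : ℝ := y * svd a y - zet a - zet a * sv a y

/-- The substitution `y = (1 + a) T ^ 2 - a` rationalises `edge`. -/
lemma edge_eq (h0 : 0 < a) {T : ℝ} (hT : 0 < T) :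
    edge a ((1 + a) * T ^ 2 - a) = a * (T - 1) ^ 2 * ((1 - a) * T ^ 2 - 2 * a * T - a) /
      (2 * (1 + a) * T ^ 3) := by
  have e : √((1 + a) * ((1 + a) * T ^ 2 - a + a)) = (1 + a) * T := by
    rw [show (1 + a) * ((1 + a) * T ^ 2 - a + a) = ((1 + a) * T) ^ 2 by ring,
      Real.sqrt_sq (by positivity)]
  rw [edge, svd, sv, e, zet]
  rw [show (1 + a) * T ^ 2 - a + a = (1 + a) * T ^ 2 by ring]
  field_simp
  ring

lemma exists_edge_root (h0 : 0 < a) (h1 : a < 1) (ha : 1 / 4 ≤ a) :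
    ∃ η, ((a = 1 / 4 ∧ η = 1) ∨ 1 / 4 < a ∧ 1 < η) ∧
      ∀ y, 1 < y → (0 < edge a y ↔ η < y) ∧ (edge a y < 0 ↔ y < η) := by
  have hr2 : √a ^ 2 = a := Real.sq_sqrt h0.le
  have hr0 : 0 < √a := Real.sqrt_pos.2 h0
  set r := √a
  have hr1 : r < 1 := by nlinarith
  have hrh : 1 / 2 ≤ r := by nlinarith
  set T₀ := r / (1 - r) with hT₀
  have h1r : 0 < 1 - r := by linarith
  have hT1 : 1 ≤ T₀ := by rw [hT₀, one_le_div h1r]; linarith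
  refine ⟨(1 + a) * T₀ ^ 2 - a, ?_, fun y hy => ?_⟩
  · rcases hT1.eq_or_lt with h | h
    · refine Or.inl ⟨?_, by rw [← h]; ring⟩
      have : r = 1 / 2 := by rw [hT₀, eq_div_iff h1r.ne'] at h; linarith
      rw [← hr2, this]; norm_num
    · have : 1 < T₀ ^ 2 := one_lt_pow₀ h two_ne_zero
      have hr3 : 1 / 2 < r := by rw [hT₀, lt_div_iff₀ h1r] at h; linarith
      exact Or.inr ⟨by nlinarith, by nlinarith⟩
  · set T := √((y + a) / (1 + a)) with hT
    have hT2 : T ^ 2 = (y + a) / (1 + a) := Real.sq_sqrt (by positivity)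
    have hyT : y = (1 + a) * T ^ 2 - a := by rw [hT2]; field_simp; ring
    have hTpos : 1 < T := by
      rw [hT, Real.lt_sqrt (by norm_num), lt_div_iff₀ (by linarith)]; linarith
    have hfac : (1 - a) * T ^ 2 - 2 * a * T - a = (T - T₀) * ((1 - a) * T + r * (1 - r)) := by
      have : (1 - a) * T₀ = r * (1 + r) := by
        rw [hT₀, ← hr2]; field_simp; ring
      have h2 : T₀ * (1 - r) = r := div_mul_cancel₀ _ h1r.ne'
      have h3 : (T - T₀) * ((1 - a) * T + r * (1 - r))
        = (1 - a) * T ^ 2 + r * (1 - r) * T - ((1 - a) * T₀) * T - (T₀ * (1 - r)) * r := by ring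
      rw [h3, this, h2, ← hr2]; ring
    have e : edge a y = (T - T₀) * (a * (T - 1) ^ 2 * ((1 - a) * T + r * (1 - r)) /
        (2 * (1 + a) * T ^ 3)) := by
      rw [hyT, edge_eq h0 (by linarith), hfac]; ring
    have hp : 0 < a * (T - 1) ^ 2 * ((1 - a) * T + r * (1 - r)) / (2 * (1 + a) * T ^ 3) := by
      have : 0 < T - 1 := by linarith
      have : 0 < 1 - a := by linarith
      positivity
    have hTT : T₀ < T ↔ (1 + a) * T₀ ^ 2 - a < y := by
      rw [hyT, sub_lt_sub_iff_right, mul_lt_mul_iff_right₀ (by linarith),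
        sq_lt_sq₀ (by linarith) (by linarith)]
    have hTT' : T < T₀ ↔ y < (1 + a) * T₀ ^ 2 - a := by
      rw [hyT, sub_lt_sub_iff_right, mul_lt_mul_iff_right₀ (by linarith),
        sq_lt_sq₀ (by linarith) (by linarith)]
    rw [e, mul_pos_iff_of_pos_right hp, sub_pos, hTT]
    refine ⟨Iff.rfl, ?_⟩
    rw [← hTT', ← sub_neg (a := T)]
    exact ⟨fun h => (neg_iff_pos_of_mul_neg h).2 hp, fun h => mul_neg_of_neg_of_pos h hp⟩

end Forward

/-! ### The third branch of the forward locus as a function -/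

section Branch

variable {a : ℝ}

/-- The domain of the third branch, in terms of `a`. -/
def FDom (a x : ℝ) : Prop := 1 < x ∨ (x = 1 ∧ 1 / 4 ≤ a) ∨ (0 < x ∧ x < 1 ∧ 1 / 4 < a)

/-- The difference quotient `fwd / (x - 1)`, extended to `x = 1` by its limit (for `y > 1`). -/
def fwdQuot (a x y : ℝ) : ℝ := if x = 1 then edge a y else fwd a x y / (x - 1)

/-- `h` is the third branch of the forward locus: over each `x` of its domain, the sign of
`fwdQuot` changes, besides at `y = 1`, exactly at `y = h x`; over `x ≤ 1` the branch lies above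
`y = 1`, except that it starts at `(1, 1)` when `a = 1 / 4`. -/
def IsForwardBranch (a : ℝ) (h : ℝ → ℝ) : Prop :=
  ∀ x, FDom a x → 0 < h x ∧ (x ≤ 1 → (a = 1 / 4 ∧ h x = 1) ∨ 1 / 4 < a ∧ 1 < h x) ∧
    ∀ y, 0 < y → y ≠ 1 → (1 < x ∨ 1 < y) →
      (0 < fwdQuot a x y * (y - 1) ↔ h x < y) ∧ (fwdQuot a x y * (y - 1) < 0 ↔ y < h x)

lemma FDom.pos {x : ℝ} (h : FDom a x) : 0 < x := by
  rcases h with h | ⟨h, _⟩ | ⟨h, _, _⟩ <;> linarith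

lemma fwdQuot_sign_gt {x y : ℝ} (hx : 1 < x) :
    (0 < fwdQuot a x y * (y - 1) ↔ 0 < fwd a x y * (y - 1)) ∧
      (fwdQuot a x y * (y - 1) < 0 ↔ fwd a x y * (y - 1) < 0) := by
  have h : 0 < x - 1 := by linarith
  rw [fwdQuot, if_neg hx.ne', div_mul_eq_mul_div]
  refine ⟨div_pos_iff_of_pos_right h, ?_⟩
  rw [div_lt_iff₀ h, zero_mul]

lemma fwdQuot_sign_lt {x y : ℝ} (hx : x < 1) (hy : 1 < y) :
    (0 < fwdQuot a x y * (y - 1) ↔ fwd a x y < 0) ∧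
      (fwdQuot a x y * (y - 1) < 0 ↔ 0 < fwd a x y) := by
  have h : 0 < 1 - x := by linarith
  have h2 : 0 < y - 1 := by linarith
  have e : fwdQuot a x y = -fwd a x y / (1 - x) := by
    rw [fwdQuot, if_neg hx.ne, ← neg_sub 1 x, div_neg, neg_div]
  rw [mul_pos_iff_of_pos_right h2, e, div_pos_iff_of_pos_right h, neg_pos]
  refine ⟨Iff.rfl, ?_⟩
  rw [← neg_pos, ← neg_mul, ← neg_div, neg_neg, mul_pos_iff_of_pos_right h2,
    div_pos_iff_of_pos_right h]

/-- The third branch: on one side of its graph `fwd / ((x - 1) (y - 1))` is negative, on the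
other side positive. -/
lemma exists_forward_branch (h0 : 0 < a) (h1 : a < 1) :
    ∃ h : ℝ → ℝ, IsForwardBranch a h ∧
      ∀ x, 1 < x → (h x < 1 ↔ 4 * a ^ 2 < (1 - 3 * a) * x) ∧
        (h x = 1 ↔ 4 * a ^ 2 = (1 - 3 * a) * x) := by
  have ex : ∀ x : ℝ, ∃ η : ℝ, (FDom a x → 0 < η ∧
      (x ≤ 1 → (a = 1 / 4 ∧ η = 1) ∨ 1 / 4 < a ∧ 1 < η) ∧
      ∀ y, 0 < y → y ≠ 1 → (1 < x ∨ 1 < y) →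
        (0 < fwdQuot a x y * (y - 1) ↔ η < y) ∧ (fwdQuot a x y * (y - 1) < 0 ↔ y < η)) ∧
      (1 < x → (η < 1 ↔ 4 * a ^ 2 < (1 - 3 * a) * x) ∧
        (η = 1 ↔ 4 * a ^ 2 = (1 - 3 * a) * x)) := by
    intro x
    rcases lt_trichotomy x 1 with hx | hx | hx
    · by_cases hd : 0 < x ∧ 1 / 4 < a
      · obtain ⟨η, hη, h⟩ := exists_fwd_root_of_lt h0 h1 hd.2 hd.1 hx
        refine ⟨η, fun _ => ⟨by linarith, fun _ => Or.inr ⟨hd.2, hη⟩, fun y _ _ hor => ?_⟩,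
          fun h => absurd h hx.not_gt⟩
        have hy := hor.resolve_left hx.not_gt
        rw [(fwdQuot_sign_lt hx hy).1, (fwdQuot_sign_lt hx hy).2]
        exact h y hy
      · refine ⟨0, fun h => ?_, fun h => absurd h hx.not_gt⟩
        rcases h with h | ⟨h, _⟩ | ⟨h, _, h'⟩
        · exact absurd h hx.not_gt
        · exact absurd h hx.ne
        · exact absurd ⟨h, h'⟩ hd
    · by_cases ha : 1 / 4 ≤ a
      · obtain ⟨η, hη, h⟩ := exists_edge_root h0 h1 ha
        refine ⟨η, fun _ => ⟨by rcases hη with ⟨_, hη⟩ | ⟨_, hη⟩ <;> linarith, fun _ => hη,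
          fun y _ _ hor => ?_⟩,
          fun h => absurd hx h.ne'⟩
        have hy := hor.resolve_left (by rw [hx]; exact lt_irrefl _)
        have hy' : 0 < y - 1 := by linarith
        rw [fwdQuot, if_pos hx, mul_pos_iff_of_pos_right hy', ← (h y hy).2]
        refine ⟨(h y hy).1, ?_⟩
        rw [← neg_pos, ← neg_mul, mul_pos_iff_of_pos_right hy', neg_pos]
      · refine ⟨0, fun h => ?_, fun h => absurd hx h.ne'⟩
        rcases h with h | ⟨_, h⟩ | ⟨_, h, _⟩
        · exact absurd hx h.ne'
        · exact absurd h ha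
        · exact absurd hx h.ne
    · obtain ⟨η, hη, h, h'⟩ := exists_fwd_root_of_gt h0 h1 hx
      refine ⟨η, fun _ => ⟨hη, fun hx' => absurd hx hx'.not_gt, fun y hy hy1 _ => ?_⟩,
        fun _ => h'⟩
      rw [(fwdQuot_sign_gt hx).1, (fwdQuot_sign_gt hx).2]
      exact h y hy hy1
  choose h hh using ex
  exact ⟨h, fun x => (hh x).1, fun x => (hh x).2⟩

lemma continuousAt_fwdQuot (h0 : 0 < a) {x y : ℝ} (hx : 0 < x) (hy : 0 < y)
    (h : x ≠ 1 ∨ 1 < y) : ContinuousAt (fun x => fwdQuot a x y) x := by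
  have hd : ∀ x, 0 < x → HasDerivAt (fun x => fwd a x y)
      (y * veld a (x * y) - veld a x - impSqd a x / (2 * imp a x) * vel a y) x := by
    intro x hx
    have h1 : HasDerivAt (fun x => vel a (x * y)) (veld a (x * y) * (1 * y)) x :=
      HasDerivAt.comp (h₂ := vel a) x (hasDerivAt_vel h0 (by positivity))
        ((hasDerivAt_id x).mul_const y)
    refine ((h1.sub (hasDerivAt_vel h0 hx)).sub
      ((hasDerivAt_imp h0 hx).mul_const _)).congr_deriv ?_
    ring
  by_cases hx1 : x = 1
  · have hy1 := h.resolve_left (not_not.2 hx1)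
    subst hx1
    have h2 := (hd 1 one_pos).tendsto_slope
    have e : y * veld a (1 * y) - veld a 1 - impSqd a 1 / (2 * imp a 1) * vel a y = edge a y := by
      rw [one_mul, veld, if_neg (not_le.2 hy1), vel_of_gt hy1, veld_one, imp_one, edge, impSqd,
        if_pos le_rfl, Real.one_rpow]
      ring
    rw [e] at h2
    have h3 : fwdQuot a 1 y = edge a y := if_pos rfl
    rw [← continuousWithinAt_compl_self, ContinuousWithinAt, h3]
    refine h2.congr' ?_
    filter_upwards [self_mem_nhdsWithin] with t ht
    rw [slope_def_field, fwd_one_left, sub_zero, fwdQuot,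
      if_neg (show ¬t = 1 from ht)]
  · have h2 : ContinuousAt (fun x => fwd a x y / (x - 1)) x :=
      (hd x hx).continuousAt.div (by fun_prop) (sub_ne_zero.2 hx1)
    refine h2.congr ?_
    filter_upwards [isOpen_ne.mem_nhds hx1] with t ht
    rw [fwdQuot, if_neg ht]

lemma exists_between_ne_one {u v : ℝ} (h : u < v) : ∃ y, u < y ∧ y < v ∧ y ≠ 1 := by
  obtain ⟨m, hm, hm'⟩ := exists_between h
  by_cases e : m = 1
  · obtain ⟨n, hn, hn'⟩ := exists_between hm
    exact ⟨n, hn, hn'.trans hm', by rw [← e]; exact hn'.ne⟩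
  · exact ⟨m, hm, hm', e⟩

/-- For `γ = 5/3` the third branch emanates from `(1, 1)`: a weak left shock overtaken by a given
rarefaction transmits a forward rarefaction. The sign comes from the entropy `logExc a x`,
of third order in `x - 1`; all other terms are of fourth order because `edge a` has a triple zero at
`1` when `a = 1 / 4`. -/
lemma fwd_pos_near_one (ha : a = 1 / 4) {y : ℝ} (hy0 : 0 < y) (hy1 : y < 1) :
    ∀ᶠ x in 𝓝[>] (1 : ℝ), 0 < fwd a x y := by
  have h0 : 0 < a := by linarith
  have hz := zet_pos h0
  set ε := 1 - y ^ zet a with hε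
  have hε0 : 0 < ε := by linarith [Real.rpow_lt_one hy0.le hy1 hz]
  -- `D` bounds `x ^ (-ζ) * fwd a x y` from below
  set D := fun x => ε * logExc a x + 1 - (1 + vel a x) * x ^ (-zet a) with hD
  set T := fun x : ℝ => √((x + a) / (1 + a)) with hT
  set Br := fun x : ℝ => ε * (a * (1 - a) * (1 + a) * (T x + 1) ^ 2 /
      (2 * (x * (1 + a * x) * (x + a)))) - x ^ (-zet a - 1) *
      (a * ((1 - a) * T x ^ 2 - 2 * a * T x - a) / (2 * (1 + a) * T x ^ 3)) with hBr
  have hT1 : T 1 = 1 := by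
    simp only [hT]; rw [div_self (by linarith), Real.sqrt_one]
  have hBr1 : 0 < Br 1 := by
    have e : (1 - a) * (1 : ℝ) ^ 2 - 2 * a * 1 - a = 0 := by rw [ha]; norm_num
    simp only [hBr, hT1, e, mul_zero, zero_div, sub_zero]
    have : 0 < 1 - a := by linarith
    positivity
  have hTc : Continuous T := by fun_prop
  have hBrc : ContinuousAt Br 1 := by
    refine ContinuousAt.sub (ContinuousAt.mul continuousAt_const (ContinuousAt.div ?_ ?_ ?_))
      (ContinuousAt.mul ?_ (ContinuousAt.div ?_ ?_ ?_))
    · fun_prop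
    · fun_prop
    · positivity
    · exact Real.continuousAt_rpow_const 1 _ (Or.inl one_ne_zero)
    · fun_prop
    · fun_prop
    · rw [hT1]; positivity
  have hderiv : ∀ x, 1 < x → HasDerivAt D ((T x - 1) ^ 2 * Br x) x := by
    intro x hx
    have hx0 : 0 < x := by linarith
    have hTp : 0 < T x := Real.sqrt_pos.2 (by positivity)
    have hT2 : T x ^ 2 = (x + a) / (1 + a) := Real.sq_sqrt (by positivity)
    have hxT : x = (1 + a) * T x ^ 2 - a := by rw [hT2]; field_simp; ring
    have h2 : HasDerivAt (fun x : ℝ => x ^ (-zet a)) (-zet a * x ^ (-zet a - 1)) x :=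
      Real.hasDerivAt_rpow_const (Or.inl hx0.ne')
    refine ((((hasDerivAt_logExc h0 hx).const_mul ε).add_const 1).sub
      (((hasDerivAt_vel h0 hx0).const_add 1).mul h2)).congr_deriv ?_
    have e1 : veld a x * x ^ (-zet a) + (1 + vel a x) * (-zet a * x ^ (-zet a - 1))
        = x ^ (-zet a - 1) * edge a x := by
      rw [edge, veld, if_neg (not_le.2 hx), vel_of_gt hx, Real.rpow_sub_one hx0.ne']
      field_simp
      ring
    have e2 : edge a x = a * (T x - 1) ^ 2 * ((1 - a) * T x ^ 2 - 2 * a * T x - a) /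
        (2 * (1 + a) * T x ^ 3) := by
      rw [← edge_eq h0 hTp, ← hxT]
    have e3 : (x - 1) ^ 2 = (1 + a) ^ 2 * (T x - 1) ^ 2 * (T x + 1) ^ 2 := by
      have : x - 1 = (1 + a) * ((T x - 1) * (T x + 1)) := by
        rw [show (T x - 1) * (T x + 1) = T x ^ 2 - 1 by ring, hT2]; field_simp; ring
      rw [this]; ring
    rw [e1, e2, e3]
    simp only [hBr]
    field_simp
  have hnear : ∀ᶠ x in 𝓝 (1 : ℝ), 0 < Br x := hBrc.eventually (lt_mem_nhds hBr1)
  obtain ⟨l, u, ⟨hl, hu⟩, hlu⟩ := mem_nhds_iff_exists_Ioo_subset.1 hnear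
  filter_upwards [Ioo_mem_nhdsGT hu, Ioo_mem_nhdsGT (show 1 < 1 / y by
    rw [lt_div_iff₀ hy0]; linarith)] with x hx hx'
  have hx0 : 0 < x := by linarith [hx.1]
  have hD1 : D 1 = 0 := by
    simp only [hD, logExc_of_le one_pos le_rfl, vel_one, Real.one_rpow]; ring
  have hDx : D 1 < D x := by
    refine lt_of_hasDerivAt_pos hx.1 ?_ (fun t ht => hderiv t ht.1) fun t ht => ?_
    · intro t ht
      have ht0 : 0 < t := by linarith [ht.1]
      refine ContinuousAt.continuousWithinAt (ContinuousAt.sub (ContinuousAt.add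
        (ContinuousAt.mul continuousAt_const (ContinuousAt.sub (ContinuousAt.log ?_ ?_) ?_))
        continuousAt_const) (ContinuousAt.mul (ContinuousAt.add continuousAt_const ?_) ?_))
      · exact (hasDerivAt_imp h0 ht0).continuousAt
      · exact (imp_pos h0 ht0).ne'
      · exact (Real.continuousAt_log ht0.ne').const_mul _
      · exact (hasDerivAt_vel h0 ht0).continuousAt
      · exact Real.continuousAt_rpow_const t _ (Or.inl ht0.ne')
    · have : 1 < T t := by
        simp only [hT]
        rw [Real.lt_sqrt (by norm_num), lt_div_iff₀ (by linarith)]; linarith [ht.1]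
      have h3 : 0 < T t - 1 := by linarith
      have := hlu ⟨by linarith [ht.1], ht.2.trans hx.2⟩
      exact mul_pos (by positivity) this
  have hxy : x * y ≤ 1 := by
    have := hx'.2
    rw [lt_div_iff₀ hy0] at this
    linarith
  have hxz : 0 < x ^ zet a := Real.rpow_pos_of_pos hx0 _
  have e : fwd a x y = x ^ zet a *
      (ε * (Real.exp (logExc a x) - 1) + 1 - (1 + vel a x) * x ^ (-zet a)) := by
    have h2 : x ^ zet a * x ^ (-zet a) = 1 := by
      rw [Real.rpow_neg hx0.le]; exact mul_inv_cancel₀ hxz.ne'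
    have h3 : x ^ zet a * (ε * (Real.exp (logExc a x) - 1) + 1 - (1 + vel a x) * x ^ (-zet a))
        = x ^ zet a * (ε * (Real.exp (logExc a x) - 1) + 1)
          - (1 + vel a x) * (x ^ zet a * x ^ (-zet a)) := by ring
    rw [h3, h2, fwd, vel_of_le hxy, vel_of_le hy1.le, imp_eq_exp h0 hx0,
      Real.mul_rpow hx0.le hy0.le, hε]
    ring
  rw [e]
  refine mul_pos hxz ?_
  have h4 := Real.add_one_le_exp (logExc a x)
  have h5 : ε * logExc a x ≤ ε * (Real.exp (logExc a x) - 1) :=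
    mul_le_mul_of_nonneg_left (by linarith) hε0.le
  have h6 : 0 < D x := by linarith
  simp only [hD] at h6
  linarith

lemma continuousOn_branch (h0 : 0 < a) {h : ℝ → ℝ} (hh : IsForwardBranch a h) :
    ContinuousOn h {x | FDom a x} := by
  intro x hx
  obtain ⟨hpos, hle, hs⟩ := hh x hx
  have hx0 : 0 < x := FDom.pos hx
  have hc : ∀ y, 0 < y → (1 < x ∨ 1 < y) →
      ContinuousAt (fun x => fwdQuot a x y * (y - 1)) x := fun y hy hor =>
    (continuousAt_fwdQuot h0 hx0 hy (hor.imp (fun h => h.ne') id)).mul continuousAt_const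
  have hev : ∀ y : ℝ, (1 < x ∨ 1 < y) → ∀ᶠ t in 𝓝[{x | FDom a x}] x,
      FDom a t ∧ (1 < t ∨ 1 < y) := by
    intro y hor
    refine (eventually_mem_nhdsWithin (s := {x | FDom a x})).and ?_
    rcases hor with h' | h'
    · filter_upwards [nhdsWithin_le_nhds (lt_mem_nhds h')] with t ht
      exact Or.inl ht
    · exact .of_forall fun t => Or.inr h'
  have low : ∀ y, 0 < y → y ≠ 1 → (1 < x ∨ 1 < y) → y < h x →
      ∀ᶠ t in 𝓝[{x | FDom a x}] x, y < h t := by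
    intro y hy hy1 hor hyh
    have h2 := nhdsWithin_le_nhds (s := {x | FDom a x})
      ((hc y hy hor).eventually (gt_mem_nhds (((hs y hy hy1 hor).2).2 hyh)))
    filter_upwards [h2, hev y hor] with t ht ht'
    exact (((hh t ht'.1).2.2 y hy hy1 ht'.2).2).1 ht
  have high : ∀ y, 0 < y → y ≠ 1 → (1 < x ∨ 1 < y) → h x < y →
      ∀ᶠ t in 𝓝[{x | FDom a x}] x, h t < y := by
    intro y hy hy1 hor hyh
    have h2 := nhdsWithin_le_nhds (s := {x | FDom a x})
      ((hc y hy hor).eventually (lt_mem_nhds (((hs y hy hy1 hor).1).2 hyh)))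
    filter_upwards [h2, hev y hor] with t ht ht'
    exact (((hh t ht'.1).2.2 y hy hy1 ht'.2).1).1 ht
  refine tendsto_order.2 ⟨fun b hb => ?_, fun b hb => ?_⟩
  · rcases lt_or_ge 1 x with hx1 | hx1
    · obtain ⟨y, hy, hy', hy1⟩ := exists_between_ne_one (max_lt hb hpos)
      filter_upwards [low y ((le_max_right _ _).trans_lt hy) hy1 (Or.inl hx1) hy'] with t ht
      exact ((le_max_left _ _).trans_lt hy).trans ht
    · rcases hle hx1 with ⟨ha, he⟩ | ⟨-, hlt⟩
      · -- only possible at `x = 1` for `γ = 5/3`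
        have hxe : x = 1 := by
          rcases hx with h' | ⟨h', _⟩ | ⟨_, _, h'⟩
          · exact absurd h' hx1.not_gt
          · exact h'
          · exact absurd ha h'.ne'
        obtain ⟨y, hy, hy'⟩ := exists_between (max_lt hb hpos)
        have hy0 : 0 < y := (le_max_right _ _).trans_lt hy
        rw [he] at hy'
        have h2 := fwd_pos_near_one ha hy0 hy'
        rw [eventually_nhdsWithin_iff] at h2
        rw [eventually_nhdsWithin_iff, hxe]
        filter_upwards [h2] with t ht hd
        refine ((le_max_left _ _).trans_lt hy).trans ?_
        rcases hd with h' | ⟨h', _⟩ | ⟨_, _, h'⟩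
        · refine (((hh t (Or.inl h')).2.2 y hy0 hy'.ne (Or.inl h')).2).1 ?_
          rw [(fwdQuot_sign_gt h').2]
          exact mul_neg_of_pos_of_neg (ht h') (by linarith)
        · rwa [h', ← hxe, he]
        · exact absurd ha h'.ne'
      · obtain ⟨y, hy, hy', hy1⟩ := exists_between_ne_one (max_lt hb hlt)
        have hy1' : 1 < y := (le_max_right _ _).trans_lt hy
        filter_upwards [low y (by linarith) hy1 (Or.inr hy1') hy'] with t ht
        exact ((le_max_left _ _).trans_lt hy).trans ht
  · obtain ⟨y, hy, hy', hy1⟩ := exists_between_ne_one hb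
    have hor : 1 < x ∨ 1 < y := by
      rcases lt_or_ge 1 x with h' | h'
      · exact Or.inl h'
      · refine Or.inr ?_
        rcases hle h' with ⟨_, he⟩ | ⟨_, hlt⟩ <;> linarith
    filter_upwards [high y (hpos.trans hy) hy1 hor hy] with t ht
    exact ht.trans hy'

/-! ### The horizontal asymptote -/

/-- The limit of `fwd a x y / √x` as `x → ∞`. -/
def fwdLim (a y : ℝ) : ℝ := a / √(1 + a) * √y - a / √(1 + a) - √a * vel a y

lemma tendsto_fwd_div_sqrt_left (h0 : 0 < a) {y : ℝ} (hy : 0 < y) :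
    Tendsto (fun x => fwd a x y / √x) atTop (𝓝 (fwdLim a y)) := by
  have t1 : Tendsto (fun x : ℝ => x * y) atTop atTop := tendsto_id.atTop_mul_const hy
  have t2 := ((tendsto_vel_div_sqrt h0).comp t1).mul_const (√y)
  have t4 := (t2.sub (tendsto_vel_div_sqrt h0)).sub ((tendsto_imp_div_sqrt h0).mul_const (vel a y))
  refine t4.congr' ?_
  filter_upwards [eventually_gt_atTop 0] with x hx
  have := Real.sqrt_pos.2 hx
  have := Real.sqrt_pos.2 hy
  simp only [Function.comp_apply, fwd, Real.sqrt_mul hx.le]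
  field_simp

lemma fwdLim_pos_iff (h0 : 0 < a) {y : ℝ} (hy : 1 < y) :
    (0 < fwdLim a y ↔ 2 * a < (1 - a) * √y) ∧ (fwdLim a y < 0 ↔ (1 - a) * √y < 2 * a) := by
  have hy0 : 0 < y := by linarith
  have hs2 : √y ^ 2 = y := Real.sq_sqrt hy0.le
  have hs1 : 1 < √y := by rw [Real.lt_sqrt (by norm_num)]; linarith
  have ha : 0 < √(1 + a) := Real.sqrt_pos.2 (by linarith)
  have hya : 0 < √(y + a) := Real.sqrt_pos.2 (by linarith)
  have hya2 : √(y + a) ^ 2 = y + a := Real.sq_sqrt (by linarith)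
  have ha2 : √a ^ 2 = a := Real.sq_sqrt h0.le
  have hsa : 0 < √a := Real.sqrt_pos.2 h0
  set s := √y
  have hden : 0 < √(y + a) + √a * (s + 1) := by positivity
  have e : fwdLim a y = ((1 - a) * s - 2 * a) * (a / √(1 + a) * (s - 1) * s /
      (√(y + a) * (√(y + a) + √a * (s + 1)))) := by
    have e1 : √(y + a) - √a * (s + 1) = s * ((1 - a) * s - 2 * a) /
        (√(y + a) + √a * (s + 1)) := by
      rw [eq_div_iff hden.ne']
      have : (√(y + a) - √a * (s + 1)) * (√(y + a) + √a * (s + 1))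
        = √(y + a) ^ 2 - √a ^ 2 * (s + 1) ^ 2 := by ring
      rw [this, hya2, ha2, ← hs2]; ring
    have e2 : fwdLim a y = a / √(1 + a) * (s - 1) / √(y + a) * (√(y + a) - √a * (s + 1)) := by
      rw [fwdLim, vel_of_gt hy, sv, Real.sqrt_mul (by linarith)]
      have : y - 1 = (s - 1) * (s + 1) := by rw [← hs2]; ring
      rw [this]
      field_simp
      ring
    rw [e2, e1]
    field_simp
  have hp : 0 < a / √(1 + a) * (s - 1) * s / (√(y + a) * (√(y + a) + √a * (s + 1))) := by
    have : 0 < s - 1 := by linarith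
    positivity
  rw [e, mul_pos_iff_of_pos_right hp, sub_pos]
  refine ⟨Iff.rfl, ?_⟩
  rw [← neg_pos, ← neg_mul, mul_pos_iff_of_pos_right hp, neg_sub, sub_pos]

/-- The limit function `fwdLim` on `y ≤ 1`, up to a positive factor. -/
def rareLim (a y : ℝ) : ℝ := √y - 1 + (1 - y ^ zet a) / √(zet a)

lemma fwdLim_of_le (h0 : 0 < a) {y : ℝ} (hy : y ≤ 1) :
    fwdLim a y = a / √(1 + a) * rareLim a y := by
  have ha2 : √a ^ 2 = a := Real.sq_sqrt h0.le
  have hsa : 0 < √a := Real.sqrt_pos.2 h0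
  have h1a : 0 < √(1 + a) := Real.sqrt_pos.2 (by linarith)
  have e : √a = a / √(1 + a) / √(zet a) := by
    rw [← sqrt_zet h0]
    have : a ≠ 0 := h0.ne'
    field_simp
  rw [fwdLim, rareLim, vel_of_le hy, e]
  ring

lemma hasDerivAt_rareLim (h0 : 0 < a) {y : ℝ} (hy : 0 < y) :
    HasDerivAt (rareLim a) (y ^ (zet a - 1) * (1 / 2 * y ^ (1 / 2 - zet a) - √(zet a))) y := by
  have hz := zet_pos h0
  have hsz : √(zet a) ^ 2 = zet a := Real.sq_sqrt hz.le
  have hsz0 : 0 < √(zet a) := Real.sqrt_pos.2 hz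
  refine (((Real.hasDerivAt_sqrt hy.ne').sub_const 1).add
    (((Real.hasDerivAt_rpow_const (p := zet a) (Or.inl hy.ne')).const_sub 1).div_const
      (√(zet a)))).congr_deriv ?_
  have e : y ^ (zet a - 1) * y ^ (1 / 2 - zet a) = 1 / √y := by
    rw [← Real.rpow_add hy, Real.sqrt_eq_rpow, one_div (y ^ (1 / 2 : ℝ)), ← Real.rpow_neg hy.le]
    congr 1; ring
  have e2 : y ^ (zet a - 1) * (1 / 2 * y ^ (1 / 2 - zet a) - √(zet a))
      = 1 / 2 * (y ^ (zet a - 1) * y ^ (1 / 2 - zet a)) - √(zet a) * y ^ (zet a - 1) := by ring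
  rw [e2, e]
  nth_rewrite 1 [← hsz]
  field_simp
  ring

lemma exists_asymptote (h0 : 0 < a) (h1 : a < 1) :
    ∃ yS, 0 < yS ∧ (1 / 2 * (1 - √(zet a))) ^ (1 / zet a) < yS ∧ (a < 1 / 3 → yS < 1) ∧
      (1 / 3 ≤ a → yS = 4 * a ^ 2 / (1 - a) ^ 2) ∧
      ∀ y, 0 < y → y ≠ 1 → (0 < fwdLim a y * (y - 1) ↔ yS < y) ∧
        (fwdLim a y * (y - 1) < 0 ↔ y < yS) := by
  have hz := zet_pos h0
  have hz2 := zet_lt_half h0 h1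
  have hsz : √(zet a) ^ 2 = zet a := Real.sq_sqrt hz.le
  have hsz0 : 0 < √(zet a) := Real.sqrt_pos.2 hz
  have hsz1 : √(zet a) < 1 := by rw [Real.sqrt_lt' one_pos]; linarith
  have hc : 0 < a / √(1 + a) := div_pos h0 (Real.sqrt_pos.2 (by linarith))
  have r1 : rareLim a 1 = 0 := by simp [rareLim]
  set s := 1 / 2 * (1 - √(zet a)) with hs
  have hs0 : 0 < s := by linarith
  have hs1 : s < 1 := by linarith
  set Y := s ^ (1 / zet a) with hY
  have hY0 : 0 < Y := Real.rpow_pos_of_pos hs0 _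
  have hY1 : Y < 1 := Real.rpow_lt_one hs0.le hs1 (by positivity)
  have hYs : Y ^ zet a = s := by
    rw [hY, ← Real.rpow_mul hs0.le, one_div, inv_mul_cancel₀ hz.ne', Real.rpow_one]
  rcases lt_or_ge a (1 / 3) with ha | ha
  · have hz4 : √(zet a) < 1 / 2 := by
      rw [Real.sqrt_lt' (by norm_num), zet, div_lt_iff₀ (by linarith)]; linarith
    have hd : ∀ y, 0 < y → HasDerivAt (rareLim a) _ y := fun y hy => hasDerivAt_rareLim h0 hy
    have U : ∀ p q r, 0 < p → p < q → q < r → rareLim a p ≤ rareLim a q →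
        rareLim a q < rareLim a r := by
      intro p q r hp hpq hqr h
      refine valley_of_deriv 0 0 hd ?_ hp hp.le hpq hqr h
      intro p q hp hpq _ _ h
      have h2 := nonneg_of_mul_nonneg_right h (Real.rpow_pos_of_pos hp (zet a - 1))
      have h3 := Real.rpow_lt_rpow hp.le hpq (show 0 < 1 / 2 - zet a by linarith)
      exact mul_pos (Real.rpow_pos_of_pos (hp.trans hpq) _) (by linarith)
    have hl : ∃ e, 0 < e ∧ e < 1 ∧ 0 < rareLim a e := by
      refine ⟨Y, hY0, hY1, ?_⟩
      have : (1 - s) / √(zet a) = 1 / 2 + 1 / 2 / √(zet a) := by rw [hs]; field_simp; ring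
      have h2 : 1 / 2 < 1 / 2 / √(zet a) := by rw [lt_div_iff₀ hsz0]; linarith
      rw [rareLim, hYs, this]
      linarith [Real.sqrt_nonneg Y]
    have hr : ∃ M, 1 < M ∧ 0 < rareLim a M := by
      have t := ((tendsto_const_nhds (x := (1 : ℝ))).sub
        ((tendsto_rpow_zet_div_sqrt h0 h1).div_const (√(zet a)))).sub
        ((tendsto_const_nhds (x := (1 : ℝ))).div_atTop Real.tendsto_sqrt_atTop)
      simp only [zero_div, sub_zero] at t
      obtain ⟨M, hM, hM1⟩ := ((t.eventually (lt_mem_nhds one_pos)).and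
        (eventually_gt_atTop 1)).exists
      refine ⟨M, hM1, ?_⟩
      have hq := Real.sqrt_pos.2 (show 0 < M by linarith)
      have e : rareLim a M = (1 - M ^ zet a / √M / √(zet a) - 1 / √M) * √M + 1 / √(zet a) := by
        rw [rareLim]; field_simp; ring
      rw [e]
      positivity
    obtain ⟨η, hη, h⟩ := exists_zero_of_valley
      (fun y hy => (hd y hy).continuousAt.continuousWithinAt) U r1 hl hr
    have hη1 : η < 1 := by
      have hd1 := hd 1 one_pos
      obtain ⟨y, hy0, hy1, hy⟩ := exists_neg_left_of_deriv_pos hd1 r1 (by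
        simp only [Real.one_rpow]; linarith)
      exact (((h y hy0 hy1.ne).1).1 (mul_pos_of_neg_of_neg hy (by linarith))).trans hy1
    refine ⟨η, hη, ?_, fun _ => hη1, fun h => absurd h ha.not_ge, fun y hy hy1 => ?_⟩
    · refine ((h Y hY0 hY1.ne).2).1 (mul_neg_of_pos_of_neg ?_ (by linarith))
      have : (1 - s) / √(zet a) = 1 / 2 + 1 / 2 / √(zet a) := by rw [hs]; field_simp; ring
      have h2 : 1 / 2 < 1 / 2 / √(zet a) := by rw [lt_div_iff₀ hsz0]; linarith
      rw [rareLim, hYs, this]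
      linarith [Real.sqrt_nonneg Y]
    · rcases lt_or_gt_of_ne hy1 with h' | h'
      · rw [fwdLim_of_le h0 h'.le, mul_assoc, mul_pos_iff_of_pos_left hc]
        refine ⟨(h y hy hy1).1, ?_⟩
        rw [← (h y hy hy1).2, ← neg_pos, ← mul_neg, mul_pos_iff_of_pos_left hc, neg_pos]
      · have h2 : 0 < fwdLim a y := by
          rw [(fwdLim_pos_iff h0 h').1]
          have : 1 < √y := by rw [Real.lt_sqrt (by norm_num)]; linarith
          nlinarith
        refine sign_iff_of_imp (fun _ => mul_pos h2 (by linarith)) (fun h => by linarith)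
          (fun h => by linarith)
  · have h1a : 0 < 1 - a := by linarith
    have hT1 : 1 ≤ 2 * a / (1 - a) := by rw [one_le_div h1a]; linarith
    have e : 4 * a ^ 2 / (1 - a) ^ 2 = (2 * a / (1 - a)) ^ 2 := by rw [div_pow]; ring
    have hge : 1 ≤ 4 * a ^ 2 / (1 - a) ^ 2 := by rw [e]; exact one_le_pow₀ hT1
    refine ⟨4 * a ^ 2 / (1 - a) ^ 2, by linarith, by linarith, fun h => absurd h ha.not_gt,
      fun _ => rfl, fun y hy hy1 => ?_⟩
    rcases lt_or_gt_of_ne hy1 with h' | h'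
    · have hz4 : 1 / 2 ≤ √(zet a) := by
        rw [Real.le_sqrt' (by norm_num), zet, le_div_iff₀ (by linarith)]; linarith
      have : rareLim a 1 < rareLim a y := by
        refine lt_of_hasDerivAt_neg_off 0 h'
          (fun t ht => hasDerivAt_rareLim h0 (hy.trans_le ht.1)) fun t ht _ => ?_
        have ht0 := hy.trans ht.1
        refine mul_neg_of_pos_of_neg (Real.rpow_pos_of_pos ht0 _) ?_
        have := Real.rpow_lt_one ht0.le ht.2 (show 0 < 1 / 2 - zet a by linarith)
        linarith
      rw [r1] at this
      have h2 : 0 < fwdLim a y := by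
        rw [fwdLim_of_le h0 h'.le]; exact mul_pos hc this
      exact sign_iff_of_imp (fun h => by linarith)
        (fun _ => mul_neg_of_pos_of_neg h2 (by linarith)) (fun h => by linarith)
    · have hy' : 0 < y - 1 := by linarith
      have hs2 : √y ^ 2 = y := Real.sq_sqrt hy.le
      have hT0 : 0 ≤ 2 * a / (1 - a) := by linarith
      rw [mul_pos_iff_of_pos_right hy', (fwdLim_pos_iff h0 h').1, e, ← Real.lt_sqrt hT0,
        div_lt_iff₀ h1a, mul_comm (√y)]
      refine ⟨Iff.rfl, ?_⟩
      rw [← neg_pos, ← neg_mul, mul_pos_iff_of_pos_right hy', neg_pos, (fwdLim_pos_iff h0 h').2,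
        ← Real.sqrt_lt' (by linarith), lt_div_iff₀ h1a, mul_comm (√y)]

lemma tendsto_branch (h0 : 0 < a) {h : ℝ → ℝ} {yS : ℝ} (hyS : 0 < yS)
    (hs : ∀ y, 0 < y → y ≠ 1 → (0 < fwdLim a y * (y - 1) ↔ yS < y) ∧
        (fwdLim a y * (y - 1) < 0 ↔ y < yS))
    (hh : ∀ x, 1 < x → ∀ y, 0 < y → y ≠ 1 →
      (0 < fwd a x y * (y - 1) ↔ h x < y) ∧ (fwd a x y * (y - 1) < 0 ↔ y < h x)) :
    Tendsto h atTop (𝓝 yS) := by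
  have t : ∀ y, 0 < y → Tendsto (fun x => fwd a x y * (y - 1) / √x) atTop
      (𝓝 (fwdLim a y * (y - 1))) := fun y hy => by
    refine ((tendsto_fwd_div_sqrt_left h0 hy).mul_const (y - 1)).congr fun x => ?_
    rw [div_mul_eq_mul_div]
  refine tendsto_order.2 ⟨fun b hb => ?_, fun b hb => ?_⟩
  · obtain ⟨y, hy, hy', hy1⟩ := exists_between_ne_one (max_lt hb hyS)
    have hy0 : 0 < y := (le_max_right _ _).trans_lt hy
    filter_upwards [(t y hy0).eventually (gt_mem_nhds (((hs y hy0 hy1).2).2 hy')),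
      eventually_gt_atTop 1] with x hx hx1
    rw [div_lt_iff₀ (Real.sqrt_pos.2 (by linarith)), zero_mul] at hx
    exact ((le_max_left _ _).trans_lt hy).trans (((hh x hx1 y hy0 hy1).2).1 hx)
  · obtain ⟨y, hy, hy', hy1⟩ := exists_between_ne_one hb
    have hy0 : 0 < y := hyS.trans hy
    filter_upwards [(t y hy0).eventually (lt_mem_nhds (((hs y hy0 hy1).1).2 hy)),
      eventually_gt_atTop 1] with x hx hx1
    rw [div_pos_iff_of_pos_right (Real.sqrt_pos.2 (by linarith))] at hx
    exact (((hh x hx1 y hy0 hy1).1).1 hx).trans hy'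

end Branch

/-! ### The normalised Riemann problem -/

section Riemann

variable {a : ℝ}

/-- The normalised velocity jump of the outgoing waves, as a function of the reciprocal `G` of
the strength of the forward wave. -/
def outVel (a x y G : ℝ) : ℝ := vel a (x * y * G) + imp a x * imp a y * vel a G

/-- The normalised velocity jump of the incoming waves. -/
def inVel (a x y : ℝ) : ℝ := vel a x + imp a x * vel a y

lemma outVel_strictMono (h0 : 0 < a) {x y : ℝ} (hx : 0 < x) (hy : 0 < y) :
    StrictMonoOn (outVel a x y) (Ioi 0) := by
  intro p (hp : 0 < p) q (hq : 0 < q) hpq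
  have hxy : 0 < x * y := by positivity
  have e1 := strictMonoOn_vel h0 (mem_Ioi.2 (mul_pos hxy hp)) (mem_Ioi.2 (mul_pos hxy hq))
    (mul_lt_mul_of_pos_left hpq hxy)
  have e2 := mul_lt_mul_of_pos_left (strictMonoOn_vel h0 hp hq hpq)
    (mul_pos (imp_pos h0 hx) (imp_pos h0 hy))
  exact add_lt_add e1 e2

lemma lt_outVel (h0 : 0 < a) {x y G : ℝ} (hx : 0 < x) (hy : 0 < y) (hG : 0 < G) :
    -(1 + imp a x * imp a y) < outVel a x y G := by
  have e1 := neg_one_lt_vel h0 (show 0 < x * y * G by positivity)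
  have e2 := mul_lt_mul_of_pos_left (neg_one_lt_vel h0 hG)
    (mul_pos (imp_pos h0 hx) (imp_pos h0 hy))
  unfold outVel
  linarith

lemma exists_outVel_eq (h0 : 0 < a) {x y r : ℝ} (hx : 0 < x) (hy : 0 < y)
    (hr : -(1 + imp a x * imp a y) < r) : ∃ G, 0 < G ∧ outVel a x y G = r := by
  have hxy : 0 < x * y := by positivity
  have t1 : Tendsto (fun G : ℝ => x * y * G) (𝓝[>] 0) (𝓝[>] 0) := by
    refine tendsto_nhdsWithin_iff.2 ⟨?_, ?_⟩
    · have : Tendsto (fun G : ℝ => x * y * G) (𝓝 0) (𝓝 (x * y * 0)) :=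
        (continuous_const.mul continuous_id).tendsto 0
      rw [mul_zero] at this
      exact this.mono_left nhdsWithin_le_nhds
    · filter_upwards [self_mem_nhdsWithin] with G hG
      exact mul_pos hxy hG
  have t2 : Tendsto (outVel a x y) (𝓝[>] 0) (𝓝 (-1 + imp a x * imp a y * -1)) :=
    ((tendsto_vel_zero h0).comp t1).add ((tendsto_vel_zero h0).const_mul _)
  have t3 : Tendsto (fun G : ℝ => x * y * G) atTop atTop := tendsto_id.const_mul_atTop hxy
  have t4 : Tendsto (outVel a x y) atTop atTop :=
    ((tendsto_vel_atTop h0).comp t3).atTop_add_atTop ((tendsto_vel_atTop h0).const_mul_atTop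
      (mul_pos (imp_pos h0 hx) (imp_pos h0 hy)))
  obtain ⟨p, hp, hp0⟩ := ((t2.eventually (gt_mem_nhds (show _ < r by linarith))).and
    self_mem_nhdsWithin).exists
  obtain ⟨q, hq, hq0⟩ := ((t4.eventually_gt_atTop r).and (eventually_gt_atTop p)).exists
  have hc : ContinuousOn (outVel a x y) (Ioi 0) :=
    ((continuousOn_vel h0).comp (by fun_prop) (fun G hG => mul_pos hxy hG)).add
      (continuousOn_const.mul (continuousOn_vel h0))
  obtain ⟨G, hG, hG'⟩ := intermediate_value_Icc hq0.le
    (hc.mono fun t ht => lt_of_lt_of_le (mem_Ioi.1 hp0) ht.1) ⟨hp.le, hq.le⟩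
  exact ⟨G, lt_of_lt_of_le (mem_Ioi.1 hp0) hG.1, hG'⟩

lemma inVel_sub_outVel_inv (h0 : 0 < a) {x y : ℝ} (hx : 0 < x) (hy : 0 < y) :
    inVel a x y - outVel a x y (1 / (x * y)) = imp a x * bwd a x y := by
  have := imp_pos h0 hx
  have e : x * y * (1 / (x * y)) = 1 := by field_simp
  rw [outVel, e, vel_one, inVel, bwd]
  field_simp
  ring

lemma outVel_one_sub (x y : ℝ) : outVel a x y 1 - inVel a x y = fwd a x y := by
  rw [outVel, inVel, fwd, vel_one, mul_one]; ring

end Riemann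

/-! ### The outgoing contact -/

section Contact

variable {a : ℝ}

lemma logExc_lt (h0 : 0 < a) (h1 : a < 1) {p q : ℝ} (hp : 0 < p) (hpq : p < q) (hq : 1 < q) :
    logExc a p < logExc a q := by
  rcases le_or_gt p 1 with h | h
  · rw [logExc_of_le hp h]; exact logExc_pos h0 h1 hq
  · exact logExc_strictMono h0 h1 h.le hpq

lemma logExc_nonneg (h0 : 0 < a) (h1 : a < 1) {q : ℝ} (hq : 0 < q) : 0 ≤ logExc a q := by
  rcases le_or_gt q 1 with h | h
  · rw [logExc_of_le hq h]
  · exact (logExc_pos h0 h1 h).le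

/-- A single shock produces more entropy than two shocks with the same total pressure ratio. -/
lemma logExc_superadditive (h0 : 0 < a) (h1 : a < 1) {p q : ℝ} (hp : 1 < p) (hq : 1 < q) :
    logExc a p + logExc a q < logExc a (p * q) := by
  have hp0 : 0 < p := by linarith
  have hq0 : 0 < q := by linarith
  have hpq : 1 < p * q := by nlinarith
  have key : imp a p * imp a q < imp a (p * q) := by
    refine lt_of_pow_lt_pow_left₀ 2 (imp_pos h0 (by positivity)).le ?_
    rw [mul_pow, imp_sq h0 hp0, imp_sq h0 hq0, imp_sq h0 (by positivity), impSq_of_ge h0 hp.le,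
      impSq_of_ge h0 hq.le, impSq_of_ge h0 hpq.le, div_mul_div_comm,
      div_lt_div_iff₀ (by positivity) (by positivity)]
    have e : p * q * (1 + a * (p * q)) * ((p + a) * (q + a))
        - p * (1 + a * p) * (q * (1 + a * q)) * (p * q + a)
        = p * q * (a * (1 - a) * ((p * q - 1) * ((p - 1) * (q - 1)))) := by ring
    have : 0 < p * q * (a * (1 - a) * ((p * q - 1) * ((p - 1) * (q - 1)))) := by
      have h2 : 0 < 1 - a := by linarith
      have h3 : 0 < p * q - 1 := by linarith
      have h4 : 0 < p - 1 := by linarith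
      have h5 : 0 < q - 1 := by linarith
      positivity
    linarith
  have := Real.log_lt_log (mul_pos (imp_pos h0 hp0) (imp_pos h0 hq0)) key
  rw [Real.log_mul (imp_pos h0 hp0).ne' (imp_pos h0 hq0).ne'] at this
  rw [logExc, logExc, logExc, Real.log_mul hp0.ne' hq0.ne']
  linarith

/-- The derivative of `logExc` on shocks. -/
def logExcd (a q : ℝ) : ℝ :=
  a * (1 - a) * (q - 1) ^ 2 / (2 * (1 + a) * (q * (1 + a * q) * (q + a)))

/-- The derivative of `vel + imp` on shocks, divided by `imp` and the derivative of `logExc`, as a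
function of `d = 1 / (q - 1)`. In this variable it is visibly increasing. -/
def slopeRatio (a d : ℝ) : ℝ :=
  ((1 + a) * (1 + 2 * (1 + a) * (d * (1 + d))) +
    √(1 + a) * (1 + (2 + 2 * a) * d) * √((1 + d) * (a + (1 + a) * d))) / (1 - a)

lemma slopeRatio_lt (h0 : 0 < a) (h1 : a < 1) {c d : ℝ} (hc : 0 < c) (hcd : c < d) :
    slopeRatio a c < slopeRatio a d := by
  have hd : 0 < d := hc.trans hcd
  refine div_lt_div_of_pos_right (add_lt_add_of_lt_of_le ?_ ?_) (by linarith)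
  · gcongr
  · gcongr

lemma slopeRatio_pos (h0 : 0 < a) (h1 : a < 1) {d : ℝ} (hd : 0 < d) : 0 < slopeRatio a d := by
  have : 0 < 1 - a := by linarith
  unfold slopeRatio
  positivity

lemma logExcd_pos (h0 : 0 < a) (h1 : a < 1) {q : ℝ} (hq : 1 < q) : 0 < logExcd a q := by
  have : 0 < 1 - a := by linarith
  have : 0 < q - 1 := by linarith
  have : 0 < q := by linarith
  unfold logExcd
  positivity

lemma hasDerivAt_vel_add_imp (h0 : 0 < a) (h1 : a < 1) {q : ℝ} (hq : 1 < q) :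
    HasDerivAt (fun q => vel a q + imp a q)
      (imp a q * logExcd a q * slopeRatio a (1 / (q - 1))) q := by
  have hq0 : 0 < q := by linarith
  refine ((hasDerivAt_vel h0 hq0).add (hasDerivAt_imp h0 hq0)).congr_deriv ?_
  have hd : 0 < q - 1 := by linarith
  have ha' : 0 < 1 - a := by linarith
  have hsa : 0 < √(1 + a) := Real.sqrt_pos.2 (by linarith)
  have hsa2 : √(1 + a) ^ 2 = 1 + a := Real.sq_sqrt (by linarith)
  have hsq : 0 < √(q + a) := Real.sqrt_pos.2 (by linarith)
  have hsq2 : √(q + a) ^ 2 = q + a := Real.sq_sqrt (by linarith)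
  have hsn : 0 < √(q * (1 + a * q)) := Real.sqrt_pos.2 (by positivity)
  have hsn2 : √(q * (1 + a * q)) ^ 2 = q * (1 + a * q) := Real.sq_sqrt (by positivity)
  have e1 : √((1 + 1 / (q - 1)) * (a + (1 + a) * (1 / (q - 1))))
      = √(q * (1 + a * q)) / (q - 1) := by
    rw [show (1 + 1 / (q - 1)) * (a + (1 + a) * (1 / (q - 1)))
      = q * (1 + a * q) / (q - 1) ^ 2 by field_simp; ring, Real.sqrt_div (by positivity),
      Real.sqrt_sq hd.le]
  have e2 : imp a q = √(q * (1 + a * q)) / √(q + a) := by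
    rw [imp_of_ge h0 hq.le, Real.sqrt_div (by positivity)]
  rw [veld, if_neg (not_le.2 hq), svd, impSqd, if_neg (not_le.2 hq), slopeRatio, e1, e2, logExcd,
    Real.sqrt_mul (by linarith)]
  set n := √(q * (1 + a * q))
  set s := √(q + a)
  set r := √(1 + a)
  have hqa : q + a = s ^ 2 := hsq2.symm
  have e3 : 2 * (1 + a) * (q * (1 + a * q) * (q + a)) = 2 * r ^ 2 * (n ^ 2 * s ^ 2) := by
    rw [hsa2, hsn2, hsq2]
  rw [e3, hqa]
  have hr2 : 1 + a = r ^ 2 := hsa2.symm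
  have e4 : (1 + a) * (1 + 2 * (1 + a) * (1 / (q - 1) * (1 + 1 / (q - 1))))
      = r ^ 2 * ((q ^ 2 + 2 * a * q + 1) / (q - 1) ^ 2) := by
    rw [← hr2]; field_simp; ring
  have e5 : 1 + (2 + 2 * a) * (1 / (q - 1)) = (q + (1 + 2 * a)) / (q - 1) := by
    field_simp; ring
  rw [e4, e5]
  field_simp
  ring

lemma continuousAt_logExc (h0 : 0 < a) {q : ℝ} (hq : 0 < q) : ContinuousAt (logExc a) q :=
  ((hasDerivAt_imp h0 hq).continuousAt.log (imp_pos h0 hq).ne').sub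
    ((Real.continuousAt_log hq.ne').const_mul _)

lemma tendsto_logExc_atTop (h0 : 0 < a) (h1 : a < 1) : Tendsto (logExc a) atTop atTop := by
  have hz := zet_lt_half h0 h1
  have t1 := (tendsto_imp_div_sqrt h0).log (Real.sqrt_pos.2 h0).ne'
  have t2 := t1.add_atTop (Real.tendsto_log_atTop.const_mul_atTop
    (show 0 < 1 / 2 - zet a by linarith))
  refine t2.congr' ?_
  filter_upwards [eventually_gt_atTop 0] with q hq
  have := imp_pos h0 hq
  rw [Real.log_div this.ne' (Real.sqrt_pos.2 hq).ne', Real.log_sqrt hq.le, logExc]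
  ring

/-- `logExc` on `[1, ∞)`, continued to an increasing bijection of `ℝ`. -/
def logExcExt (a q : ℝ) : ℝ := logExc a (max q 1) + min (q - 1) 0

lemma logExcExt_strictMono (h0 : 0 < a) (h1 : a < 1) : StrictMono (logExcExt a) := by
  intro p q hpq
  unfold logExcExt
  rcases le_or_gt q 1 with h | h
  · rw [max_eq_right h, max_eq_right (hpq.le.trans h), min_eq_left (by linarith),
      min_eq_left (by linarith)]
    linarith
  · refine add_lt_add_of_lt_of_le (logExc_lt h0 h1 (lt_max_of_lt_right one_pos) ?_ ?_)
      (min_le_min_right _ (by linarith))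
    · rw [max_eq_left h.le]; exact max_lt hpq h
    · exact lt_max_of_lt_left h

lemma logExcExt_surjective (h0 : 0 < a) (h1 : a < 1) : Function.Surjective (logExcExt a) := by
  refine Continuous.surjective ?_ ?_ ?_
  · refine Continuous.add ?_ (by fun_prop)
    refine continuous_iff_continuousAt.2 fun q => ContinuousAt.comp (g := logExc a)
      (continuousAt_logExc h0 (lt_max_of_lt_right one_pos)) (by fun_prop)
  · refine (tendsto_logExc_atTop h0 h1).congr' ?_
    filter_upwards [eventually_ge_atTop 1] with q hq
    rw [logExcExt, max_eq_left hq, min_eq_right (by linarith), add_zero]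
  · refine (tendsto_atBot_add_const_right atBot (-1) tendsto_id).congr' ?_
    filter_upwards [eventually_le_atBot 1] with q hq
    rw [logExcExt, max_eq_right hq, min_eq_left (by linarith), logExc_of_le one_pos le_rfl]
    simp; ring

/-- The strength of the shock for which `logExc` takes the prescribed value `s ≥ 0`; the values at
`s < 0` are an artefact of the continuation `logExcExt`. -/
def entShock (h0 : 0 < a) (h1 : a < 1) : ℝ ≃o ℝ :=
  ((logExcExt_strictMono h0 h1).orderIsoOfSurjective _ (logExcExt_surjective h0 h1)).symm

lemma logExcExt_entShock (h0 : 0 < a) (h1 : a < 1) (s : ℝ) :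
    logExcExt a (entShock h0 h1 s) = s :=
  ((logExcExt_strictMono h0 h1).orderIsoOfSurjective _
    (logExcExt_surjective h0 h1)).apply_symm_apply s

lemma logExcExt_of_ge {q : ℝ} (hq : 1 ≤ q) : logExcExt a q = logExc a q := by
  rw [logExcExt, max_eq_left hq, min_eq_right (by linarith), add_zero]

lemma entShock_logExc (h0 : 0 < a) (h1 : a < 1) {q : ℝ} (hq : 1 ≤ q) :
    entShock h0 h1 (logExc a q) = q := by
  rw [← logExcExt_of_ge hq]
  exact ((logExcExt_strictMono h0 h1).orderIsoOfSurjective _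
    (logExcExt_surjective h0 h1)).symm_apply_apply q

lemma one_lt_entShock (h0 : 0 < a) (h1 : a < 1) {s : ℝ} (hs : 0 < s) :
    1 < entShock h0 h1 s := by
  have e := entShock_logExc h0 h1 (le_refl 1)
  rw [logExc_of_le one_pos le_rfl] at e
  rw [← e]
  exact (entShock h0 h1).strictMono hs

lemma logExc_entShock (h0 : 0 < a) (h1 : a < 1) {s : ℝ} (hs : 0 < s) :
    logExc a (entShock h0 h1 s) = s := by
  rw [← logExcExt_of_ge (one_lt_entShock h0 h1 hs).le]
  exact logExcExt_entShock h0 h1 s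

lemma hasDerivAt_entShock (h0 : 0 < a) (h1 : a < 1) {s : ℝ} (hs : 0 < s) :
    HasDerivAt (entShock h0 h1) (logExcd a (entShock h0 h1 s))⁻¹ s := by
  have hq := one_lt_entShock h0 h1 hs
  refine HasDerivAt.of_local_left_inverse (f := logExcExt a)
    (entShock h0 h1).continuous.continuousAt ?_ (logExcd_pos h0 h1 hq).ne'
    (.of_forall fun t => logExcExt_entShock h0 h1 t)
  refine (hasDerivAt_logExc h0 hq).congr_of_eventuallyEq ?_
  filter_upwards [lt_mem_nhds hq] with t ht
  exact logExcExt_of_ge ht.le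

/-- The single shock that produces the entropy of two successive shocks `x`, `y` reaches a lower
pressure than these. -/
lemma entShock_add_lt (h0 : 0 < a) (h1 : a < 1) {x y : ℝ} (hx : 1 < x) (hy : 1 < y) :
    entShock h0 h1 (logExc a x + logExc a y) < x * y := by
  have hxy : 1 < x * y := by nlinarith
  rw [← entShock_logExc h0 h1 hxy.le]
  exact (entShock h0 h1).strictMono (logExc_superadditive h0 h1 hx hy)

lemma lt_entShock_add (h0 : 0 < a) (h1 : a < 1) {x y : ℝ} (hx : 1 < x) (hy : 1 ≤ y) :
    y < entShock h0 h1 (logExc a x + logExc a y) := by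
  conv_lhs => rw [← entShock_logExc h0 h1 hy]
  exact (entShock h0 h1).strictMono (by linarith [logExc_pos h0 h1 hx])

lemma imp_entShock_add (h0 : 0 < a) (h1 : a < 1) {x y : ℝ} (hx : 1 < x) (hy : 1 < y) :
    imp a (entShock h0 h1 (logExc a x + logExc a y))
      = imp a x * imp a y *
        (entShock h0 h1 (logExc a x + logExc a y) / (x * y)) ^ zet a := by
  have hx0 : 0 < x := by linarith
  have hy0 : 0 < y := by linarith
  have hs : 0 < logExc a x + logExc a y := add_pos (logExc_pos h0 h1 hx) (logExc_pos h0 h1 hy)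
  have hB0 : 0 < entShock h0 h1 (logExc a x + logExc a y) := by
    linarith [one_lt_entShock h0 h1 hs]
  rw [imp_eq_exp h0 hB0, logExc_entShock h0 h1 hs, imp_eq_exp h0 hx0, imp_eq_exp h0 hy0,
    Real.div_rpow hB0.le (by positivity), Real.mul_rpow hx0.le hy0.le, Real.exp_add]
  have := Real.rpow_pos_of_pos hx0 (zet a)
  have := Real.rpow_pos_of_pos hy0 (zet a)
  field_simp

/-- The single backward shock with the entropy of two successive shocks `x`, `y`, followed by the
isentropic forward wave that restores the pressure, decelerates the gas less than the two shocks
do. The difference vanishes at `y = 1` and increases with `y`, as `slopeRatio` decreases with the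
strength. -/
lemma vel_add_imp_entShock_lt (h0 : 0 < a) (h1 : a < 1) {x y : ℝ} (hx : 1 < x) (hy : 1 < y) :
    vel a (entShock h0 h1 (logExc a x + logExc a y))
      + imp a (entShock h0 h1 (logExc a x + logExc a y))
      < vel a x + imp a x * (vel a y + imp a y) := by
  set χ := fun q => vel a q + imp a q with hχ
  set Bf := fun y => entShock h0 h1 (logExc a x + logExc a y) with hBf
  have hEx := logExc_pos h0 h1 hx
  have hB1 : ∀ t, 1 ≤ t → 1 < Bf t := fun t ht =>
    one_lt_entShock h0 h1 (by linarith [logExc_nonneg h0 h1 (one_pos.trans_le ht)])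
  have hχc : ∀ q, 0 < q → ContinuousAt χ q := fun q hq =>
    (hasDerivAt_vel h0 hq).continuousAt.add (hasDerivAt_imp h0 hq).continuousAt
  have hx0 : 0 < x := by linarith
  have hBx : Bf 1 = x := by
    simp only [hBf, logExc_of_le one_pos le_rfl, add_zero]
    exact entShock_logExc h0 h1 hx.le
  have hmain : (fun y => imp a x * χ y - χ (Bf y)) 1 < (fun y => imp a x * χ y - χ (Bf y)) y := by
    refine lt_of_hasDerivAt_pos (f := fun y => imp a x * χ y - χ (Bf y))
      (f' := fun t => imp a x * (imp a t * logExcd a t *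
      slopeRatio a (1 / (t - 1))) - imp a (Bf t) * logExcd a (Bf t) *
      slopeRatio a (1 / (Bf t - 1)) * ((logExcd a (Bf t))⁻¹ * logExcd a t)) hy ?_ ?_ ?_
    · intro t ht
      have ht0 : 0 < t := by linarith [ht.1]
      have hc : ContinuousAt Bf t := ContinuousAt.comp (g := entShock h0 h1)
        (entShock h0 h1).continuous.continuousAt
        (continuousAt_const.add (continuousAt_logExc h0 ht0))
      exact (((hχc t ht0).const_mul _).sub
        (ContinuousAt.comp (g := χ) (hχc _ (by linarith [hB1 t ht.1])) hc)).continuousWithinAt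
    · intro t ht
      have hs : 0 < logExc a x + logExc a t := add_pos hEx (logExc_pos h0 h1 ht.1)
      have hB : HasDerivAt Bf ((logExcd a (Bf t))⁻¹ * logExcd a t) t :=
        HasDerivAt.comp (h₂ := entShock h0 h1) t (hasDerivAt_entShock h0 h1 hs)
          ((hasDerivAt_logExc h0 ht.1).const_add _)
      exact ((hasDerivAt_vel_add_imp h0 h1 ht.1).const_mul _).sub
        (HasDerivAt.comp (h₂ := χ) t (hasDerivAt_vel_add_imp h0 h1 (hB1 t ht.1.le)) hB)
    · intro t ht
      have ht1 : 1 < t := ht.1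
      have hB := hB1 t ht1.le
      have hd := logExcd_pos h0 h1 hB
      have htB : t < Bf t := lt_entShock_add h0 h1 hx ht1.le
      have hBt : Bf t < x * t := entShock_add_lt h0 h1 hx ht1
      have e1 : imp a (Bf t) < imp a x * imp a t := by
        rw [hBf]
        simp only
        rw [imp_entShock_add h0 h1 hx ht1]
        have h2 : (Bf t / (x * t)) ^ zet a < 1 := by
          refine Real.rpow_lt_one (by positivity) ?_ (zet_pos h0)
          rwa [div_lt_one (by positivity)]
        have h3 := mul_pos (imp_pos h0 hx0) (imp_pos h0 (show 0 < t by linarith))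
        exact mul_lt_of_lt_one_right h3 h2
      have e2 : slopeRatio a (1 / (Bf t - 1)) < slopeRatio a (1 / (t - 1)) :=
        slopeRatio_lt h0 h1 (one_div_pos.2 (by linarith))
          (one_div_lt_one_div_of_lt (by linarith) (by linarith))
      have e3 := slopeRatio_pos h0 h1 (one_div_pos.2 (show 0 < Bf t - 1 by linarith))
      have e4 := mul_lt_mul'' e1 e2 (imp_pos h0 (by linarith)).le e3.le
      have e5 : imp a x * (imp a t * logExcd a t * slopeRatio a (1 / (t - 1))) -
          imp a (Bf t) * logExcd a (Bf t) * slopeRatio a (1 / (Bf t - 1)) *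
            ((logExcd a (Bf t))⁻¹ * logExcd a t)
          = logExcd a t * (imp a x * imp a t * slopeRatio a (1 / (t - 1)) -
            imp a (Bf t) * slopeRatio a (1 / (Bf t - 1))) := by
        field_simp
      rw [e5]
      exact mul_pos (logExcd_pos h0 h1 ht1) (by linarith)
  simp only [hBx] at hmain
  have e1 : χ 1 = 1 := by simp [hχ]
  rw [e1] at hmain
  simp only [hχ] at hmain
  linarith

/-- Two shocks: the entropy decreases across the outgoing contact. -/
lemma entropy_SS (h0 : 0 < a) (h1 : a < 1) {x y G : ℝ} (hx : 1 < x) (hy : 1 < y) (hG : 0 < G)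
    (h : outVel a x y G = inVel a x y) :
    logExc a x + logExc a y + logExc a G < logExc a (x * y * G) := by
  have hx0 : 0 < x := by linarith
  have hy0 : 0 < y := by linarith
  have hxy : 1 < x * y := by nlinarith
  have hsup := logExc_superadditive h0 h1 hx hy
  -- outgoing forward shock: `B = x y G` is the total pressure ratio of the shocks `x`, `y`, `G`
  rcases lt_or_ge 1 G with hG1 | hG1
  · linarith [logExc_superadditive h0 h1 hxy hG1]
  rw [logExc_of_le hG hG1, add_zero]
  -- otherwise `x y G` is at most the shock `B` with the incoming entropy, which slows the gas down
  -- too little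
  by_contra! hcon
  have hs : 0 < logExc a x + logExc a y := add_pos (logExc_pos h0 h1 hx) (logExc_pos h0 h1 hy)
  have hlt := entShock_add_lt h0 h1 hx hy
  have himp := imp_entShock_add h0 h1 hx hy
  have hmain := vel_add_imp_entShock_lt h0 h1 hx hy
  have hB1 := one_lt_entShock h0 h1 hs
  have hEB := logExc_entShock h0 h1 hs
  set B := entShock h0 h1 (logExc a x + logExc a y)
  have hle : x * y * G ≤ B := by
    by_contra! h2
    have := logExc_strictMono h0 h1 hB1.le h2
    linarith
  have hxy0 : 0 < x * y := by positivity
  have hGs : G ≤ B / (x * y) := by rw [le_div_iff₀ hxy0]; linarith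
  have hGs0 : 0 < B / (x * y) := hG.trans_le hGs
  have hGs1 : B / (x * y) ≤ 1 := by rw [div_le_one hxy0]; exact hlt.le
  have hm := (outVel_strictMono h0 hx0 hy0).monotoneOn hG hGs0 hGs
  rw [h] at hm
  have e : outVel a x y (B / (x * y)) = vel a B + imp a B - imp a x * imp a y := by
    rw [outVel, vel_of_le hGs1, mul_div_cancel₀ _ hxy0.ne', himp]; ring
  rw [e, inVel] at hm
  linarith

/-- A shock overtaken by a rarefaction: the outgoing backward wave is weaker than the incoming
shock, and the entropy increases across the outgoing contact. -/
lemma entropy_SR (h0 : 0 < a) (h1 : a < 1) {x y G : ℝ} (hx : 1 < x) (hy0 : 0 < y) (hy : y < 1)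
    (hG : 0 < G) (h : outVel a x y G = inVel a x y) :
    logExc a (x * y * G) < logExc a x + logExc a y + logExc a G := by
  have hx0 : 0 < x := by linarith
  have hB : x * y * G < x := by
    by_contra! hcon
    have hle : 1 / y ≤ G := by
      rw [div_le_iff₀ hy0]
      have : x * 1 ≤ x * (G * y) := by linarith
      exact le_of_mul_le_mul_left this hx0
    have hm := (outVel_strictMono h0 hx0 hy0).monotoneOn
      (mem_Ioi.2 (show 0 < 1 / y by positivity)) hG hle
    have e : x * y * (1 / y) = x := by field_simp
    have hv := vel_pos h0 (show 1 < 1 / y by rw [lt_div_iff₀ hy0]; linarith)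
    have hv2 := vel_neg h0 hy0 hy
    have hix := imp_pos h0 hx0
    have hiy := imp_pos h0 hy0
    rw [h, outVel, inVel, e] at hm
    have := mul_pos (mul_pos hix hiy) hv
    have := mul_neg_of_pos_of_neg hix hv2
    linarith
  have := logExc_lt h0 h1 (show 0 < x * y * G by positivity) hB hx
  linarith [logExc_nonneg h0 h1 hG, logExc_nonneg h0 h1 hy0]

/-- A rarefaction overtaken by a shock: the outgoing backward wave is weaker than the incoming
shock, and the entropy increases across the outgoing contact. -/
lemma entropy_RS (h0 : 0 < a) (h1 : a < 1) {x y G : ℝ} (hx0 : 0 < x) (hx : x < 1) (hy : 1 < y)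
    (hG : 0 < G) (h : outVel a x y G = inVel a x y) :
    logExc a (x * y * G) < logExc a x + logExc a y + logExc a G := by
  have hy0 : 0 < y := by linarith
  have hB : x * y * G < y := by
    by_contra! hcon
    have hle : 1 / x ≤ G := by
      rw [div_le_iff₀ hx0]
      have : y * 1 ≤ y * (G * x) := by linarith
      exact le_of_mul_le_mul_left this hy0
    have hm := (outVel_strictMono h0 hx0 hy0).monotoneOn
      (mem_Ioi.2 (show 0 < 1 / x by positivity)) hG hle
    have e : x * y * (1 / x) = y := by field_simp
    have hv := vel_pos h0 (show 1 < 1 / x by rw [lt_div_iff₀ hx0]; linarith)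
    have hv2 := vel_neg h0 hx0 hx
    have hvy := vel_pos h0 hy
    have hix := imp_pos h0 hx0
    have hix1 := imp_lt_one h0 hx0 hx
    have hiy := imp_pos h0 hy0
    rw [h, outVel, inVel, e] at hm
    have := mul_pos (mul_pos hix hiy) hv
    nlinarith
  have := logExc_lt h0 h1 (show 0 < x * y * G by positivity) hB hy
  linarith [logExc_nonneg h0 h1 hG, logExc_nonneg h0 h1 hx0]

end Contact

/-! ### From the gas-dynamical quantities to the normalised ones -/

section Bridge

variable {γ : ℝ}

lemma a_pos (hγ : 1 < γ) : 0 < a γ := div_pos (by linarith) (by linarith)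

lemma a_lt_one (hγ : 1 < γ) : a γ < 1 := by
  rw [a, div_lt_one (by linarith)]; linarith

lemma zet_a (hγ : 1 < γ) : zet (a γ) = (γ - 1) / (2 * γ) := by
  have : γ + 1 ≠ 0 := by linarith
  have : γ ≠ 0 := by linarith
  rw [zet, a, show 1 + (γ - 1) / (γ + 1) = 2 * γ / (γ + 1) by field_simp; ring]
  field_simp

lemma nu_pos (hγ : 1 < γ) : 0 < nu γ := by
  have h0 := a_pos hγ
  have h1 := a_lt_one hγ
  exact div_pos (Real.sqrt_pos.2 (by nlinarith)) h0

lemma nu_eq (hγ : 1 < γ) : nu γ = 2 / (γ - 1) * √γ := by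
  have h1 : 0 < γ - 1 := by linarith
  have h2 : 0 < γ + 1 := by linarith
  have e : 1 - a γ ^ 2 = γ * (2 / (γ + 1)) ^ 2 := by rw [a]; field_simp; ring
  rw [nu, e, Real.sqrt_mul (by linarith), Real.sqrt_sq (by positivity), a]
  field_simp

lemma kappa_eq (hγ : 1 < γ) : kappa γ = nu γ * (a γ / √(1 + a γ)) := by
  have h0 := a_pos hγ
  have h1 := a_lt_one hγ
  have hs : 0 < √(1 + a γ) := Real.sqrt_pos.2 (by linarith)
  rw [kappa, nu, show 1 - a γ ^ 2 = (1 - a γ) * (1 + a γ) by ring, Real.sqrt_mul (by linarith)]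
  field_simp

lemma kappa_shock (hγ : 1 < γ) {q : ℝ} :
    kappa γ * (q - 1) / √(q + a γ) = nu γ * sv (a γ) q := by
  have h0 := a_pos hγ
  rw [kappa_eq hγ, sv, Real.sqrt_mul (by linarith)]
  field_simp

lemma psiB_eq (hγ : 1 < γ) (q : ℝ) : psiB γ q = nu γ * vel (a γ) q := by
  unfold psiB vel
  split_ifs
  · rfl
  · exact kappa_shock hγ

lemma phiB_eq (hγ : 1 < γ) {q : ℝ} (hq : 0 < q) : phiB γ q = impSq (a γ) q / q := by
  unfold phiB impSq
  split_ifs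
  · rw [← Real.rpow_sub_one hq.ne', zet_a hγ]
    congr 1
    have : γ ≠ 0 := by linarith
    field_simp
    ring
  · field_simp

lemma phiB_pos (hγ : 1 < γ) {q : ℝ} (hq : 0 < q) : 0 < phiB γ q := by
  rw [phiB_eq hγ hq]; exact div_pos (impSq_pos (a_pos hγ) hq) hq

lemma phiF_eq (hγ : 1 < γ) {f : ℝ} (hf : 0 < f) : phiF γ f = (phiB γ (1 / f))⁻¹ := by
  have h0 := a_pos hγ
  unfold phiF phiB
  rcases lt_trichotomy f 1 with h | h | h
  · rw [if_neg (not_le.2 h), if_neg (not_le.2 (by rw [lt_div_iff₀ hf]; linarith))]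
    field_simp
  · subst h; simp
  · rw [if_pos h.le, if_pos (by rw [div_le_one hf]; exact h.le), one_div f, Real.inv_rpow hf.le,
      inv_inv]

/-- Reversing the orientation of a wave exchanges the forward and the backward families. -/
lemma vel_div_imp_inv {a : ℝ} (h0 : 0 < a) {f : ℝ} (hf : 0 < f) :
    vel a (1 / f) / imp a (1 / f)
      = if 1 ≤ f then 1 - f ^ zet a else -sv a f := by
  have hif := imp_pos h0 (show 0 < 1 / f by positivity)
  split_ifs with h
  · have h2 : 1 / f ≤ 1 := by rwa [div_le_one hf]
    have hp := Real.rpow_pos_of_pos hf (zet a)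
    rw [vel_of_le h2, imp_of_le (by positivity) h2, one_div f, Real.inv_rpow hf.le]
    field_simp
  · have h2 : 1 ≤ 1 / f := by rw [le_div_iff₀ hf]; linarith
    rw [vel_of_ge h2, imp_of_ge h0 h2, sv, sv]
    have e1 : (1 + a) * (1 / f + a) = (1 + a) * (1 + a * f) / f := by field_simp
    have e2 : 1 / f * (1 + a * (1 / f)) / (1 / f + a) = (f + a) / (1 + a * f) / f := by
      field_simp
    rw [e1, e2, Real.sqrt_div (by positivity), Real.sqrt_div (by positivity),
      Real.sqrt_div (by positivity), Real.sqrt_mul (by positivity), Real.sqrt_mul (by positivity)]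
    have hs1 := Real.sqrt_pos.2 hf
    have hs2 := Real.sqrt_pos.2 (show 0 < 1 + a by positivity)
    have hs3 := Real.sqrt_pos.2 (show 0 < 1 + a * f by positivity)
    have hs4 := Real.sqrt_pos.2 (show 0 < f + a by positivity)
    have hf2 : √f ^ 2 = f := Real.sq_sqrt hf.le
    set s := √f
    rw [← hf2]
    field_simp
    ring

lemma psiF_eq (hγ : 1 < γ) {f : ℝ} (hf : 0 < f) :
    psiF γ f = -(nu γ * (vel (a γ) (1 / f) / imp (a γ) (1 / f))) := by
  rw [vel_div_imp_inv (a_pos hγ) hf]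
  unfold psiF
  split_ifs
  · change nu γ * (f ^ zet (a γ) - 1) = _
    ring
  · rw [kappa_shock hγ]; ring

/-- On the hyperbola `x y = 1` the function `bwd` compares the two branches of `vel`. -/
lemma bwd_inv {a : ℝ} (h0 : 0 < a) {q : ℝ} (hq : 0 < q) :
    bwd a (1 / q) q = if 1 ≤ q then gap a q else -gap a q := by
  have e : 1 / (1 / q * q) = 1 := by field_simp
  rw [bwd, vel_div_imp_inv h0 hq, e, vel_one, mul_zero, sub_zero]
  split_ifs with h
  · rw [vel_of_ge h, gap]; ring
  · rw [vel_of_le (not_le.1 h).le, gap]; ring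

lemma alpha_eq (hγ : 1 < γ) {q : ℝ} (hq : 0 < q) :
    alpha γ q = -(nu γ * bwd (a γ) (1 / q) q) := by
  have e : 1 / (1 / q * q) = 1 := by field_simp
  rw [alpha, psiF_eq hγ hq, psiB_eq hγ, bwd, e, vel_one]
  ring

lemma sqrt_after_wave (hγ : 1 < γ) {q τ p : ℝ} (hq : 0 < q) :
    √(phiB γ q * τ * (q * p)) = imp (a γ) q * √(τ * p) := by
  have e : phiB γ q * τ * (q * p) = impSq (a γ) q * (τ * p) := by
    rw [phiB_eq hγ hq]; field_simp
  rw [e, Real.sqrt_mul (impSq_pos (a_pos hγ) hq).le, imp]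

lemma GasState.eq_of_components {V W : GasState} (h1 : V.τ = W.τ) (h2 : V.u = W.u)
    (h3 : V.p = W.p) : V = W := by
  cases V; cases W; simp_all

/-- Matching the pressures determines `B` and matching the specific volumes determines `C`; the
velocities leave one equation for the reciprocal of the strength of the outgoing forward wave. -/
lemma outgoing_iff (hγ : 1 < γ) {U : GasState} (hU : U.Physical) {x y : ℝ} (hx : 0 < x)
    (hy : 0 < y) {B C F : ℝ} :
    Outgoing γ U x y B C F ↔ 0 < F ∧ B = x * y * (1 / F) ∧
      C = (imp (a γ) x * imp (a γ) y * imp (a γ) (1 / F) / imp (a γ) B) ^ 2 ∧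
      outVel (a γ) x y (1 / F) = inVel (a γ) x y := by
  have h0 := a_pos hγ
  have hν := nu_pos hγ
  obtain ⟨hτ, hp⟩ := hU
  have hs : 0 < √(U.τ * U.p) := Real.sqrt_pos.2 (mul_pos hτ hp)
  -- the wave relations, given the relation between the pressures and specific volumes
  have main : ∀ G : ℝ, 0 < G → F = 1 / G → B = x * y * G →
      C * phiB γ B = phiB γ x * phiB γ y * phiB γ G →
      ((forwardWave γ F (contactWave C (backwardWave γ B U))).u = (rightState γ U x y).u ↔
        outVel (a γ) x y G = inVel (a γ) x y) := by
    intro G hG hFG hB hC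
    have hF0 : 0 < F := by rw [hFG]; positivity
    have e1 : √(C * (phiB γ B * U.τ) * (B * U.p))
        = imp (a γ) x * imp (a γ) y * imp (a γ) G * √(U.τ * U.p) := by
      have : C * (phiB γ B * U.τ) * (B * U.p)
          = impSq (a γ) x * impSq (a γ) y * impSq (a γ) G * (U.τ * U.p) := by
        rw [← mul_assoc C, hC, hB, phiB_eq hγ hx, phiB_eq hγ hy, phiB_eq hγ hG]
        field_simp
      have hix := (impSq_pos h0 hx).le
      have hiy := (impSq_pos h0 hy).le
      have hig := (impSq_pos h0 hG).le
      rw [this, Real.sqrt_mul (by positivity), Real.sqrt_mul (by positivity),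
        Real.sqrt_mul hix, imp, imp, imp]
    have e2 : psiF γ F = -(nu γ * (vel (a γ) G / imp (a γ) G)) := by
      rw [psiF_eq hγ hF0, hFG, one_div_one_div]
    simp only [forwardWave, contactWave, backwardWave, rightState]
    rw [e1, e2, sqrt_after_wave hγ hx, psiB_eq hγ, psiB_eq hγ, psiB_eq hγ, outVel, inVel, ← hB]
    have hig := imp_pos h0 hG
    have e3 : nu γ * (vel (a γ) G / imp (a γ) G) *
        (imp (a γ) x * imp (a γ) y * imp (a γ) G * √(U.τ * U.p))
        = nu γ * √(U.τ * U.p) * (imp (a γ) x * imp (a γ) y * vel (a γ) G) := by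
      field_simp
    rw [neg_mul, e3]
    constructor
    · intro h
      have : nu γ * √(U.τ * U.p) * (vel (a γ) B + imp (a γ) x * imp (a γ) y * vel (a γ) G)
          = nu γ * √(U.τ * U.p) * (vel (a γ) x + imp (a γ) x * vel (a γ) y) := by linarith
      exact mul_left_cancel₀ (mul_pos hν hs).ne' this
    · intro h
      have := congrArg (fun t => nu γ * √(U.τ * U.p) * t) h
      linarith
  have hCsq : ∀ G : ℝ, 0 < G → B = x * y * G →
      (C * phiB γ B = phiB γ x * phiB γ y * phiB γ G ↔
        C = (imp (a γ) x * imp (a γ) y * imp (a γ) G / imp (a γ) B) ^ 2) := by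
    intro G hG hB
    have hB0 : 0 < B := by rw [hB]; positivity
    rw [div_pow, mul_pow, mul_pow, imp_sq h0 hx, imp_sq h0 hy, imp_sq h0 hG, imp_sq h0 hB0,
      phiB_eq hγ hB0, phiB_eq hγ hx, phiB_eq hγ hy, phiB_eq hγ hG,
      eq_div_iff (impSq_pos h0 hB0).ne', hB]
    rw [hB] at hB0
    field_simp
  constructor
  · rintro ⟨hB, hC, hF, h⟩
    have hG : 0 < 1 / F := by positivity
    have h1 := congrArg GasState.p h
    have h2 := congrArg GasState.τ h
    simp only [forwardWave, contactWave, backwardWave, rightState] at h1 h2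
    have hBF : B = x * y * (1 / F) := by
      rw [mul_one_div, eq_div_iff hF.ne']
      have : (B * F) * U.p = (x * y) * U.p := by linarith
      exact mul_right_cancel₀ hp.ne' this
    have hCB : C * phiB γ B = phiB γ x * phiB γ y * phiB γ (1 / F) := by
      have hφ := phiB_pos hγ hG
      rw [phiF_eq hγ hF] at h2
      field_simp at h2
      linarith
    exact ⟨hF, hBF, (hCsq _ hG hBF).1 hCB, (main _ hG (by simp) hBF hCB).1
      (congrArg GasState.u h)⟩
  · rintro ⟨hF, hB, hC, h⟩
    have hG : 0 < 1 / F := by positivity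
    have hB0 : 0 < B := by rw [hB]; positivity
    have hCB := (hCsq _ hG hB).2 hC
    have hu := (main _ hG (by simp) hB hCB).2 h
    have hC0 : 0 < C := by
      have := imp_pos h0 hx
      have := imp_pos h0 hy
      have := imp_pos h0 hG
      have := imp_pos h0 hB0
      rw [hC]; positivity
    refine ⟨hB0, hC0, hF, ?_⟩
    have hφ := phiB_pos hγ hG
    have e1 : (forwardWave γ F (contactWave C (backwardWave γ B U))).τ
        = (rightState γ U x y).τ := by
      simp only [forwardWave, contactWave, backwardWave, rightState]
      rw [phiF_eq hγ hF, ← mul_assoc C, hCB]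
      field_simp
    have e2 : (forwardWave γ F (contactWave C (backwardWave γ B U))).p
        = (rightState γ U x y).p := by
      simp only [forwardWave, contactWave, backwardWave, rightState]
      rw [hB]; field_simp
    exact GasState.eq_of_components e1 hu e2

lemma exists_outgoing_iff (hγ : 1 < γ) {U : GasState} (hU : U.Physical) {x y : ℝ} (hx : 0 < x)
    (hy : 0 < y) (Q : ℝ → Prop) :
    (∃ B C F, Outgoing γ U x y B C F ∧ Q F) ↔
      ∃ G, 0 < G ∧ outVel (a γ) x y G = inVel (a γ) x y ∧ Q (1 / G) := by
  constructor
  · rintro ⟨B, C, F, h, hQ⟩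
    obtain ⟨hF, _, _, h⟩ := (outgoing_iff hγ hU hx hy).1 h
    exact ⟨1 / F, by positivity, h, by rwa [one_div_one_div]⟩
  · rintro ⟨G, hG, h, hQ⟩
    exact ⟨_, _, 1 / G, (outgoing_iff hγ hU hx hy).2 ⟨by positivity, rfl, rfl, by
      rwa [one_div_one_div]⟩, hQ⟩

/-- A vacuum is produced exactly if the incoming velocity drop is at most the infimum of
`outVel`. -/
lemma vacuum_iff (hγ : 1 < γ) {U : GasState} (hU : U.Physical) {x y : ℝ} (hx : 0 < x)
    (hy : 0 < y) : ProducesVacuum γ U x y ↔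
      inVel (a γ) x y ≤ -(1 + imp (a γ) x * imp (a γ) y) := by
  obtain ⟨hτ, hp⟩ := hU
  have hν := nu_pos hγ
  have hs : 0 < √(U.τ * U.p) := Real.sqrt_pos.2 (mul_pos hτ hp)
  have e1 : √(phiB γ y * (phiB γ x * U.τ) * (y * (x * U.p)))
      = imp (a γ) y * (imp (a γ) x * √(U.τ * U.p)) := by
    rw [sqrt_after_wave hγ hy, sqrt_after_wave hγ hx]
  unfold ProducesVacuum Vacuum soundSpeed rightState backwardWave
  simp only
  rw [mul_assoc γ, mul_assoc γ, Real.sqrt_mul (by linarith : 0 ≤ γ) (U.τ * U.p),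
    Real.sqrt_mul (by linarith : 0 ≤ γ) (phiB γ y * (phiB γ x * U.τ) * (y * (x * U.p))), e1,
    psiB_eq hγ, psiB_eq hγ, sqrt_after_wave hγ hx, inVel]
  have e2 : 2 / (γ - 1) * (√γ * √(U.τ * U.p) + √γ * (imp (a γ) y * (imp (a γ) x * √(U.τ * U.p))))
      = nu γ * √(U.τ * U.p) * (1 + imp (a γ) x * imp (a γ) y) := by
    rw [nu_eq hγ]; ring
  rw [e2]
  constructor
  · intro h
    have h2 : nu γ * √(U.τ * U.p) * (1 + imp (a γ) x * imp (a γ) y)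
        ≤ nu γ * √(U.τ * U.p) * -(vel (a γ) x + imp (a γ) x * vel (a γ) y) := by linarith
    have := le_of_mul_le_mul_left h2 (mul_pos hν hs)
    linarith
  · intro h
    have := mul_le_mul_of_nonneg_left h (mul_pos hν hs).le
    linarith

lemma not_vacuum_iff (hγ : 1 < γ) {U : GasState} (hU : U.Physical) {x y : ℝ} (hx : 0 < x)
    (hy : 0 < y) : ¬ProducesVacuum γ U x y ↔
      ∃ G, 0 < G ∧ outVel (a γ) x y G = inVel (a γ) x y := by
  have h0 := a_pos hγ
  rw [vacuum_iff hγ hU hx hy, not_le]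
  exact ⟨fun h => exists_outVel_eq h0 hx hy h, fun ⟨G, hG, h⟩ => h ▸ lt_outVel h0 hx hy hG⟩

lemma backward_trivial_iff (hγ : 1 < γ) {U : GasState} (hU : U.Physical) {x y : ℝ} (hx : 0 < x)
    (hy : 0 < y) : (∃ C F, Outgoing γ U x y 1 C F) ↔ bwd (a γ) x y = 0 := by
  have h0 := a_pos hγ
  have hxy : 0 < x * y := by positivity
  have hb := inVel_sub_outVel_inv h0 hx hy
  have hi := imp_pos h0 hx
  constructor
  · rintro ⟨C, F, h⟩
    obtain ⟨hF, hB, _, h⟩ := (outgoing_iff hγ hU hx hy).1 h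
    have e : 1 / F = 1 / (x * y) := by
      rw [eq_div_iff hxy.ne']; linarith
    rw [← e, h, sub_self] at hb
    exact (mul_eq_zero.1 hb.symm).resolve_left hi.ne'
  · intro h
    rw [h, mul_zero] at hb
    refine ⟨_, x * y, (outgoing_iff hγ hU hx hy).2 ⟨hxy, by field_simp, rfl, by linarith⟩⟩

lemma backwardShock_iff (hγ : 1 < γ) {U : GasState} (hU : U.Physical) {x y : ℝ} (hx : 0 < x)
    (hy : 0 < y) : BackwardShock γ U x y ↔ 0 < bwd (a γ) x y := by
  have h0 := a_pos hγ
  have hxy : 0 < x * y := by positivity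
  have hxy' : 0 < 1 / (x * y) := by positivity
  have hb := inVel_sub_outVel_inv h0 hx hy
  have hi := imp_pos h0 hx
  have hm := outVel_strictMono h0 hx hy
  rw [← mul_pos_iff_of_pos_left hi, ← hb, sub_pos]
  constructor
  · rintro ⟨B, C, F, h, hB1⟩
    obtain ⟨hF, hB, _, h⟩ := (outgoing_iff hγ hU hx hy).1 h
    rw [← h]
    refine hm hxy' (mem_Ioi.2 (by positivity)) ?_
    rw [div_lt_iff₀ hxy]; linarith
  · intro h
    obtain ⟨G, hG, hGe⟩ := exists_outVel_eq h0 hx hy ((lt_outVel h0 hx hy hxy').trans h)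
    refine ⟨_, _, 1 / G, (outgoing_iff hγ hU hx hy).2 ⟨by positivity, rfl, rfl, by
      rwa [one_div_one_div]⟩, ?_⟩
    rw [← hGe, hm.lt_iff_lt hxy' hG, div_lt_iff₀ hxy] at h
    rw [one_div_one_div]; linarith

lemma forward_trivial_iff (hγ : 1 < γ) {U : GasState} (hU : U.Physical) {x y : ℝ} (hx : 0 < x)
    (hy : 0 < y) : (∃ B C, Outgoing γ U x y B C 1) ↔ fwd (a γ) x y = 0 := by
  have hf := outVel_one_sub (a := a γ) x y
  rw [← hf, sub_eq_zero]
  constructor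
  · rintro ⟨B, C, h⟩
    have := ((outgoing_iff hγ hU hx hy).1 h).2.2.2
    rwa [one_div_one] at this
  · intro h
    exact ⟨_, _, (outgoing_iff hγ hU hx hy).2 ⟨one_pos, rfl, rfl, by rwa [one_div_one]⟩⟩

lemma forwardShock_iff (hγ : 1 < γ) {U : GasState} (hU : U.Physical) {x y : ℝ} (hx : 0 < x)
    (hy : 0 < y) : ForwardShock γ U x y ↔ fwd (a γ) x y < 0 := by
  have h0 := a_pos hγ
  have hm := outVel_strictMono h0 hx hy
  rw [← outVel_one_sub, sub_neg, ForwardShock, exists_outgoing_iff hγ hU hx hy fun F => F < 1]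
  constructor
  · rintro ⟨G, hG, h, hG1⟩
    rw [← h]
    exact hm (mem_Ioi.2 one_pos) hG (by rwa [div_lt_one hG] at hG1)
  · intro h
    obtain ⟨G, hG, hGe⟩ := exists_outVel_eq h0 hx hy ((lt_outVel h0 hx hy one_pos).trans h)
    rw [← hGe, hm.lt_iff_lt (mem_Ioi.2 one_pos) hG] at h
    exact ⟨G, hG, hGe, by rwa [div_lt_one hG]⟩

lemma forwardRarefaction_iff (hγ : 1 < γ) {U : GasState} (hU : U.Physical) {x y : ℝ}
    (hx : 0 < x) (hy : 0 < y) : ForwardRarefaction γ U x y ↔ 0 < fwd (a γ) x y := by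
  have h0 := a_pos hγ
  have hm := outVel_strictMono h0 hx hy
  rw [← outVel_one_sub, sub_pos, ForwardRarefaction,
    exists_outgoing_iff hγ hU hx hy fun F => 1 < F]
  constructor
  · rintro (h | ⟨G, hG, h, hG1⟩)
    · rw [vacuum_iff hγ hU hx hy] at h
      exact h.trans_lt (lt_outVel h0 hx hy one_pos)
    · rw [← h]
      exact hm hG (mem_Ioi.2 one_pos) (by rw [lt_div_iff₀ hG] at hG1; linarith)
  · intro h
    by_cases hv : ProducesVacuum γ U x y
    · exact Or.inl hv
    · obtain ⟨G, hG, hGe⟩ := (not_vacuum_iff hγ hU hx hy).1 hv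
      rw [← hGe, hm.lt_iff_lt hG (mem_Ioi.2 one_pos)] at h
      exact Or.inr ⟨G, hG, hGe, by rw [lt_div_iff₀ hG]; linarith⟩

/-- The well-posedness of the interaction problem. -/
lemma vacuum_or_existsUnique (hγ : 1 < γ) {U : GasState} (hU : U.Physical) {x y : ℝ} (hx : 0 < x)
    (hy : 0 < y) : (ProducesVacuum γ U x y ∧ ¬∃ B C F, Outgoing γ U x y B C F) ∨
      (¬ProducesVacuum γ U x y ∧ ∃! w : ℝ × ℝ × ℝ, Outgoing γ U x y w.1 w.2.1 w.2.2) := by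
  by_cases hv : ProducesVacuum γ U x y
  · refine Or.inl ⟨hv, fun ⟨B, C, F, h⟩ => ?_⟩
    obtain ⟨hF, _, _, h⟩ := (outgoing_iff hγ hU hx hy).1 h
    exact ((not_vacuum_iff hγ hU hx hy).2 ⟨1 / F, by positivity, h⟩) hv
  · refine Or.inr ⟨hv, ?_⟩
    obtain ⟨G, hG, hGe⟩ := (not_vacuum_iff hγ hU hx hy).1 hv
    refine ⟨(x * y * (1 / (1 / G)), (imp (a γ) x * imp (a γ) y * imp (a γ) (1 / (1 / G)) /
      imp (a γ) (x * y * (1 / (1 / G)))) ^ 2, 1 / G), (outgoing_iff hγ hU hx hy).2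
      ⟨by positivity, rfl, rfl, by rwa [one_div_one_div]⟩, ?_⟩
    rintro ⟨B, C, F⟩ h
    obtain ⟨hF, hB, hC, h⟩ := (outgoing_iff hγ hU hx hy).1 h
    simp only at hF hB hC h
    have e : 1 / F = G := (outVel_strictMono (a_pos hγ) hx hy).injOn
      (mem_Ioi.2 (by positivity)) hG (h.trans hGe.symm)
    have e' : F = 1 / G := by rw [← e, one_div_one_div]
    subst e'
    rw [hC, hB]

/-- The outgoing contact is read off from the entropies produced by the waves on both sides. -/
lemma contact_iff (hγ : 1 < γ) {U : GasState} (hU : U.Physical) {x y : ℝ} (hx : 0 < x)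
    (hy : 0 < y) {B C F : ℝ} (h : Outgoing γ U x y B C F) :
    (C < 1 ↔ logExc (a γ) x + logExc (a γ) y + logExc (a γ) (1 / F)
      < logExc (a γ) (x * y * (1 / F))) ∧
    (1 < C ↔ logExc (a γ) (x * y * (1 / F))
      < logExc (a γ) x + logExc (a γ) y + logExc (a γ) (1 / F)) := by
  have h0 := a_pos hγ
  obtain ⟨hF, hB, hC, -⟩ := (outgoing_iff hγ hU hx hy).1 h
  have hG : 0 < 1 / F := by positivity
  set G := 1 / F
  have e : C = Real.exp (2 * (logExc (a γ) x + logExc (a γ) y + logExc (a γ) G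
      - logExc (a γ) (x * y * G))) := by
    rw [hC, hB, imp_eq_exp h0 hx, imp_eq_exp h0 hy, imp_eq_exp h0 hG,
      imp_eq_exp h0 (show 0 < x * y * G by positivity), Real.mul_rpow (by positivity) hG.le,
      Real.mul_rpow hx.le hy.le, two_mul, Real.exp_add, ← pow_two, Real.exp_sub, Real.exp_add,
      Real.exp_add]
    have := Real.rpow_pos_of_pos hx (zet (a γ))
    have := Real.rpow_pos_of_pos hy (zet (a γ))
    have := Real.rpow_pos_of_pos hG (zet (a γ))
    field_simp
  rw [e, Real.exp_lt_one_iff, Real.one_lt_exp_iff]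
  constructor <;> constructor <;> intro h <;> linarith

lemma wave_entropy (hγ : 1 < γ) {q : ℝ} (hq : 0 < q) :
    q * phiB γ q ^ γ = Real.exp (2 * γ * logExc (a γ) q) := by
  have h0 := a_pos hγ
  have hγ0 : γ ≠ 0 := by linarith
  have hφ := phiB_pos hγ hq
  have hlog : Real.log (phiB γ q) = 2 * logExc (a γ) q - Real.log q / γ := by
    rw [phiB_eq hγ hq, Real.log_div (impSq_pos h0 hq).ne' hq.ne', ← imp_sq h0 hq, Real.log_pow,
      logExc, zet_a hγ]
    push_cast
    field_simp
    ring
  rw [Real.rpow_def_of_pos hφ, hlog]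
  nth_rewrite 1 [← Real.exp_log hq]
  rw [← Real.exp_add]
  congr 1
  field_simp
  ring

lemma entropy_increase (hγ : 1 < γ) {U : GasState} (hU : U.Physical) {x y : ℝ} (hx : 0 < x)
    (hy : 0 < y) (hs : 0 < logExc (a γ) x + logExc (a γ) y) {K cv : ℝ} (hK : 0 < K)
    (hcv : 0 < cv) :
    specificEntropy γ K cv U < specificEntropy γ K cv (rightState γ U x y) := by
  obtain ⟨hτ, hp⟩ := hU
  have hγ0 : 0 < γ := by linarith
  have hφx := phiB_pos hγ hx
  have hφy := phiB_pos hγ hy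
  have e : y * (x * U.p) * (phiB γ y * (phiB γ x * U.τ)) ^ γ
      = U.p * U.τ ^ γ * Real.exp (2 * γ * (logExc (a γ) x + logExc (a γ) y)) := by
    rw [mul_add (2 * γ), Real.exp_add, ← wave_entropy hγ hx, ← wave_entropy hγ hy,
      Real.mul_rpow hφy.le (by positivity), Real.mul_rpow hφx.le hτ.le]
    ring
  unfold specificEntropy rightState backwardWave
  simp only
  rw [e]
  refine mul_lt_mul_of_pos_left (Real.log_lt_log (by positivity) ?_) hcv
  refine div_lt_div_of_pos_right ?_ hK
  have h1 : 1 < Real.exp (2 * γ * (logExc (a γ) x + logExc (a γ) y)) :=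
    Real.one_lt_exp_iff.2 (by positivity)
  have h2 : 0 < U.p * U.τ ^ γ := by positivity
  exact lt_mul_of_one_lt_right h2 h1

lemma vFun_div_nu (hγ : 1 < γ) {x : ℝ} (hx : 1 < x) :
    vFun γ x / nu γ = (1 + vel (a γ) x) / imp (a γ) x := by
  have h0 := a_pos hγ
  have hν := nu_pos hγ
  have hx0 : 0 < x := by linarith
  have hs1 := Real.sqrt_pos.2 (show 0 < 1 + a γ by linarith)
  have hs2 := Real.sqrt_pos.2 (show 0 < x + a γ by linarith)
  have hs3 := Real.sqrt_pos.2 (show 0 < x + a γ * x ^ 2 by positivity)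
  rw [vFun, kappa_eq hγ, vel_of_gt hx, sv, imp_of_ge h0 hx.le, Real.sqrt_mul (by linarith),
    show x * (1 + a γ * x) = x + a γ * x ^ 2 by ring, Real.sqrt_div (by positivity)]
  field_simp

lemma vacuum_SR_iff (hγ : 1 < γ) {U : GasState} (hU : U.Physical) {x y : ℝ} (h : IsSR x y) :
    ProducesVacuum γ U x y ↔
      y ≤ (1 / 2 * (1 - vFun γ x / nu γ)) ^ (1 / zeta γ) := by
  obtain ⟨hx, hy, hy1⟩ := h
  have h0 := a_pos hγ
  have hx0 : 0 < x := by linarith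
  have hi := imp_pos h0 hx0
  have hlt := one_add_vel_lt_imp h0 hx
  have hz := zet_pos h0
  rw [vacuum_iff hγ hU hx0 hy, vFun_div_nu hγ hx, inVel, vel_of_le hy1.le, imp_of_le hy hy1.le]
  change _ ↔ y ≤ (1 / 2 * (1 - (1 + vel (a γ) x) / imp (a γ) x)) ^ (1 / zet (a γ))
  have hnn : 0 ≤ 1 / 2 * (1 - (1 + vel (a γ) x) / imp (a γ) x) := by
    have := (div_lt_one hi).2 hlt
    linarith
  rw [one_div (zet (a γ)), Real.le_rpow_inv_iff_of_pos hy.le hnn hz]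
  have e : 1 / 2 * (1 - (1 + vel (a γ) x) / imp (a γ) x)
      = (imp (a γ) x - (1 + vel (a γ) x)) / (2 * imp (a γ) x) := by field_simp
  rw [e, le_div_iff₀ (by positivity)]
  constructor <;> intro h <;> linarith

lemma not_vacuum_SS_RS (hγ : 1 < γ) {U : GasState} (hU : U.Physical) {x y : ℝ} (hx : 0 < x)
    (hy : 1 < y) : ¬ProducesVacuum γ U x y := by
  have h0 := a_pos hγ
  have hy0 : 0 < y := by linarith
  rw [vacuum_iff hγ hU hx hy0, not_le, inVel]
  have := neg_one_lt_vel h0 hx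
  have := mul_pos (imp_pos h0 hx) (imp_pos h0 hy0)
  have := mul_pos (imp_pos h0 hx) (vel_pos h0 hy)
  linarith

end Bridge

/-! ### Relative position of the two loci -/

section Position

variable {a : ℝ}

/-- On the backward locus `B = 1`, so `F = x y`, and `F < 1` exactly below the hyperbola
`x y = 1`. -/
lemma fwd_on_backward_locus (h0 : 0 < a) {x y : ℝ} (hx : 0 < x) (hy : 0 < y)
    (h : bwd a x y = 0) :
    (fwd a x y < 0 ↔ y < 1 / x) ∧ (fwd a x y = 0 ↔ y = 1 / x) := by
  have hxy : 0 < x * y := by positivity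
  have hb := inVel_sub_outVel_inv h0 hx hy
  rw [h, mul_zero, sub_eq_zero] at hb
  have hm := outVel_strictMono h0 hx hy
  rw [← outVel_one_sub, hb, sub_neg, sub_eq_zero,
    hm.lt_iff_lt (mem_Ioi.2 one_pos) (mem_Ioi.2 (by positivity)),
    hm.eq_iff_eq (mem_Ioi.2 one_pos) (mem_Ioi.2 (by positivity)), lt_div_iff₀ hxy,
    lt_div_iff₀ hx, eq_div_iff hxy.ne', eq_div_iff hx.ne', one_mul, mul_comm x]
  exact ⟨Iff.rfl, Iff.rfl⟩

end Position

/-! ### The loci and their intersection -/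

section Loci

variable {a : ℝ}

lemma mul_sub_one_sign_gt {s y : ℝ} (hy : 1 < y) :
    (0 < s * (y - 1) ↔ 0 < s) ∧ (s * (y - 1) < 0 ↔ s < 0) := by
  have h : 0 < y - 1 := by linarith
  refine ⟨mul_pos_iff_of_pos_right h, ?_⟩
  rw [← neg_pos, ← neg_mul, mul_pos_iff_of_pos_right h, neg_pos]

lemma mul_sub_one_sign_lt {s y : ℝ} (hy : y < 1) :
    (0 < s * (y - 1) ↔ s < 0) ∧ (s * (y - 1) < 0 ↔ 0 < s) := by
  have h : 0 < 1 - y := by linarith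
  rw [show s * (y - 1) = -s * (1 - y) by ring, mul_pos_iff_of_pos_right h, neg_pos, neg_mul,
    neg_lt_zero, mul_pos_iff_of_pos_right h]
  exact ⟨Iff.rfl, Iff.rfl⟩

/-- On the hyperbola `x y = 1`, the position relative to the backward locus is decided by the
root `y₀` of the gap. -/
lemma bwd_hyperbola (h0 : 0 < a) {y₀ : ℝ}
    (hs : ∀ q, 0 < q → q ≠ 1 → (0 < gap a q * (q - 1) ↔ y₀ < q) ∧
      (gap a q * (q - 1) < 0 ↔ q < y₀)) {q : ℝ} (hq : 0 < q) (hq1 : q ≠ 1) :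
    (0 < bwd a (1 / q) q ↔ y₀ < q) ∧ (bwd a (1 / q) q = 0 ↔ q = y₀) := by
  obtain ⟨hp, hn⟩ := hs q hq hq1
  have hpos : 0 < bwd a (1 / q) q ↔ y₀ < q := by
    rw [← hp, bwd_inv h0 hq]
    rcases hq1.lt_or_gt with h | h
    · rw [if_neg h.not_ge, neg_pos, (mul_sub_one_sign_lt h).1]
    · rw [if_pos h.le, (mul_sub_one_sign_gt h).1]
  have hneg : bwd a (1 / q) q < 0 ↔ q < y₀ := by
    rw [← hn, bwd_inv h0 hq]
    rcases hq1.lt_or_gt with h | h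
    · rw [if_neg h.not_ge, neg_lt_zero, (mul_sub_one_sign_lt h).2]
    · rw [if_pos h.le, (mul_sub_one_sign_gt h).2]
  refine ⟨hpos, ?_⟩
  constructor
  · intro h
    exact le_antisymm (not_lt.1 fun h' => (hpos.2 h').ne' h) (not_lt.1 fun h' => (hneg.2 h').ne h)
  · intro h
    exact le_antisymm (not_lt.1 fun h' => (hpos.1 h').ne' h) (not_lt.1 fun h' => (hneg.1 h').ne h)

lemma IsForwardBranch.sign_gt {h : ℝ → ℝ} (hh : IsForwardBranch a h) {x y : ℝ} (hx : 1 < x)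
    (hy : 0 < y) (hy1 : y ≠ 1) :
    (0 < fwd a x y * (y - 1) ↔ h x < y) ∧ (fwd a x y * (y - 1) < 0 ↔ y < h x) := by
  have := (hh x (Or.inl hx)).2.2 y hy hy1 (Or.inl hx)
  rwa [(fwdQuot_sign_gt hx).1, (fwdQuot_sign_gt hx).2] at this

lemma IsForwardBranch.sign_lt {h : ℝ → ℝ} (hh : IsForwardBranch a h) {x y : ℝ}
    (hd : FDom a x) (hx : x < 1) (hy : 1 < y) :
    (fwd a x y < 0 ↔ h x < y) ∧ (0 < fwd a x y ↔ y < h x) := by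
  have := (hh x hd).2.2 y (by linarith) hy.ne' (Or.inr hy)
  rwa [(fwdQuot_sign_lt hx hy).1, (fwdQuot_sign_lt hx hy).2] at this

lemma IsForwardBranch.sign_gt_gt {h : ℝ → ℝ} (hh : IsForwardBranch a h) {x y : ℝ} (hx : 1 < x)
    (hy : 1 < y) : (0 < fwd a x y ↔ h x < y) ∧ (fwd a x y < 0 ↔ y < h x) := by
  have := hh.sign_gt hx (by linarith : 0 < y) hy.ne'
  rwa [(mul_sub_one_sign_gt hy).1, (mul_sub_one_sign_gt hy).2] at this

lemma IsForwardBranch.sign_gt_lt {h : ℝ → ℝ} (hh : IsForwardBranch a h) {x y : ℝ} (hx : 1 < x)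
    (hy : 0 < y) (hy1 : y < 1) : (fwd a x y < 0 ↔ h x < y) ∧ (0 < fwd a x y ↔ y < h x) := by
  have := hh.sign_gt hx hy hy1.ne
  rwa [(mul_sub_one_sign_lt hy1).1, (mul_sub_one_sign_lt hy1).2] at this

lemma fwd_eq_zero_iff (h0 : 0 < a) (h1 : a < 1) {h : ℝ → ℝ} (hh : IsForwardBranch a h) {x y : ℝ}
    (hx : 0 < x) (hy : 0 < y) (hxy : 1 ≤ x ∨ 1 ≤ y) :
    fwd a x y = 0 ↔ x = 1 ∨ y = 1 ∨ (FDom a x ∧ y = h x) := by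
  rcases eq_or_ne x 1 with rfl | hx1
  · simp [fwd_one_left]
  rcases eq_or_ne y 1 with rfl | hy1
  · simp [fwd_one_right]
  have key : ∀ {s : ℝ}, FDom a x → (0 < s ↔ h x < y) → (s < 0 ↔ y < h x) →
      (s = 0 ↔ x = 1 ∨ y = 1 ∨ (FDom a x ∧ y = h x)) := by
    intro s hd hp hn
    simp only [hx1, hy1, hd, false_or, true_and]
    constructor
    · intro e
      exact le_antisymm (not_lt.1 fun h' => (hp.2 h').ne' e) (not_lt.1 fun h' => (hn.2 h').ne e)
    · intro e
      exact le_antisymm (not_lt.1 fun h' => (hp.1 h').ne' e) (not_lt.1 fun h' => (hn.1 h').ne e)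
  rcases hx1.lt_or_gt with hlt | hgt
  · have hy2 : 1 < y := lt_of_le_of_ne (hxy.resolve_left hlt.not_ge) hy1.symm
    by_cases ha : 1 / 4 < a
    · have hd : FDom a x := Or.inr (Or.inr ⟨hx, hlt, ha⟩)
      obtain ⟨hn, hp⟩ := hh.sign_lt hd hlt hy2
      rw [← neg_eq_zero]
      exact key hd (by rw [neg_pos]; exact hn) (by rw [neg_lt_zero]; exact hp)
    · have hneg := fwd_neg_of_lt h0 h1 (not_lt.1 ha) hx hlt hy2
      refine ⟨fun e => absurd e hneg.ne, ?_⟩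
      rintro (e | e | ⟨hd, -⟩)
      · exact absurd e hx1
      · exact absurd e hy1
      · rcases hd with hd | ⟨hd, -⟩ | ⟨-, -, hd⟩
        · exact absurd hd hlt.not_gt
        · exact absurd hd hx1
        · exact absurd hd ha
  · obtain ⟨hp, hn⟩ := hh.sign_gt hgt hy hy1
    rw [← mul_eq_zero_iff_right (sub_ne_zero.2 hy1)]
    exact key (Or.inl hgt) hp hn

/-- The graphs of the two loci cross exactly once, on the hyperbola `x y = 1`. -/
lemma loci_crossing (h0 : 0 < a) {h k : ℝ → ℝ} {y₀ : ℝ} (hy₀ : 0 < y₀)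
    (hlt : a < 1 / 4 → y₀ < 1) (heq : a = 1 / 4 → y₀ = 1) (hgt : 1 / 4 < a → 1 < y₀)
    (hs : ∀ q, 0 < q → q ≠ 1 → (0 < gap a q * (q - 1) ↔ y₀ < q) ∧
      (gap a q * (q - 1) < 0 ↔ q < y₀))
    (hk1 : k 1 = 1) (hanti : StrictAntiOn k (Ioi 0))
    (hk : ∀ x, 0 < x → 0 < k x ∧ ∀ y, 0 < y → (bwd a x y = 0 ↔ y = k x) ∧
      (0 < bwd a x y ↔ k x < y)) (hh : IsForwardBranch a h) :
    FDom a (1 / y₀) ∧ h (1 / y₀) = y₀ ∧ k (1 / y₀) = y₀ ∧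
      ∀ x, FDom a x → (h x = k x ↔ x = 1 / y₀) ∧ (h x < k x ↔ x < 1 / y₀) := by
  have hinv : 0 < 1 / y₀ := by positivity
  have hd : FDom a (1 / y₀) := by
    rcases lt_trichotomy a (1 / 4) with ha | ha | ha
    · refine Or.inl ?_
      rw [lt_div_iff₀ hy₀]; linarith [hlt ha]
    · exact Or.inr (Or.inl ⟨by rw [heq ha, div_one], ha.ge⟩)
    · refine Or.inr (Or.inr ⟨hinv, ?_, ha⟩)
      rw [div_lt_one hy₀]; exact hgt ha
  have cmp : ∀ x, FDom a x → (h x = k x ↔ x = 1 / y₀) ∧ (h x < k x ↔ x < 1 / y₀) := by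
    intro x hx
    have hx0 := hx.pos
    rcases eq_or_ne x 1 with rfl | hx1
    · rw [hk1]
      rcases (hh 1 hx).2.1 le_rfl with ⟨ha', hh1⟩ | ⟨ha', hh1⟩
      · rw [hh1, heq ha']; simp
      · have hne := hgt ha'
        rw [eq_div_iff hy₀.ne', lt_div_iff₀ hy₀]
        constructor <;> constructor <;> intro h' <;> linarith
    · obtain ⟨hkx, hk'⟩ := hk x hx0
      have hb := ((hk' (k x) hkx).1).2 rfl
      obtain ⟨fneg, fzero⟩ := fwd_on_backward_locus h0 hx0 hkx hb
      have hq1 : 1 / x ≠ 1 := by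
        intro e; rw [div_eq_one_iff_eq hx0.ne'] at e; exact hx1 e.symm
      obtain ⟨bp, bz⟩ := bwd_hyperbola h0 hs (show 0 < 1 / x by positivity) hq1
      rw [one_div_one_div] at bp bz
      have hq := hk' (1 / x) (by positivity)
      rw [← hq.2, bp, lt_div_iff₀ hx0] at fneg
      rw [eq_comm (a := k x), ← hq.1, bz, div_eq_iff hx0.ne'] at fzero
      have hneg : fwd a x (k x) < 0 ↔ h x < k x := by
        rcases hx1.lt_or_gt with hlt | hgt
        · have : 1 < k x := hk1 ▸ hanti (mem_Ioi.2 hx0) (mem_Ioi.2 one_pos) hlt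
          exact (hh.sign_lt hx hlt this).1
        · have : k x < 1 := hk1 ▸ hanti (mem_Ioi.2 one_pos) (mem_Ioi.2 hx0) hgt
          exact (hh.sign_gt_lt hgt hkx this).1
      have hpos : 0 < fwd a x (k x) ↔ k x < h x := by
        rcases hx1.lt_or_gt with hlt | hgt
        · have : 1 < k x := hk1 ▸ hanti (mem_Ioi.2 hx0) (mem_Ioi.2 one_pos) hlt
          exact (hh.sign_lt hx hlt this).2
        · have : k x < 1 := hk1 ▸ hanti (mem_Ioi.2 one_pos) (mem_Ioi.2 hx0) hgt
          exact (hh.sign_gt_lt hgt hkx this).2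
      have hzero : fwd a x (k x) = 0 ↔ h x = k x := by
        constructor
        · intro e
          exact le_antisymm (not_lt.1 fun h' => (hpos.2 h').ne' e)
            (not_lt.1 fun h' => (hneg.2 h').ne e)
        · intro e
          exact le_antisymm (not_lt.1 fun h' => (hpos.1 h').ne' e)
            (not_lt.1 fun h' => (hneg.1 h').ne e)
      rw [← hneg, ← hzero, fneg, fzero, eq_div_iff hy₀.ne', lt_div_iff₀ hy₀, mul_comm y₀,
        eq_comm (a := 1)]
      exact ⟨Iff.rfl, Iff.rfl⟩
  have hk0 : k (1 / y₀) = y₀ := by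
    rcases eq_or_ne y₀ 1 with e | hne
    · rw [e, div_one, hk1]
    · exact (((hk _ hinv).2 y₀ hy₀).1.1 ((bwd_hyperbola h0 hs hy₀ hne).2.2 rfl)).symm
  exact ⟨hd, ((cmp _ hd).1.2 rfl).trans hk0, hk0, cmp⟩

end Loci

/-! ### Translation of the parameter ranges -/

section Parameters

variable {γ : ℝ}

lemma a_lt_quarter_iff (hγ : 1 < γ) : a γ < 1 / 4 ↔ γ < 5 / 3 := by
  rw [a, div_lt_iff₀ (by linarith)]
  constructor <;> intro h <;> linarith

lemma quarter_lt_a_iff (hγ : 1 < γ) : 1 / 4 < a γ ↔ 5 / 3 < γ := by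
  rw [a, lt_div_iff₀ (by linarith)]
  constructor <;> intro h <;> linarith

lemma a_lt_third_iff (hγ : 1 < γ) : a γ < 1 / 3 ↔ γ < 2 := by
  rw [a, div_lt_iff₀ (by linarith)]
  constructor <;> intro h <;> linarith

lemma mem_hDomain_iff (hγ : 1 < γ) {x : ℝ} : x ∈ hDomain γ ↔ FDom (a γ) x := by
  have h1 := a_lt_quarter_iff hγ
  have h2 := quarter_lt_a_iff hγ
  rw [← not_iff_not, not_lt, not_lt] at h1
  constructor
  · rintro (⟨-, h⟩ | ⟨hg, h⟩ | ⟨hg, h⟩)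
    · exact Or.inl h
    · exact h.lt_or_eq.imp_right fun e => Or.inl ⟨e.symm, h1.2 hg.ge⟩
    · rcases lt_trichotomy x 1 with hx | hx | hx
      · exact Or.inr (Or.inr ⟨h, hx, h2.2 hg⟩)
      · exact Or.inr (Or.inl ⟨hx, (h2.2 hg).le⟩)
      · exact Or.inl hx
  · rintro (h | ⟨rfl, h⟩ | ⟨h, -, h'⟩)
    · rcases lt_trichotomy γ (5 / 3) with hg | hg | hg
      · exact Or.inl ⟨hg, h⟩
      · exact Or.inr (Or.inl ⟨hg, h.le⟩)
      · exact Or.inr (Or.inr ⟨hg, by linarith⟩)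
    · rcases (h1.1 h).eq_or_lt with hg | hg
      · exact Or.inr (Or.inl ⟨hg.symm, le_rfl⟩)
      · exact Or.inr (Or.inr ⟨hg, one_pos⟩)
    · exact Or.inr (Or.inr ⟨h2.1 h', h⟩)

lemma alpha_eq_zero_iff (hγ : 1 < γ) {y₀ : ℝ}
    (hs : ∀ q, 0 < q → q ≠ 1 → (0 < gap (a γ) q * (q - 1) ↔ y₀ < q) ∧
      (gap (a γ) q * (q - 1) < 0 ↔ q < y₀)) {q : ℝ} (hq : 0 < q) :
    alpha γ q = 0 ↔ q = 1 ∨ q = y₀ := by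
  have h0 := a_pos hγ
  rw [alpha_eq hγ hq, neg_eq_zero, mul_eq_zero, or_iff_right (nu_pos hγ).ne']
  rcases eq_or_ne q 1 with rfl | hq1
  · simp [bwd, vel_one, imp_one]
  · rw [(bwd_hyperbola h0 hs hq hq1).2, or_iff_right hq1]

/-- The contact produced by an incoming shock and rarefaction, and the entropy increase that
replaces it in the presence of a vacuum. -/
lemma contact_of_mixed (hγ : 1 < γ) {U : GasState} (hU : U.Physical) {x y : ℝ}
    (h : IsSR x y ∨ IsRS x y) :
    (∀ B C F, Outgoing γ U x y B C F → 1 < C) ∧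
      ∀ K cv : ℝ, 0 < K → 0 < cv →
        specificEntropy γ K cv U < specificEntropy γ K cv (rightState γ U x y) := by
  have h0 := a_pos hγ
  have h1 := a_lt_one hγ
  have hx : 0 < x := by
    rcases h with h | h
    · linarith [h.1]
    · exact h.1
  have hy : 0 < y := by
    rcases h with h | h
    · exact h.2.1
    · linarith [h.2.2]
  constructor
  · intro B C F hO
    obtain ⟨hF, -, -, hv⟩ := (outgoing_iff hγ hU hx hy).1 hO
    have hG : 0 < 1 / F := by positivity
    refine (contact_iff hγ hU hx hy hO).2.2 ?_
    rcases h with h | h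
    · exact entropy_SR h0 h1 h.1 hy h.2.2 hG hv
    · exact entropy_RS h0 h1 hx h.2.1 h.2.2 hG hv
  · intro K cv hK hcv
    refine entropy_increase hγ hU hx hy ?_ hK hcv
    rcases h with h | h
    · exact add_pos_of_pos_of_nonneg (logExc_pos h0 h1 h.1) (logExc_nonneg h0 h1 hy)
    · exact add_pos_of_nonneg_of_pos (logExc_nonneg h0 h1 hx) (logExc_pos h0 h1 h.2.2)

lemma yHat_pos_lt_one (hγ : 1 < γ) : 0 < yHat γ ∧ yHat γ < 1 := by
  have hz : 0 < zeta γ := zet_pos (a_pos hγ)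
  have hz2 : zeta γ < 1 / 2 := zet_lt_half (a_pos hγ) (a_lt_one hγ)
  have hs := Real.sqrt_pos.2 hz
  have hs1 : √(zeta γ) < 1 := by rw [Real.sqrt_lt' one_pos]; linarith
  exact ⟨Real.rpow_pos_of_pos (by linarith) _,
    Real.rpow_lt_one (by linarith) (by linarith) (by positivity)⟩

end Parameters

end Overtaking

end

theorem mainTheorem1 (γ : ℝ) (hγ : 1 < γ) :
    -- the interaction problem is well posed
    (∀ U : Overtaking.GasState, U.Physical → ∀ x y : ℝ, Overtaking.IncomingRegion x y →
      (Overtaking.ProducesVacuum γ U x y ∧ ¬ ∃ B C F, Overtaking.Outgoing γ U x y B C F) ∨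
      (¬ Overtaking.ProducesVacuum γ U x y ∧
        ∃! w : ℝ × ℝ × ℝ, Overtaking.Outgoing γ U x y w.1 w.2.1 w.2.2)) ∧
    ∃ (y₀ : ℝ) (k h : ℝ → ℝ) (yStar : ℝ),
      -- the root `y₀` of `α`
      (0 < y₀ ∧ (y₀ = 1 ↔ γ = 5 / 3) ∧
        ∀ q : ℝ, 0 < q → (Overtaking.alpha γ q = 0 ↔ q = 1 ∨ q = y₀)) ∧
      -- (i) the outgoing backward wave
      (ContDiffOn ℝ 2 k (Ioi 0) ∧ StrictAntiOn k (Ioi 0) ∧ k 1 = 1 ∧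
        Tendsto k (𝓝[>] 0) atTop ∧
        Tendsto k atTop (𝓝 (Overtaking.yHat γ)) ∧
        0 < Overtaking.yHat γ ∧ Overtaking.yHat γ < 1 ∧
        ∀ U : Overtaking.GasState, U.Physical → ∀ x y : ℝ, Overtaking.IncomingRegion x y →
          ((∃ C F, Overtaking.Outgoing γ U x y 1 C F) ↔ y = k x) ∧
          (Overtaking.BackwardShock γ U x y ↔ k x < y)) ∧
      -- (ii) the outgoing forward wave
      (ContinuousOn h (Overtaking.hDomain γ) ∧
        (∀ x ∈ Overtaking.hDomain γ, 0 < h x) ∧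
        (∀ U : Overtaking.GasState, U.Physical → ∀ x y : ℝ, Overtaking.IncomingRegion x y →
          ((∃ B C, Overtaking.Outgoing γ U x y B C 1) ↔
            x = 1 ∨ y = 1 ∨ (x ∈ Overtaking.hDomain γ ∧ y = h x))) ∧
        -- location of the graph of `h` relative to the line `y = 1`
        (γ ≤ 5 / 3 → ∀ x : ℝ, 1 < x → h x < 1) ∧
        (5 / 3 < γ → γ < 2 → 1 < Overtaking.xBar γ ∧
          ∀ x : ℝ, 0 < x → (h x < 1 ↔ Overtaking.xBar γ < x) ∧
            (h x = 1 ↔ x = Overtaking.xBar γ)) ∧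
        (2 ≤ γ → ∀ x : ℝ, 0 < x → 1 < h x) ∧
        -- type of the outgoing forward wave
        (∀ U : Overtaking.GasState, U.Physical → ∀ x y : ℝ,
          (Overtaking.IsSS x y →
            (Overtaking.ForwardRarefaction γ U x y ↔ h x < y) ∧
            (Overtaking.ForwardShock γ U x y ↔ y < h x)) ∧
          (Overtaking.IsSR x y →
            (Overtaking.ForwardRarefaction γ U x y ↔ y < h x) ∧
            (Overtaking.ForwardShock γ U x y ↔ h x < y)) ∧
          (Overtaking.IsRS x y →
            (γ ≤ 5 / 3 → Overtaking.ForwardShock γ U x y) ∧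
            (5 / 3 < γ →
              (Overtaking.ForwardRarefaction γ U x y ↔ y < h x) ∧
              (Overtaking.ForwardShock γ U x y ↔ h x < y)))) ∧
        -- horizontal asymptote
        Tendsto h atTop (𝓝 yStar) ∧
        Overtaking.yHat γ < yStar ∧ (γ < 2 → yStar < 1) ∧
        (2 ≤ γ → yStar = 4 * Overtaking.a γ ^ 2 / (1 - Overtaking.a γ) ^ 2) ∧
        -- intersection with the graph of `k`
        1 / y₀ ∈ Overtaking.hDomain γ ∧ h (1 / y₀) = y₀ ∧ k (1 / y₀) = y₀ ∧
        (∀ x ∈ Overtaking.hDomain γ,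
          (h x = k x ↔ x = 1 / y₀) ∧ (h x < k x ↔ x < 1 / y₀))) ∧
      -- (iii) the outgoing contact
      (∀ U : Overtaking.GasState, U.Physical → ∀ x y : ℝ,
        (Overtaking.IsSS x y → ∀ B C F, Overtaking.Outgoing γ U x y B C F → C < 1) ∧
        (Overtaking.IsSR x y ∨ Overtaking.IsRS x y →
          (∀ B C F, Overtaking.Outgoing γ U x y B C F → 1 < C) ∧
          (Overtaking.ProducesVacuum γ U x y → ∀ K cv : ℝ, 0 < K → 0 < cv →
            Overtaking.specificEntropy γ K cv U <
              Overtaking.specificEntropy γ K cv (Overtaking.rightState γ U x y)))) ∧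
      -- (iv) vacuum formation
      (∀ U : Overtaking.GasState, U.Physical → ∀ x y : ℝ,
        (Overtaking.IsSS x y ∨ Overtaking.IsRS x y → ¬ Overtaking.ProducesVacuum γ U x y) ∧
        (Overtaking.IsSR x y →
          (Overtaking.ProducesVacuum γ U x y ↔
            y ≤ (1 / 2 * (1 - Overtaking.vFun γ x / Overtaking.nu γ)) ^
              (1 / Overtaking.zeta γ)))) := by
  have h0 := Overtaking.a_pos hγ
  have h1 := Overtaking.a_lt_one hγ
  have q1 := Overtaking.a_lt_quarter_iff hγ
  have q2 := Overtaking.quarter_lt_a_iff hγ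
  have q3 := Overtaking.a_lt_third_iff hγ
  have pos : ∀ {x y : ℝ}, Overtaking.IncomingRegion x y → 0 < x ∧ 0 < y := fun h => ⟨h.1, h.2.1⟩
  refine ⟨fun U hU x y hxy =>
    Overtaking.vacuum_or_existsUnique hγ hU (pos hxy).1 (pos hxy).2, ?_⟩
  obtain ⟨y₀, hy₀, hlt, heq, hgt, hs⟩ := Overtaking.exists_gap_root h0 h1
  obtain ⟨k, kC, kanti, k1, k0, kinf, hk⟩ := Overtaking.exists_backward_locus h0 h1
  obtain ⟨h, hh, hloc⟩ := Overtaking.exists_forward_branch h0 h1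
  obtain ⟨yS, hyS, hyh, hyS1, hyS2, hlim⟩ := Overtaking.exists_asymptote h0 h1
  obtain ⟨cd, ch, ck, cmp⟩ := Overtaking.loci_crossing h0 hy₀ hlt heq hgt hs k1 kanti hk hh
  have hdom : Overtaking.hDomain γ = {x | Overtaking.FDom (Overtaking.a γ) x} :=
    Set.ext fun x => Overtaking.mem_hDomain_iff hγ
  refine ⟨y₀, k, h, yS, ⟨hy₀, ?_, fun q hq => Overtaking.alpha_eq_zero_iff hγ hs hq⟩,
    ⟨kC, kanti, k1, k0, kinf, (Overtaking.yHat_pos_lt_one hγ).1, (Overtaking.yHat_pos_lt_one hγ).2,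
      fun U hU x y hxy => ?_⟩,
    ⟨?_, ?_, ?_, ?_, ?_, ?_, ?_, ?_, hyh, ?_, ?_, ?_, ch, ck, ?_⟩, ?_, ?_⟩
  · constructor
    · intro e
      refine le_antisymm (not_lt.1 fun h' => ?_) (not_lt.1 fun h' => ?_)
      · linarith [hgt (q2.2 h')]
      · linarith [hlt (q1.2 h')]
    · rintro rfl
      exact heq (le_antisymm (not_lt.1 fun h' => lt_irrefl _ (q2.1 h'))
        (not_lt.1 fun h' => lt_irrefl _ (q1.1 h')))
  · obtain ⟨hx, hy⟩ := pos hxy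
    rw [Overtaking.backward_trivial_iff hγ hU hx hy, Overtaking.backwardShock_iff hγ hU hx hy]
    exact (hk x hx).2 y hy
  · rw [hdom]
    exact Overtaking.continuousOn_branch h0 hh
  · intro x hx
    exact (hh x ((Overtaking.mem_hDomain_iff hγ).1 hx)).1
  · intro U hU x y hxy
    rw [Overtaking.forward_trivial_iff hγ hU (pos hxy).1 (pos hxy).2,
      Overtaking.mem_hDomain_iff hγ]
    exact Overtaking.fwd_eq_zero_iff h0 h1 hh (pos hxy).1 (pos hxy).2 hxy.2.2
  · intro hg x hx
    have ha : Overtaking.a γ ≤ 1 / 4 := not_lt.1 fun h' => hg.not_gt (q2.1 h')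
    refine (hloc x hx).1.2 ?_
    nlinarith
  · intro hg hg2
    have ha := q2.2 hg
    have ha3 := q3.2 hg2
    have hpos : 0 < 1 - 3 * Overtaking.a γ := by linarith
    have hb : 1 < Overtaking.xBar γ := by
      rw [Overtaking.xBar, lt_div_iff₀ hpos]
      nlinarith
    refine ⟨hb, fun x hx => ?_⟩
    rcases lt_or_ge 1 x with hx1 | hx1
    · rw [(hloc x hx1).1, (hloc x hx1).2, Overtaking.xBar, div_lt_iff₀ hpos, eq_div_iff hpos.ne',
        mul_comm x, eq_comm]
      exact ⟨Iff.rfl, Iff.rfl⟩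
    · have hd : Overtaking.FDom (Overtaking.a γ) x :=
        (Overtaking.mem_hDomain_iff hγ).1 (Or.inr (Or.inr ⟨hg, hx⟩))
      have : 1 < h x := by
        rcases (hh x hd).2.1 hx1 with ⟨e, -⟩ | ⟨-, h'⟩
        · exact absurd e ha.ne'
        · exact h'
      constructor <;> constructor <;> intro h' <;> linarith
  · intro hg x hx
    have ha3 : 1 / 3 ≤ Overtaking.a γ := not_lt.1 fun h' => hg.not_gt (q3.1 h')
    rcases lt_or_ge 1 x with hx1 | hx1
    · obtain ⟨e1, e2⟩ := hloc x hx1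
      have hle : (1 - 3 * Overtaking.a γ) * x < 4 * Overtaking.a γ ^ 2 := by nlinarith
      refine lt_of_le_of_ne (not_lt.1 fun h' => ?_) fun h' => ?_
      · exact hle.not_gt (e1.1 h')
      · exact hle.ne' (e2.1 h'.symm)
    · have hd : Overtaking.FDom (Overtaking.a γ) x :=
        (Overtaking.mem_hDomain_iff hγ).1 (Or.inr (Or.inr ⟨by linarith, hx⟩))
      rcases (hh x hd).2.1 hx1 with ⟨e, -⟩ | ⟨-, h'⟩
      · linarith
      · exact h'
  · intro U hU x y
    refine ⟨fun hi => ?_, fun hi => ?_, fun hi => ⟨fun hg => ?_, fun hg => ?_⟩⟩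
    · have hx : 0 < x := by linarith [hi.1]
      have hy : 0 < y := by linarith [hi.2]
      rw [Overtaking.forwardRarefaction_iff hγ hU hx hy, Overtaking.forwardShock_iff hγ hU hx hy]
      exact hh.sign_gt_gt hi.1 hi.2
    · have hx : 0 < x := by linarith [hi.1]
      rw [Overtaking.forwardRarefaction_iff hγ hU hx hi.2.1,
        Overtaking.forwardShock_iff hγ hU hx hi.2.1]
      exact (hh.sign_gt_lt hi.1 hi.2.1 hi.2.2).symm
    · have hy : 0 < y := by linarith [hi.2.2]
      rw [Overtaking.forwardShock_iff hγ hU hi.1 hy]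
      exact Overtaking.fwd_neg_of_lt h0 h1 (not_lt.1 fun h' => hg.not_gt (q2.1 h')) hi.1 hi.2.1
        hi.2.2
    · have hy : 0 < y := by linarith [hi.2.2]
      rw [Overtaking.forwardRarefaction_iff hγ hU hi.1 hy,
        Overtaking.forwardShock_iff hγ hU hi.1 hy]
      exact (hh.sign_lt ((Overtaking.mem_hDomain_iff hγ).1 (Or.inr (Or.inr ⟨hg, hi.1⟩)))
        hi.2.1 hi.2.2).symm
  · exact Overtaking.tendsto_branch h0 hyS hlim fun x hx y hy hy1 => hh.sign_gt hx hy hy1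
  · exact fun hg => hyS1 (q3.2 hg)
  · exact fun hg => hyS2 (not_lt.1 fun h' => hg.not_gt (q3.1 h'))
  · exact (Overtaking.mem_hDomain_iff hγ).2 cd
  · exact fun x hx => cmp x ((Overtaking.mem_hDomain_iff hγ).1 hx)
  · intro U hU x y
    refine ⟨fun hi B C F hO => ?_, fun hi => ?_⟩
    · have hx : 0 < x := by linarith [hi.1]
      have hy : 0 < y := by linarith [hi.2]
      obtain ⟨hF, -, -, hv⟩ := (Overtaking.outgoing_iff hγ hU hx hy).1 hO
      exact (Overtaking.contact_iff hγ hU hx hy hO).1.2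
        (Overtaking.entropy_SS h0 h1 hi.1 hi.2 (by positivity) hv)
    · obtain ⟨hC, hS⟩ := Overtaking.contact_of_mixed hγ hU hi
      exact ⟨hC, fun _ => hS⟩
  · intro U hU x y
    refine ⟨?_, fun hi => Overtaking.vacuum_SR_iff hγ hU hi⟩
    rintro (hi | hi)
    · exact Overtaking.not_vacuum_SS_RS hγ hU (by linarith [hi.1]) hi.2
    · exact Overtaking.not_vacuum_SS_RS hγ hU hi.1 hi.2.2
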